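/- **Conventions.** Let $\mathbb{T}^2=\mathbb{R}^2/\mathbb{Z}^2\subset\mathbb{C}^2/\mathbb{Z}^2$, $S^1=\mathbb{R}/\mathbb{Z}\subset\mathbb{C}/\mathbb{Z}$, and $A(r)=\{z\in\mathbb{C}/\mathbb{Z} : |\operatorname{Im} z|<r\}$ for $r>0$; let $P_x$ denote the projection to the first coordinate. A Hamiltonian diffeomorphism of $\mathbb{T}^2$ is a finite composition of time-one maps of Hamiltonian flows of real-analytic time-dependent Hamiltonian functions on $\mathbb{T}^2$, with respect to $dx\wedge dy$. For an open neighborhood $U$ of $\mathbb{T}^2$ in $\mathbb{C}^2/\mathbb{Z}^2$, let $\mathrm{Ham}^\omega_U(\mathbb{T}^2)$ be the set of holomorphic maps $U\to\mathbb{C}^2/\mathbb{Z}^2$ which restrict to a Hamiltonian diffeomorphism of $\mathbb{T}^2$, with the topology of uniform convergence on compact subsets of $U$; for $V\subset U$, an element of $\mathrm{Ham}^\omega_U(\mathbb{T}^2)$ is regarded as an element of $\mathrm{Ham}^\omega_V(\mathbb{T}^2)$ by restriction. A *graph KAM curve* of $f\in\mathrm{Ham}^\omega_U(\mathbb{T}^2)$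 with rotation number $\theta\in\mathbb{R}$ is a holomorphic map $\varphi:A(r)\to U$ with $\varphi(S^1)\subset\mathbb{T}^2$ such that $f(\varphi(z))=\varphi(z+\theta)$ for all $z\in A(r)$, $P_x\circ\varphi$ is a holomorphic diffeomorphism of $A(r)$ onto its image, and $\frac{\partial}{\partial y}(P_x\circ f)>0$ on $\varphi(S^1)$. Put $U_{\varphi,r'}=\{(z_1,z_2)\in U : z_1\in P_x\circ\varphi(A(r'))\}$ for $0<r'\le r$. For $n\ge 1$, let $\mathrm{Per}_h(f,n)$ (resp. $\mathrm{Per}_e(f,n)$) be the set of points $p\in\mathbb{T}^2$ of least period $n$ under $f$ such that $Df^n_p$ has no eigenvalue of modulus one (resp. has only non-real eigenvalues of modulus one). **Proposition.** Let $U_0$ be an open neighborhood of $\mathbb{T}^2$ in $\mathbb{C}^2/\mathbb{Z}^2$, $f_0\in\mathrm{Ham}^\omega_{U_0}(\mathbb{T}^2)$, $r_0>r'>r_1>0$ real numbers, $\varphi_0:A(r_0)\to U_0$ a graph KAM curve of $f_0$ (with some rotation number $\theta\in\mathbb{R}$), and $K$ a compact subset of $(U_0)_{\varphi_0,r_1}$.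 Then there exists an open neighborhood $U_1\subset U_0$ of $\mathbb{T}^2$ such that 1. the closure of $U_1$ in $\mathbb{C}^2/\mathbb{Z}^2$ is compact; 2. $\varphi_0(A(r'))\subset U_1$ and $K\subset (U_1)_{\varphi_0,r_1}$; 3. for any sequence $(\gamma_n)_{n\ge1}$ of positive integers, any $n_0\ge 1$, and any neighborhood $\mathcal{U}$ of $f_0$ in $\mathrm{Ham}^\omega_{U_1}(\mathbb{T}^2)$, there exist $f_1\in\mathcal{U}$ and $n_1>n_0$ such that $$\min\{\#\mathrm{Per}_h(f_1,n_1),\ \#\mathrm{Per}_e(f_1,n_1)\}\ \ge\ n_1\cdot\gamma_{n_1}.$$ -/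

import Mathlib

open Set Filter Topology

noncomputable section

/-! ### The tori `ℝ²/ℤ²` and `ℂ²/ℤ²`, and the cylinder `ℂ/ℤ` -/

/-- The two-dimensional torus `𝕋² = ℝ²/ℤ² = (ℝ/ℤ) × (ℝ/ℤ)`. -/
abbrev RTorus : Type := AddCircle (1 : ℝ) × AddCircle (1 : ℝ)

/-- The cylinder `ℂ/ℤ`. -/
abbrev CCyl : Type := AddCircle (1 : ℂ)

/-- The complex surface `ℂ²/ℤ² = (ℂ/ℤ) × (ℂ/ℤ)`. -/
abbrev CTorus : Type := CCyl × CCyl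

/-- The covering projection `ℝ² → ℝ²/ℤ²`. -/
def projR (p : ℝ × ℝ) : RTorus := ((p.1 : AddCircle (1 : ℝ)), (p.2 : AddCircle (1 : ℝ)))

/-- The covering projection `ℂ² → ℂ²/ℤ²`. -/
def projC (p : ℂ × ℂ) : CTorus := ((p.1 : CCyl), (p.2 : CCyl))

/-- The inclusion `ℝ/ℤ → ℂ/ℤ` induced by `ℝ ⊆ ℂ`. -/
def circleIncl : AddCircle (1 : ℝ) →+ CCyl :=
  QuotientAddGroup.map _ _ Complex.ofRealHom.toAddMonoidHom (by
    rw [AddSubgroup.zmultiples_le]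
    exact ⟨1, by simp⟩)

/-- The inclusion `𝕋² = ℝ²/ℤ² → ℂ²/ℤ²`. -/
def torusIncl (p : RTorus) : CTorus := (circleIncl p.1, circleIncl p.2)

/-- The torus `𝕋²` as a subset of `ℂ²/ℤ²`. -/
def realTorus : Set CTorus := Set.range torusIncl

/-- `f : 𝕋² → 𝕋²` is differentiable at `p` with derivative `D` (in the standard trivialisation of
the tangent bundle): near a point `x` over `p`, the map `f` has a lift `G` to `ℝ²` with
derivative `D` at `x`. -/
def HasTorusDerivAt (f : RTorus → RTorus) (D : ℝ × ℝ →L[ℝ] ℝ × ℝ) (p : RTorus) : Prop :=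
  ∃ (x : ℝ × ℝ) (G : ℝ × ℝ → ℝ × ℝ), projR x = p ∧
    (∀ᶠ y in 𝓝 x, projR (G y) = f (projR y)) ∧ HasFDerivAt G D x

/-! ### Hamiltonian diffeomorphisms of `𝕋²` -/

/-- A real-analytic time-dependent Hamiltonian function `H(t, x, y)` on `𝕋²`, written as a function
on `ℝ × ℝ²` which is `ℤ²`-periodic in `(x, y)`. -/
structure IsAnalyticHamiltonian (H : ℝ × ℝ × ℝ → ℝ) : Prop where
  analytic : AnalyticOnNhd ℝ H Set.univ
  periodic_fst : ∀ t x y : ℝ, H (t, x + 1, y) = H (t, x, y)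
  periodic_snd : ∀ t x y : ℝ, H (t, x, y + 1) = H (t, x, y)

/-- The Hamiltonian vector field `(∂H/∂y, -∂H/∂x)` of `H(t, ·)` for the area form `dx ∧ dy`. -/
def hamVectorField (H : ℝ × ℝ × ℝ → ℝ) (t : ℝ) (p : ℝ × ℝ) : ℝ × ℝ :=
  (deriv (fun y : ℝ => H (t, p.1, y)) p.2, -deriv (fun x : ℝ => H (t, x, p.2)) p.1)

/-- `f : 𝕋² → 𝕋²` is the time-one map of the Hamiltonian flow of `H`: each point `q` of `ℝ²` is the
starting point of an integral curve on `[0, 1]` whose end point projects to the image of `q`. -/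
def IsTimeOneMap (H : ℝ × ℝ × ℝ → ℝ) (f : RTorus → RTorus) : Prop :=
  ∀ q : ℝ × ℝ, ∃ c : ℝ → ℝ × ℝ, c 0 = q ∧
    (∀ t ∈ Set.Icc (0 : ℝ) 1,
      HasDerivWithinAt c (hamVectorField H t (c t)) (Set.Icc (0 : ℝ) 1) t) ∧
    f (projR q) = projR (c 1)

/-- Real-analytic Hamiltonian diffeomorphisms of `𝕋²`: finite compositions of time-one maps of
Hamiltonian flows of real-analytic time-dependent Hamiltonian functions. -/
inductive IsHamDiffeo : (RTorus → RTorus) → Prop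
  | timeOne (H : ℝ × ℝ × ℝ → ℝ) (f : RTorus → RTorus) (hH : IsAnalyticHamiltonian H)
      (hf : IsTimeOneMap H f) : IsHamDiffeo f
  | comp (f g : RTorus → RTorus) (hf : IsHamDiffeo f) (hg : IsHamDiffeo g) : IsHamDiffeo (f ∘ g)

/-! ### Holomorphic maps and the spaces `Ham^ω_U(𝕋²)` -/

/-- A map `F` from an open subset `U` of `ℂ²/ℤ²` to `ℂ²/ℤ²` is holomorphic: around each point it
lifts to a complex differentiable map between open subsets of `ℂ²`. -/
def IsHolomorphicMap {U : Set CTorus} (F : U → CTorus) : Prop :=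
  ∀ x : ℂ × ℂ, projC x ∈ U → ∃ G : ℂ × ℂ → ℂ × ℂ,
    (∀ᶠ y in 𝓝 x, DifferentiableAt ℂ G y) ∧
    (∀ᶠ y in 𝓝 x, ∀ hy : projC y ∈ U, projC (G y) = F ⟨projC y, hy⟩)

/-- For an open neighbourhood `U` of `𝕋²` in `ℂ²/ℤ²`, the set `Ham^ω_U(𝕋²)` of Hamiltonian
diffeomorphisms `f` of `𝕋²` together with a holomorphic extension of `f` to `U`
(the extension is unique when `U` is connected). -/
structure HamOn (U : Set CTorus) where
  /-- The Hamiltonian diffeomorphism of `𝕋²`. -/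
  toMap : RTorus → RTorus
  isHam : IsHamDiffeo toMap
  /-- Its holomorphic extension to `U`. -/
  ext : C(U, CTorus)
  holomorphic : IsHolomorphicMap ext
  extends_toMap : ∀ (p : RTorus) (hp : torusIncl p ∈ U), ext ⟨torusIncl p, hp⟩ = torusIncl (toMap p)

/-- The topology of `Ham^ω_U(𝕋²)` as a subset of the space of holomorphic maps `U → ℂ²/ℤ²`, which
carries the topology of uniform convergence on compact subsets of `U` (the compact-open
topology). -/
instance HamOn.instTopologicalSpace (U : Set CTorus) : TopologicalSpace (HamOn U) :=
  TopologicalSpace.induced HamOn.ext ContinuousMap.compactOpen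

/-- An element of `Ham^ω_U(𝕋²)`, regarded as an element of `Ham^ω_V(𝕋²)` for `V ⊆ U`. -/
def HamOn.restrict {U V : Set CTorus} (h : V ⊆ U) (f : HamOn U) : HamOn V where
  toMap := f.toMap
  isHam := f.isHam
  ext := f.ext.comp ⟨Set.inclusion h, continuous_inclusion h⟩
  holomorphic := by
    intro x hx
    obtain ⟨G, hG, hl⟩ := f.holomorphic x (h hx)
    exact ⟨G, hG, hl.mono fun y hy hyV => hy (h hyV)⟩
  extends_toMap := fun p hp => f.extends_toMap p (h hp)

/-! ### Graph KAM curves -/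

/-- The annulus `A(r) = {z ∈ ℂ/ℤ : |Im z| < r}`. -/
def annulus (r : ℝ) : Set CCyl := (fun w : ℂ => (w : CCyl)) '' {w : ℂ | |w.im| < r}

/-- The map `φ` is holomorphic on `A(r)` with values in `ℂ²/ℤ²`: it has holomorphic local lifts. -/
def IsHolomorphicCurve (r : ℝ) (φ : CCyl → CTorus) : Prop :=
  ∀ x : ℂ, |x.im| < r → ∃ G : ℂ → ℂ × ℂ,
    (∀ᶠ y in 𝓝 x, DifferentiableAt ℂ G y) ∧ (∀ᶠ y in 𝓝 x, projC (G y) = φ (y : CCyl))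

/-- The map `u` restricts to a holomorphic diffeomorphism of `A(r)` onto its image in `ℂ/ℤ`: it is
injective on `A(r)`, and locally holomorphic there with nowhere vanishing derivative. -/
def IsBiholomorphicOntoImage (r : ℝ) (u : CCyl → CCyl) : Prop :=
  Set.InjOn u (annulus r) ∧
  ∀ x : ℂ, |x.im| < r → ∃ G : ℂ → ℂ,
    (∀ᶠ y in 𝓝 x, DifferentiableAt ℂ G y) ∧ (∀ᶠ y in 𝓝 x, (G y : CCyl) = u (y : CCyl)) ∧
    deriv G x ≠ 0

/-- `φ : A(r) → U` is a graph KAM curve of `f ∈ Ham^ω_U(𝕋²)` with rotation number `θ`.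
Only the values of `φ` on `A(r)` matter. -/
structure IsGraphKAMCurve {U : Set CTorus} (f : HamOn U) (θ r : ℝ) (φ : CCyl → CTorus) : Prop where
  holomorphic : IsHolomorphicCurve r φ
  mapsTo : Set.MapsTo φ (annulus r) U
  /-- The circle `S¹ = ℝ/ℤ` is mapped into `𝕋²`. -/
  real : ∀ s : AddCircle (1 : ℝ), φ (circleIncl s) ∈ realTorus
  /-- `f ∘ φ (z) = φ (z + θ)` on `A(r)`. -/
  conj : ∀ (z : CCyl) (hz : z ∈ annulus r), f.ext ⟨φ z, mapsTo hz⟩ = φ (z + ((θ : ℂ) : CCyl))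
  /-- `P_x ∘ φ` is a diffeomorphism from `A(r)` onto its image. -/
  graph : IsBiholomorphicOntoImage r (fun z => (φ z).1)
  /-- The twist condition `∂/∂y (P_x ∘ f) > 0` on `φ(S¹)`. -/
  twist : ∀ (s : AddCircle (1 : ℝ)) (p : RTorus), torusIncl p = φ (circleIncl s) →
    ∃ D : ℝ × ℝ →L[ℝ] ℝ × ℝ, HasTorusDerivAt f.toMap D p ∧ 0 < (D (0, 1)).1

/-- `U_{φ,r} = {(z₁, z₂) ∈ U : z₁ ∈ P_x ∘ φ (A(r))}`. -/
def overCurve (U : Set CTorus) (φ : CCyl → CTorus) (r : ℝ) : Set CTorus :=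
  {z | z ∈ U ∧ z.1 ∈ (fun w => (φ w).1) '' annulus r}

/-! ### Hyperbolic and elliptic periodic points -/

/-- No complex eigenvalue has modulus one. -/
def IsHyperbolicMap (D : ℝ × ℝ →L[ℝ] ℝ × ℝ) : Prop :=
  ∀ μ ∈ (D : ℝ × ℝ →ₗ[ℝ] ℝ × ℝ).charpoly.aroots ℂ, ‖μ‖ ≠ 1

/-- The complex eigenvalues are non-real and have modulus one. -/
def IsEllipticMap (D : ℝ × ℝ →L[ℝ] ℝ × ℝ) : Prop :=
  ∀ μ ∈ (D : ℝ × ℝ →ₗ[ℝ] ℝ × ℝ).charpoly.aroots ℂ, ‖μ‖ = 1 ∧ μ.im ≠ 0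

/-- For `n ≥ 1`, the set of hyperbolic periodic points of `f` of least period `n`. -/
def perHyp (f : RTorus → RTorus) (n : ℕ) : Set RTorus :=
  {p | Function.minimalPeriod f p = n ∧
    ∃ D : ℝ × ℝ →L[ℝ] ℝ × ℝ, HasTorusDerivAt f^[n] D p ∧ IsHyperbolicMap D}

/-- For `n ≥ 1`, the set of elliptic periodic points of `f` of least period `n`. -/
def perEll (f : RTorus → RTorus) (n : ℕ) : Set RTorus :=
  {p | Function.minimalPeriod f p = n ∧
    ∃ D : ℝ × ℝ →L[ℝ] ℝ × ℝ, HasTorusDerivAt f^[n] D p ∧ IsEllipticMap D}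

end

open Set Filter Topology

set_option maxSynthPendingDepth 3

noncomputable section

/-! ### The covering projections -/

/-! A perturbation `f₁ = f₀ ∘ gE ∘ gV` is built so that the invariant curve carries the periodic
points. Lift the curve to `s ↦ (Φ s, Γ s)` on a strip. The map `gE` is a Hamiltonian diffeomorphism
close to the identity which preserves the curve and moves the parameter by a small `δ`. With `δ =
p/q - θ'`, where `θ'` is the rotation number up to orientation, `f₀ ∘ gE` rotates the curve by
`p/q`, so the curve consists of points of least period `q`. The map `gV` is a vertical shear by `ε`
times a function vanishing at the parameters in `(1/2M)ℤ`, `M = q * γ q`. This set is invariant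
under rotation by `p/q`, so its points keep their orbits, but their multipliers change.

In a frame of tangent and vertical vectors along the curve, the derivative of `f₀ ∘ gE` is `[[1, τ],
[0, 1]]` with `τ > 0`, by area preservation and positive twist, while that of `gV` is `[[1, 0], [k,
1]]` with `k = ± 2πMε`, the same sign along a whole orbit. The trace of the `q`-fold product exceeds
`2` for `k > 0` (`two_lt_shearTrace`) and lies in `(-2, 2)` for small `k < 0`
(`eventually_abs_shearTrace_lt_two`). Each sign occurs at `M` points, hence `q * γ q` hyperbolic and
as many elliptic points (`IsGraphLift.eventually_many_periodic_points`).

The delicate object is `gE`: it must be holomorphic over the part of `ℂ²/ℤ²` above the curve, and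
Hamiltonian. It is `IsGraphLift.translate`: the flow of a cosine of `y - height x`, whose level
through the curve is tuned so that the horizontal displacement is `Φ (s + δ) - Φ s`, followed by a
vertical shear returning the result to the curve. The shear is Hamiltonian because its profile has
an explicit periodic primitive (`IsGraphLift.exists_primitive_turn_sub`), an expression of the
vanishing of the flux. Only points above the image of `Φ` are allowed, which is why `U₁` is chosen
relatively compact there.

The constants are chosen in the order `η` (amplitude of the flow), then `δ`, hence `p` and `q`, then
`ε`. -/

theorem projC_add (p q : ℂ × ℂ) : projC (p + q) = projC p + projC q := rfl

theorem projC_surjective : Function.Surjective projC := by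
  rintro ⟨a, b⟩
  obtain ⟨x, rfl⟩ := QuotientAddGroup.mk_surjective a
  obtain ⟨y, rfl⟩ := QuotientAddGroup.mk_surjective b
  exact ⟨(x, y), rfl⟩

theorem projR_surjective : Function.Surjective projR := by
  rintro ⟨a, b⟩
  obtain ⟨x, rfl⟩ := QuotientAddGroup.mk_surjective a
  obtain ⟨y, rfl⟩ := QuotientAddGroup.mk_surjective b
  exact ⟨(x, y), rfl⟩

theorem isOpenMap_projC : IsOpenMap projC :=
  (QuotientAddGroup.isOpenMap_coe (N := AddSubgroup.zmultiples (1 : ℂ))).prodMap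
    (QuotientAddGroup.isOpenMap_coe (N := AddSubgroup.zmultiples (1 : ℂ)))

theorem continuous_projC : Continuous projC :=
  ((AddCircle.continuous_mk' (1 : ℂ)).comp continuous_fst).prodMk
    ((AddCircle.continuous_mk' (1 : ℂ)).comp continuous_snd)

theorem map_projC_nhds (p : ℂ × ℂ) : map projC (𝓝 p) = 𝓝 (projC p) :=
  isOpenMap_projC.map_nhds_eq continuous_projC.continuousAt

theorem coe_eq_coe_iff_exists_int {𝕜 : Type*} [Ring 𝕜] {a b : 𝕜} :
    (a : AddCircle (1 : 𝕜)) = b ↔ ∃ n : ℤ, a = b + n := by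
  rw [← sub_eq_zero, ← AddCircle.coe_sub, AddCircle.coe_eq_zero_iff]
  simp only [zsmul_one]
  exact exists_congr fun n => ⟨fun h => by rw [h]; abel, fun h => by rw [h]; abel⟩

theorem projC_eq_iff {p q : ℂ × ℂ} : projC p = projC q ↔ ∃ m n : ℤ, p = q + ((m : ℂ), (n : ℂ)) := by
  simp only [projC, coe_eq_coe_iff_exists_int, Prod.ext_iff, Prod.fst_add,
    Prod.snd_add]
  exact ⟨fun ⟨⟨m, h⟩, n, h'⟩ => ⟨m, n, h, h'⟩, fun ⟨m, n, h, h'⟩ => ⟨⟨m, h⟩, n, h'⟩⟩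

theorem projR_eq_iff {p q : ℝ × ℝ} : projR p = projR q ↔ ∃ m n : ℤ, p = q + ((m : ℝ), (n : ℝ)) := by
  simp only [projR, coe_eq_coe_iff_exists_int, Prod.ext_iff, Prod.fst_add,
    Prod.snd_add]
  exact ⟨fun ⟨⟨m, h⟩, n, h'⟩ => ⟨m, n, h, h'⟩, fun ⟨m, n, h, h'⟩ => ⟨⟨m, h⟩, n, h'⟩⟩

/-- The inclusion `ℝ² → ℂ²`. -/
def ofReal2 (p : ℝ × ℝ) : ℂ × ℂ := ((p.1 : ℂ), (p.2 : ℂ))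

theorem torusIncl_projR (p : ℝ × ℝ) : torusIncl (projR p) = projC (ofReal2 p) := rfl

theorem circleIncl_injective : Function.Injective circleIncl := by
  intro a b h
  obtain ⟨x, rfl⟩ := QuotientAddGroup.mk_surjective a
  obtain ⟨y, rfl⟩ := QuotientAddGroup.mk_surjective b
  obtain ⟨n, hn⟩ := coe_eq_coe_iff_exists_int.1 (h : ((x : ℂ) : CCyl) = ((y : ℂ) : CCyl))
  exact coe_eq_coe_iff_exists_int.2 ⟨n, by
    have hn' : (x : ℂ) = (y : ℂ) + n := hn
    exact_mod_cast hn'⟩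

theorem torusIncl_injective : Function.Injective torusIncl := fun _ _ h =>
  Prod.ext (circleIncl_injective (congrArg Prod.fst h)) (circleIncl_injective (congrArg Prod.snd h))

/-- A function with integer values near a point of continuity is locally constant there. -/
theorem eventually_eq_of_integer_valued {X 𝕜 : Type*} [TopologicalSpace X] [RCLike 𝕜]
    {u : X → 𝕜} {x : X} (hu : ContinuousAt u x) (h : ∀ᶠ y in 𝓝 x, ∃ n : ℤ, u y = n) :
    ∀ᶠ y in 𝓝 x, u y = u x := by
  obtain ⟨m, hm⟩ := h.self_of_nhds
  filter_upwards [h, hu (Metric.ball_mem_nhds _ one_pos)] with y ⟨n, hn⟩ hy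
  rw [mem_preimage, Metric.mem_ball, hm, hn, dist_eq_norm, ← Int.cast_sub,
    ← RCLike.ofReal_intCast, RCLike.norm_ofReal] at hy
  have : n - m = 0 := by
    rw [← Int.abs_lt_one_iff]; exact_mod_cast hy
  rw [hm, hn, sub_eq_zero.1 this]

theorem ContinuousOn.exists_int_const {𝕜 X : Type*} [RCLike 𝕜] [TopologicalSpace X] {S : Set X}
    {u : X → 𝕜} (hu : ContinuousOn u S) (hS : IsPreconnected S) (h : ∀ y ∈ S, ∃ n : ℤ, u y = n) :
    ∃ n : ℤ, ∀ y ∈ S, u y = n := by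
  rcases S.eq_empty_or_nonempty with rfl | ⟨x, hx⟩
  · exact ⟨0, by simp⟩
  obtain ⟨n, hn⟩ := h x hx
  refine ⟨n, fun y hy => ?_⟩
  have := isPreconnected_iff_preconnectedSpace.1 hS
  have hloc : IsLocallyConstant (fun z : S => u z) := by
    rw [IsLocallyConstant.iff_eventually_eq]
    intro z
    exact eventually_eq_of_integer_valued (continuousOn_iff_continuous_domRestrict.1 hu).continuousAt
      (Eventually.of_forall fun w => h w w.2)
  exact (hloc.apply_eq_of_preconnectedSpace ⟨y, hy⟩ ⟨x, hx⟩).trans hn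

/-! ### Hamiltonian diffeomorphisms preserve area -/

/-- The area form `dx ∧ dy`. -/
def areaForm (u v : ℝ × ℝ) : ℝ := u.1 * v.2 - u.2 * v.1

theorem abs_areaForm_le (u v : ℝ × ℝ) : |areaForm u v| ≤ 2 * ‖u‖ * ‖v‖ := by
  have h1 := norm_fst_le u
  have h2 := norm_snd_le u
  have h3 := norm_fst_le v
  have h4 := norm_snd_le v
  rw [Real.norm_eq_abs] at h1 h2 h3 h4
  calc |areaForm u v| ≤ |u.1 * v.2| + |u.2 * v.1| := abs_sub _ _
    _ = |u.1| * |v.2| + |u.2| * |v.1| := by rw [abs_mul, abs_mul]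
    _ ≤ ‖u‖ * ‖v‖ + ‖u‖ * ‖v‖ := by gcongr
    _ = _ := by ring

/-- Lipschitz maps of the plane which preserve the area of infinitesimal parallelograms, with a
uniform cubic error term. This notion is stable under composition and does not presuppose
differentiability. -/
def AlmostAreaPreserving (F : ℝ × ℝ → ℝ × ℝ) : Prop :=
  ∃ C : ℝ, 0 ≤ C ∧ ∀ q a b : ℝ × ℝ, ‖F (q + a) - F q‖ ≤ C * ‖a‖ ∧
    |areaForm (F (q + a) - F q) (F (q + b) - F q) - areaForm a b| ≤ C * (‖a‖ + ‖b‖) ^ 3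

theorem AlmostAreaPreserving.comp {F G : ℝ × ℝ → ℝ × ℝ} (hF : AlmostAreaPreserving F)
    (hG : AlmostAreaPreserving G) : AlmostAreaPreserving (F ∘ G) := by
  obtain ⟨C, hC, hF⟩ := hF
  obtain ⟨B, hB, hG⟩ := hG
  refine ⟨C * B + (C * B ^ 3 + B), by positivity, fun q a b => ?_⟩
  have key := hF (G q) (G (q + a) - G q) (G (q + b) - G q)
  simp only [add_sub_cancel] at key
  have ha := (hG q a b).1
  have hb := (hG q b b).1
  constructor
  · calc _ ≤ C * (B * ‖a‖) := key.1.trans (by gcongr)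
      _ ≤ _ := by
        rw [← mul_assoc]; gcongr; have : 0 ≤ C * B ^ 3 + B := by positivity
        linarith
  · calc _ ≤ _ := abs_sub_le _ (areaForm (G (q + a) - G q) (G (q + b) - G q)) _
      _ ≤ C * (B * ‖a‖ + B * ‖b‖) ^ 3 + B * (‖a‖ + ‖b‖) ^ 3 :=
        add_le_add (key.2.trans (by gcongr)) (hG q a b).2
      _ = (C * B ^ 3 + B) * (‖a‖ + ‖b‖) ^ 3 := by ring
      _ ≤ _ := mul_le_mul_of_nonneg_right (le_add_of_nonneg_left (by positivity)) (by positivity)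

theorem AlmostAreaPreserving.continuous {F : ℝ × ℝ → ℝ × ℝ} (hF : AlmostAreaPreserving F) :
    Continuous F := by
  obtain ⟨C, hC, hF⟩ := hF
  have : LipschitzWith (Real.toNNReal C) F := by
    refine LipschitzWith.of_dist_le_mul fun x y => ?_
    have := (hF y (x - y) 0).1
    rwa [add_sub_cancel, ← dist_eq_norm, ← dist_eq_norm, ← Real.coe_toNNReal C hC] at this
  exact this.continuous

theorem continuous_areaForm : Continuous fun p : (ℝ × ℝ) × (ℝ × ℝ) => areaForm p.1 p.2 := by
  unfold areaForm; fun_prop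

theorem areaForm_smul_smul (t : ℝ) (u v : ℝ × ℝ) :
    areaForm (t • u) (t • v) = t ^ 2 * areaForm u v := by
  simp [areaForm]; ring

/-- Applied to `t • u` and `t • v`, the cubic error divided by `t ^ 2` is still of order `|t|`, so
it disappears in the limit of difference quotients. -/
theorem AlmostAreaPreserving.areaForm_map_map {F : ℝ × ℝ → ℝ × ℝ} (hF : AlmostAreaPreserving F)
    {D : ℝ × ℝ →L[ℝ] ℝ × ℝ} {x : ℝ × ℝ} (hD : HasFDerivAt F D x) (u v : ℝ × ℝ) :
    areaForm (D u) (D v) = areaForm u v := by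
  obtain ⟨C, hC, hF⟩ := hF
  have hlim : ∀ w : ℝ × ℝ, Tendsto (fun t : ℝ => t⁻¹ • (F (x + t • w) - F x)) (𝓝[≠] 0) (𝓝 (D w)) :=
    fun w => (hD.hasLineDerivAt w).tendsto_slope_zero
  have h1 : Tendsto (fun t : ℝ => areaForm (t⁻¹ • (F (x + t • u) - F x))
      (t⁻¹ • (F (x + t • v) - F x)) - areaForm u v) (𝓝[≠] 0) (𝓝 (areaForm (D u) (D v) - areaForm u v)) :=
    ((continuous_areaForm.tendsto (D u, D v)).comp ((hlim u).prodMk_nhds (hlim v))).sub_const _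
  have h2 : Tendsto (fun t : ℝ => areaForm (t⁻¹ • (F (x + t • u) - F x))
      (t⁻¹ • (F (x + t • v) - F x)) - areaForm u v) (𝓝[≠] 0) (𝓝 0) := by
    have h3 : Tendsto (fun t : ℝ => C * (‖u‖ + ‖v‖) ^ 3 * |t|) (𝓝[≠] 0) (𝓝 0) := by
      have : Continuous (fun t : ℝ => C * (‖u‖ + ‖v‖) ^ 3 * |t|) := by fun_prop
      simpa using (this.tendsto 0).mono_left nhdsWithin_le_nhds
    refine squeeze_zero_norm' ?_ h3
    filter_upwards [self_mem_nhdsWithin] with t (ht : t ≠ 0)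
    have h4 := (hF x (t • u) (t • v)).2
    rw [areaForm_smul_smul, norm_smul, norm_smul, ← mul_add, mul_pow, Real.norm_eq_abs] at h4
    rw [areaForm_smul_smul, Real.norm_eq_abs]
    have ht' : 0 < |t| := abs_pos.2 ht
    have e : areaForm (F (x + t • u) - F x) (F (x + t • v) - F x) - t ^ 2 * areaForm u v
      = t ^ 2 * (t⁻¹ ^ 2 * areaForm (F (x + t • u) - F x) (F (x + t • v) - F x) - areaForm u v) := by
      field_simp
    rw [e, abs_mul, abs_of_nonneg (sq_nonneg t), ← sq_abs t] at h4
    have : |t| ^ 2 * |t⁻¹ ^ 2 * areaForm (F (x + t • u) - F x) (F (x + t • v) - F x) - areaForm u v|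
      ≤ |t| ^ 2 * (C * (‖u‖ + ‖v‖) ^ 3 * |t|) := h4.trans (le_of_eq (by ring))
    exact le_of_mul_le_mul_left this (by positivity)
  exact sub_eq_zero.1 (tendsto_nhds_unique h1 h2)

/-! #### Time-one maps -/

namespace IsAnalyticHamiltonian

variable {H : ℝ × ℝ × ℝ → ℝ}

theorem contDiff (hH : IsAnalyticHamiltonian H) : ContDiff ℝ ⊤ H :=
  contDiffOn_univ.1 (hH.analytic.contDiffOn uniqueDiffOn_univ)

theorem periodic_int (hH : IsAnalyticHamiltonian H) (z : ℝ × ℝ × ℝ) (m n : ℤ) :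
    H (z + (0, (m : ℝ), (n : ℝ))) = H z := by
  obtain ⟨t, x, y⟩ := z
  have h1 : Function.Periodic (fun x => H (t, x, y + n)) 1 := fun x => hH.periodic_fst t x _
  have h2 : Function.Periodic (fun y => H (t, x, y)) 1 := fun y => hH.periodic_snd t x y
  have e1 := h1.int_mul m x
  have e2 := h2.int_mul n y
  simp only [mul_one] at e1 e2
  simpa using e1.trans e2

/-- A function on `ℝ × ℝ²` which is continuous and `ℤ²`-periodic is bounded on `[0, 1] × ℝ²`. -/
theorem exists_bound_of_periodic {E : Type*} [NormedAddCommGroup E] {g : ℝ × ℝ × ℝ → E}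
    (hg : Continuous g) (hper : ∀ z, ∀ m n : ℤ, g (z + (0, (m : ℝ), (n : ℝ))) = g z) :
    ∃ M : ℝ, 0 ≤ M ∧ ∀ t ∈ Icc (0 : ℝ) 1, ∀ p, ‖g (t, p)‖ ≤ M := by
  have hK : IsCompact (Icc (0 : ℝ) 1 ×ˢ (Icc (0 : ℝ) 1 ×ˢ Icc (0 : ℝ) 1)) :=
    isCompact_Icc.prod (isCompact_Icc.prod isCompact_Icc)
  obtain ⟨M, hM⟩ := hK.exists_bound_of_continuousOn hg.continuousOn
  refine ⟨max M 0, le_max_right _ _, fun t ht p => le_max_of_le_left ?_⟩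
  have h := hM (t, Int.fract p.1, Int.fract p.2) ⟨ht,
    ⟨Int.fract_nonneg _, (Int.fract_lt_one _).le⟩, Int.fract_nonneg _, (Int.fract_lt_one _).le⟩
  rw [← hper _ ⌊p.1⌋ ⌊p.2⌋] at h
  simpa using h

theorem hamVectorField_eq (hH : IsAnalyticHamiltonian H) (t : ℝ) (p : ℝ × ℝ) :
    hamVectorField H t p = (fderiv ℝ H (t, p) (0, 0, 1), -fderiv ℝ H (t, p) (0, 1, 0)) := by
  have hd : HasFDerivAt H (fderiv ℝ H (t, p)) (t, p) :=
    (hH.contDiff.differentiable (by simp) _).hasFDerivAt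
  have h1 : HasDerivAt (fun y : ℝ => ((t, p.1, y) : ℝ × ℝ × ℝ)) (0, 0, 1) p.2 :=
    (hasDerivAt_const _ _).prodMk ((hasDerivAt_const _ _).prodMk (hasDerivAt_id _))
  have h2 : HasDerivAt (fun x : ℝ => ((t, x, p.2) : ℝ × ℝ × ℝ)) (0, 1, 0) p.1 :=
    (hasDerivAt_const _ _).prodMk ((hasDerivAt_id _).prodMk (hasDerivAt_const _ _))
  have e1 := hd.comp_hasDerivAt_of_eq p.2 h1 rfl
  have e2 := hd.comp_hasDerivAt_of_eq p.1 h2 rfl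
  rw [hamVectorField]
  exact Prod.ext e1.deriv (by rw [← e2.deriv]; rfl)

/-- The map `A` is the spatial linearisation of the Hamiltonian field; symmetry of the Hessian of
`H` makes it infinitesimally symplectic. A single `M` works everywhere because the second and third
derivatives of `H` are periodic, hence bounded for `t ∈ [0, 1]`. -/
theorem exists_taylor_bounds (hH : IsAnalyticHamiltonian H) :
    ∃ M : ℝ, 0 ≤ M ∧ ∀ t ∈ Icc (0 : ℝ) 1, ∀ p : ℝ × ℝ, ∃ A : ℝ × ℝ → ℝ × ℝ,
      (∀ a b, areaForm (A a) b + areaForm a (A b) = 0) ∧ ∀ a : ℝ × ℝ,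
      ‖hamVectorField H t (p + a) - hamVectorField H t p‖ ≤ M * ‖a‖ ∧
      ‖hamVectorField H t (p + a) - hamVectorField H t p - A a‖ ≤ M * ‖a‖ ^ 2 := by
  have hH1 : ContDiff ℝ ⊤ (fderiv ℝ H) := hH.contDiff.fderiv_right (by simp)
  have hH2 : ContDiff ℝ ⊤ (fderiv ℝ (fderiv ℝ H)) := hH1.fderiv_right (by simp)
  have hH3 : ContDiff ℝ ⊤ (fderiv ℝ (fderiv ℝ (fderiv ℝ H))) := hH2.fderiv_right (by simp)
  have step : ∀ {E : Type} [NormedAddCommGroup E] [NormedSpace ℝ E] (g : ℝ × ℝ × ℝ → E),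
      (∀ z, ∀ m n : ℤ, g (z + (0, (m : ℝ), (n : ℝ))) = g z) →
      ∀ z, ∀ m n : ℤ, fderiv ℝ g (z + (0, (m : ℝ), (n : ℝ))) = fderiv ℝ g z := by
    intro E _ _ g hg z m n
    rw [← fderiv_comp_add_right]
    congr 1
    ext z
    exact hg z m n
  have p1 := step H hH.periodic_int
  have p2 := step _ p1
  have p3 := step _ p2
  obtain ⟨M2, hM2, h2⟩ := exists_bound_of_periodic hH2.continuous p2
  obtain ⟨M3, hM3, h3⟩ := exists_bound_of_periodic hH3.continuous p3
  refine ⟨M2 + M3, by positivity, fun t ht p => ?_⟩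
  have hconv : Convex ℝ ({t} ×ˢ univ : Set (ℝ × ℝ × ℝ)) := (convex_singleton t).prod convex_univ
  have lip : ∀ {E : Type} [NormedAddCommGroup E] [NormedSpace ℝ E] (g : ℝ × ℝ × ℝ → E) (M : ℝ),
      Differentiable ℝ g → (∀ t ∈ Icc (0 : ℝ) 1, ∀ p, ‖fderiv ℝ g (t, p)‖ ≤ M) →
      ∀ p a : ℝ × ℝ, ‖g (t, p + a) - g (t, p)‖ ≤ M * ‖a‖ := by
    intro E _ _ g M hg hM p a
    have := hconv.norm_image_sub_le_of_norm_fderiv_le (𝕜 := ℝ) (f := g) (C := M) (x := (t, p))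
      (y := (t, p + a)) (fun x _ => hg x)
      (by rintro ⟨t', p'⟩ ⟨h, -⟩; obtain rfl : t' = t := h; exact hM _ ht p') ⟨rfl, trivial⟩
      ⟨rfl, trivial⟩
    simpa [Prod.norm_def] using this
  set g := fderiv ℝ H with hg
  set B := fderiv ℝ g (t, p) with hB
  have l1 := lip g M2 (hH1.differentiable (by simp)) h2
  have l2 := lip (fderiv ℝ g) M3 (hH2.differentiable (by simp)) h3
  have l3 : ∀ a : ℝ × ℝ, ‖g (t, p + a) - g (t, p) - B (0, a)‖ ≤ M3 * ‖a‖ ^ 2 := by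
    intro a
    have hs : Convex ℝ ({t} ×ˢ Metric.closedBall p ‖a‖ : Set (ℝ × ℝ × ℝ)) :=
      (convex_singleton t).prod (convex_closedBall _ _)
    have := hs.norm_image_sub_le_of_norm_fderiv_le' (𝕜 := ℝ) (f := g) (C := M3 * ‖a‖) (φ := B)
      (x := (t, p)) (y := (t, p + a)) (fun x _ => hH1.differentiable (by simp) x)
      (by
        rintro ⟨t', p'⟩ ⟨h, h'⟩
        obtain rfl : t' = t := h
        have := l2 p (p' - p)
        rw [add_sub_cancel] at this
        refine this.trans ?_
        gcongr
        rwa [Metric.mem_closedBall, dist_eq_norm] at h')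
      ⟨rfl, by simp⟩ ⟨rfl, by simp⟩
    have e : ((t, p + a) : ℝ × ℝ × ℝ) - (t, p) = (0, a) := by ext <;> simp
    rw [e] at this
    simpa [Prod.norm_def, pow_two, mul_assoc] using this
  have hsymm : ∀ v w, B v w = B w v :=
    (hH.contDiff.contDiffAt.isSymmSndFDerivAt (by simp) :
      IsSymmSndFDerivAt ℝ H (t, p))
  have n1 : ‖((0, 0, 1) : ℝ × ℝ × ℝ)‖ = 1 := by simp [Prod.norm_def]
  have n2 : ‖((0, 1, 0) : ℝ × ℝ × ℝ)‖ = 1 := by simp [Prod.norm_def]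
  have hop : ∀ (T : ℝ × ℝ × ℝ →L[ℝ] ℝ) (K : ℝ), ‖T‖ ≤ K →
      ‖((T (0, 0, 1), -T (0, 1, 0)) : ℝ × ℝ)‖ ≤ K := by
    intro T K hT
    rw [Prod.norm_def, max_le_iff, norm_neg]
    have e1 := T.le_opNorm (0, 0, 1)
    have e2 := T.le_opNorm (0, 1, 0)
    rw [n1, mul_one] at e1
    rw [n2, mul_one] at e2
    exact ⟨e1.trans hT, e2.trans hT⟩
  refine ⟨fun a => (B (0, a) (0, 0, 1), -B (0, a) (0, 1, 0)), fun a b => ?_, fun a => ⟨?_, ?_⟩⟩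
  · have split : ∀ a : ℝ × ℝ, ((0, a) : ℝ × ℝ × ℝ)
        = a.1 • ((0, 1, 0) : ℝ × ℝ × ℝ) + a.2 • ((0, 0, 1) : ℝ × ℝ × ℝ) := by
      intro a; ext <;> simp
    have e1 : B (0, a) (0, b) = b.1 * B (0, a) (0, 1, 0) + b.2 * B (0, a) (0, 0, 1) := by
      conv_lhs => rw [split b]
      simp only [map_add, map_smul, smul_eq_mul]
    have e2 : B (0, b) (0, a) = a.1 * B (0, b) (0, 1, 0) + a.2 * B (0, b) (0, 0, 1) := by
      conv_lhs => rw [split a]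
      simp only [map_add, map_smul, smul_eq_mul]
    have e3 := hsymm (0, a) (0, b)
    simp only [areaForm]
    linarith
  · rw [hH.hamVectorField_eq, hH.hamVectorField_eq]
    have := hop (g (t, p + a) - g (t, p)) _ (l1 p a)
    simp only [sub_apply] at this
    rw [Prod.mk_sub_mk, ← neg_sub']
    refine this.trans ?_
    gcongr
    linarith
  · rw [hH.hamVectorField_eq, hH.hamVectorField_eq]
    have := hop (g (t, p + a) - g (t, p) - B (0, a)) _ (l3 a)
    simp only [sub_apply] at this
    rw [Prod.mk_sub_mk, Prod.mk_sub_mk]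
    have e : -g (t, p + a) (0, 1, 0) - -g (t, p) (0, 1, 0) - -B (0, a) (0, 1, 0)
      = -(g (t, p + a) (0, 1, 0) - g (t, p) (0, 1, 0) - B (0, a) (0, 1, 0)) := by ring
    rw [e]
    refine this.trans ?_
    gcongr
    linarith

end IsAnalyticHamiltonian

theorem HasDerivWithinAt.areaForm {u v : ℝ → ℝ × ℝ} {u' v' : ℝ × ℝ} {s : Set ℝ} {t : ℝ}
    (hu : HasDerivWithinAt u u' s t) (hv : HasDerivWithinAt v v' s t) :
    HasDerivWithinAt (fun t => areaForm (u t) (v t))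
      (areaForm u' (v t) + areaForm (u t) v') s t := by
  have hu1 : HasDerivWithinAt (fun t => (u t).1) u'.1 s t :=
    (ContinuousLinearMap.fst ℝ ℝ ℝ).hasFDerivAt.comp_hasDerivWithinAt t hu
  have hu2 : HasDerivWithinAt (fun t => (u t).2) u'.2 s t :=
    (ContinuousLinearMap.snd ℝ ℝ ℝ).hasFDerivAt.comp_hasDerivWithinAt t hu
  have hv1 : HasDerivWithinAt (fun t => (v t).1) v'.1 s t :=
    (ContinuousLinearMap.fst ℝ ℝ ℝ).hasFDerivAt.comp_hasDerivWithinAt t hv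
  have hv2 : HasDerivWithinAt (fun t => (v t).2) v'.2 s t :=
    (ContinuousLinearMap.snd ℝ ℝ ℝ).hasFDerivAt.comp_hasDerivWithinAt t hv
  refine ((hu1.mul hv2).sub (hu2.mul hv1)).congr_deriv ?_
  simp only [_root_.areaForm]
  ring

/-- Integral curves are compared by Grönwall's inequality, which gives the Lipschitz bound. The area
spanned by two differences of trajectories has a derivative of third order, so no differentiability
of the flow in its initial point is needed. -/
theorem IsTimeOneMap.exists_lift {H : ℝ × ℝ × ℝ → ℝ} {f : RTorus → RTorus}
    (hH : IsAnalyticHamiltonian H) (hf : IsTimeOneMap H f) :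
    ∃ F : ℝ × ℝ → ℝ × ℝ, AlmostAreaPreserving F ∧ ∀ q, projR (F q) = f (projR q) := by
  choose c hc0 hc hc1 using hf
  obtain ⟨M, hM, hX⟩ := hH.exists_taylor_bounds
  refine ⟨fun q => c q 1, ?_, fun q => (hc1 q).symm⟩
  set K := Real.exp M with hK
  have hKpos : 0 < K := Real.exp_pos _
  have hlip : ∀ q a, ∀ t ∈ Icc (0 : ℝ) 1, ‖c (q + a) t - c q t‖ ≤ K * ‖a‖ := by
    intro q a t ht
    have hd : ∀ q, ∀ t ∈ Ico (0 : ℝ) 1,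
        HasDerivWithinAt (c q) (hamVectorField H t (c q t)) (Ici t) t := fun q t ht =>
      (hc q t (Ico_subset_Icc_self ht)).mono_of_mem_nhdsWithin (Icc_mem_nhdsGE_of_mem ht)
    have hcont : ∀ q, ContinuousOn (c q) (Icc 0 1) := fun q t ht => (hc q t ht).continuousWithinAt
    have := dist_le_of_trajectories_ODE_of_mem (v := hamVectorField H) (s := fun _ => univ)
      (K := ⟨M, hM⟩) (δ := ‖a‖) (f := c (q + a)) (g := c q)
      (fun t ht => ?_) (hcont _) (hd _) (fun _ _ => trivial) (hcont _) (hd _) (fun _ _ => trivial)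
      (by rw [hc0, hc0, dist_eq_norm, add_sub_cancel_left]) t ht
    · rw [dist_eq_norm] at this
      refine this.trans ?_
      rw [mul_comm]
      refine mul_le_mul_of_nonneg_right (Real.exp_le_exp.2 ?_) (norm_nonneg _)
      change M * (t - 0) ≤ M
      rw [sub_zero]
      exact mul_le_of_le_one_right hM ht.2
    · refine LipschitzOnWith.of_dist_le_mul fun x _ y _ => ?_
      obtain ⟨A, -, hA⟩ := hX t (Ico_subset_Icc_self ht) y
      have := (hA (x - y)).1
      rwa [add_sub_cancel, ← dist_eq_norm, ← dist_eq_norm] at this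
  refine ⟨K + 4 * M * K ^ 3, by positivity, fun q a b => ⟨?_, ?_⟩⟩
  · refine (hlip q a 1 (right_mem_Icc.2 zero_le_one)).trans ?_
    gcongr
    have : 0 ≤ 4 * M * K ^ 3 := by positivity
    linarith
  · set u := fun t => c (q + a) t - c q t with hu
    set v := fun t => c (q + b) t - c q t with hv
    have hderiv : ∀ t ∈ Icc (0 : ℝ) 1, HasDerivWithinAt (fun t => areaForm (u t) (v t)) _ (Icc 0 1) t :=
      fun t ht => HasDerivWithinAt.areaForm ((hc (q + a) t ht).sub (hc q t ht))
        ((hc (q + b) t ht).sub (hc q t ht))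
    have hbound : ∀ t ∈ Icc (0 : ℝ) 1,
        ‖areaForm (hamVectorField H t (c (q + a) t) - hamVectorField H t (c q t)) (v t) +
          areaForm (u t) (hamVectorField H t (c (q + b) t) - hamVectorField H t (c q t))‖
        ≤ 4 * M * K ^ 3 * (‖a‖ + ‖b‖) ^ 3 := by
      intro t ht
      obtain ⟨A, hA0, hA⟩ := hX t ht (c q t)
      have h1 := (hA (u t)).2
      have h2 := (hA (v t)).2
      simp only [hu, hv, add_sub_cancel] at h1 h2
      set X1 := hamVectorField H t (c (q + a) t) - hamVectorField H t (c q t)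
      set X2 := hamVectorField H t (c (q + b) t) - hamVectorField H t (c q t)
      -- The linear part `A` of the field contributes nothing to the variation of area, so only the
      -- quadratic remainders are left.
      have e : areaForm X1 (v t) + areaForm (u t) X2
          = areaForm (X1 - A (u t)) (v t) + areaForm (u t) (X2 - A (v t)) := by
        have := hA0 (u t) (v t)
        simp only [areaForm, Prod.fst_sub, Prod.snd_sub] at this ⊢
        linarith
      have hua := hlip q a t ht
      have hvb := hlip q b t ht
      have k1 := abs_areaForm_le (X1 - A (u t)) (v t)
      have k2 := abs_areaForm_le (u t) (X2 - A (v t))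
      have hsa : K * ‖a‖ ≤ K * (‖a‖ + ‖b‖) := by gcongr; linarith [norm_nonneg b]
      have hsb : K * ‖b‖ ≤ K * (‖a‖ + ‖b‖) := by gcongr; linarith [norm_nonneg a]
      have hua' : ‖u t‖ ≤ K * (‖a‖ + ‖b‖) := hua.trans hsa
      have hvb' : ‖v t‖ ≤ K * (‖a‖ + ‖b‖) := hvb.trans hsb
      have h1' : ‖X1 - A (u t)‖ ≤ M * (K * (‖a‖ + ‖b‖)) ^ 2 := h1.trans (by gcongr)
      have h2' : ‖X2 - A (v t)‖ ≤ M * (K * (‖a‖ + ‖b‖)) ^ 2 := h2.trans (by gcongr)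
      rw [e, Real.norm_eq_abs]
      calc _ ≤ _ := abs_add_le _ _
        _ ≤ 2 * (M * (K * (‖a‖ + ‖b‖)) ^ 2) * (K * (‖a‖ + ‖b‖))
            + 2 * (K * (‖a‖ + ‖b‖)) * (M * (K * (‖a‖ + ‖b‖)) ^ 2) :=
          add_le_add (k1.trans (by gcongr)) (k2.trans (by gcongr))
        _ = _ := by ring
    have := (convex_Icc (0 : ℝ) 1).norm_image_sub_le_of_norm_hasDerivWithin_le hderiv hbound
      (left_mem_Icc.2 zero_le_one) (right_mem_Icc.2 zero_le_one)
    simp only [hu, hv, hc0, add_sub_cancel_left, sub_zero, norm_one, mul_one, Real.norm_eq_abs] at this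
    refine this.trans ?_
    gcongr
    linarith

theorem IsHamDiffeo.exists_lift {f : RTorus → RTorus} (hf : IsHamDiffeo f) :
    ∃ F : ℝ × ℝ → ℝ × ℝ, AlmostAreaPreserving F ∧ ∀ q, projR (F q) = f (projR q) := by
  induction hf with
  | timeOne H f hH hf => exact hf.exists_lift hH
  | comp f g _ _ ihf ihg =>
    obtain ⟨F, hF, hF'⟩ := ihf
    obtain ⟨G, hG, hG'⟩ := ihg
    exact ⟨F ∘ G, hF.comp hG, fun q => by simp [hF', hG']⟩

/-! ### Lifts of torus maps and their derivatives -/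

theorem ContinuousAt.eventually_eq_add_of_projR {X : Type*} [TopologicalSpace X]
    {F G : X → ℝ × ℝ} {x : X} (hF : ContinuousAt F x) (hG : ContinuousAt G x)
    (h : ∀ᶠ y in 𝓝 x, projR (F y) = projR (G y)) : ∀ᶠ y in 𝓝 x, F y = G y + (F x - G x) := by
  have h' : ∀ᶠ y in 𝓝 x, ∃ m n : ℤ, F y = G y + ((m : ℝ), (n : ℝ)) :=
    h.mono fun y hy => projR_eq_iff.1 hy
  have h1 := eventually_eq_of_integer_valued (𝕜 := ℝ) (hF.fst.sub hG.fst)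
    (h'.mono fun y ⟨m, n, e⟩ => ⟨m, by simp [e]⟩)
  have h2 := eventually_eq_of_integer_valued (𝕜 := ℝ) (hF.snd.sub hG.snd)
    (h'.mono fun y ⟨m, n, e⟩ => ⟨n, by simp [e]⟩)
  filter_upwards [h1, h2] with y e1 e2
  ext
  · have e1' : (F y).1 - (G y).1 = (F x).1 - (G x).1 := e1
    simp only [Prod.fst_add, Prod.fst_sub]; linarith
  · have e2' : (F y).2 - (G y).2 = (F x).2 - (G x).2 := e2
    simp only [Prod.snd_add, Prod.snd_sub]; linarith

/-- Two continuous lifts differ locally by a constant, so a derivative found with one local lift is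
valid for every global continuous lift. -/
theorem HasTorusDerivAt.hasFDerivAt_lift {f : RTorus → RTorus} {D : ℝ × ℝ →L[ℝ] ℝ × ℝ}
    {x : ℝ × ℝ} (hf : HasTorusDerivAt f D (projR x)) {F : ℝ × ℝ → ℝ × ℝ} (hFc : Continuous F)
    (hF : ∀ q, projR (F q) = f (projR q)) : HasFDerivAt F D x := by
  obtain ⟨x', G, hx, hG, hD⟩ := hf
  obtain ⟨m, n, rfl⟩ := projR_eq_iff.1 hx
  set v : ℝ × ℝ := ((m : ℝ), (n : ℝ))
  have hG' : HasFDerivAt (fun y => G (y + v)) D x := by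
    have := hD.comp x ((hasFDerivAt_id x).add_const v)
    rwa [ContinuousLinearMap.comp_id] at this
  have hev : ∀ᶠ y in 𝓝 x, projR (F y) = projR (G (y + v)) := by
    have : Tendsto (fun y => y + v) (𝓝 x) (𝓝 (x + v)) := (continuous_add_const v).tendsto x
    filter_upwards [this.eventually hG] with y hy
    rw [hy, hF]
    exact congrArg f (projR_eq_iff.2 ⟨-m, -n, by ext <;> simp [v]⟩)
  exact (hG'.add_const _).congr_of_eventuallyEq
    (hFc.continuousAt.eventually_eq_add_of_projR hG'.continuousAt hev)

theorem hasTorusDerivAt_of_lift {f : RTorus → RTorus} {D : ℝ × ℝ →L[ℝ] ℝ × ℝ}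
    {x : ℝ × ℝ} {F : ℝ × ℝ → ℝ × ℝ} (hF : ∀ q, projR (F q) = f (projR q)) (hD : HasFDerivAt F D x) :
    HasTorusDerivAt f D (projR x) :=
  ⟨x, F, rfl, Eventually.of_forall hF, hD⟩

theorem IsHamDiffeo.areaForm_deriv {f : RTorus → RTorus} (hf : IsHamDiffeo f)
    {F : ℝ × ℝ → ℝ × ℝ} (hF : ∀ q, projR (F q) = f (projR q))
    {D : ℝ × ℝ →L[ℝ] ℝ × ℝ} {x : ℝ × ℝ} (hD : HasFDerivAt F D x) (u v : ℝ × ℝ) :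
    areaForm (D u) (D v) = areaForm u v := by
  obtain ⟨G, hG, hGf⟩ := hf.exists_lift
  exact hG.areaForm_map_map ((hasTorusDerivAt_of_lift hF hD).hasFDerivAt_lift hG.continuous hGf) u v

/-! ### Explicit Hamiltonian diffeomorphisms of the torus -/

theorem exists_torus_map {h : ℝ × ℝ → ℝ × ℝ}
    (hper : ∀ q, ∀ m n : ℤ, projR (h (q + ((m : ℝ), (n : ℝ)))) = projR (h q)) :
    ∃ f : RTorus → RTorus, ∀ q, f (projR q) = projR (h q) := by
  refine ⟨fun p => projR (h (Function.surjInv projR_surjective p)), fun q => ?_⟩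
  obtain ⟨m, n, e⟩ := projR_eq_iff.1 (Function.surjInv_eq projR_surjective (projR q))
  simp only [e, hper]

/-- The vertical shear `(x, y) ↦ (x, y + b x)` is Hamiltonian if `b` has a periodic primitive. -/
theorem exists_isHamDiffeo_shear {B b : ℝ → ℝ} (hB : AnalyticOnNhd ℝ B univ)
    (hper : ∀ x, B (x + 1) = B x) (hb : ∀ x, HasDerivAt B (b x) x) :
    ∃ f : RTorus → RTorus, IsHamDiffeo f ∧ ∀ q, f (projR q) = projR (q.1, q.2 + b q.1) := by
  have hbper : Function.Periodic b 1 := fun x => by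
    have h1 : HasDerivAt (fun x => B (x + 1)) (b (x + 1)) x := (hb (x + 1)).comp_add_const x 1
    simp only [hper] at h1
    exact h1.unique (hb x)
  obtain ⟨f, hf⟩ := exists_torus_map (h := fun q => (q.1, q.2 + b q.1)) fun q m n => by
    have := hbper.int_mul m q.1
    rw [mul_one] at this
    exact projR_eq_iff.2 ⟨m, n, by ext <;> simp [this]; ring⟩
  -- The Hamiltonian `-B x` has vector field `(0, b x)`, which is constant along its vertical
  -- orbits.
  refine ⟨f, .timeOne (fun z => -B z.2.1) f ⟨fun z _ => ?_, fun t x y => ?_, fun t x y => rfl⟩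
    fun q => ⟨fun t => (q.1, q.2 + t * b q.1), by simp, fun t _ => ?_, by simpa using hf q⟩, hf⟩
  · exact ((hB z.2.1 trivial).fun_comp_of_eq (g := B) (analyticAt_fst.comp analyticAt_snd) rfl).neg
  · simp [hper]
  · have e : hamVectorField (fun z : ℝ × ℝ × ℝ => -B z.2.1) t (q.1, q.2 + t * b q.1) = (0, b q.1) := by
      have := ((hb q.1).fun_neg).deriv
      simp [hamVectorField, this]
    rw [e]
    refine ((hasDerivAt_const t q.1).prodMk ?_).hasDerivWithinAt
    simpa using ((hasDerivAt_id t).mul_const (b q.1)).const_add q.2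

/-- The Hamiltonian flow of a function of `y - α x`, in the case of
`-η / (2π) * cos (2π (y - α x))`. -/
theorem exists_isHamDiffeo_shear_along {α α' : ℝ → ℝ} (η : ℝ) (d : ℤ) (hα : AnalyticOnNhd ℝ α univ)
    (hper : ∀ x, α (x + 1) = α x + d) (hα' : ∀ x, HasDerivAt α (α' x) x) :
    ∃ f : RTorus → RTorus, IsHamDiffeo f ∧ ∀ q, f (projR q) =
      projR (q.1 + η * Real.sin (2 * Real.pi * (q.2 - α q.1)),
        q.2 + (α (q.1 + η * Real.sin (2 * Real.pi * (q.2 - α q.1))) - α q.1)) := by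
  have hpern : ∀ (n : ℤ) x, α (x + n) = α x + n * d := by
    intro n
    induction n using Int.induction_on with
    | zero => simp
    | succ i ih => intro x; push_cast; rw [← add_assoc, hper, ← Int.cast_natCast, ih]; push_cast; ring
    | pred i ih =>
      intro x
      have := hper (x + (-(i : ℤ) - 1 : ℤ))
      have h2 := ih x
      push_cast at this h2 ⊢
      rw [show x + (-(i : ℝ) - 1) + 1 = x + -i by ring, h2] at this
      linarith
  have hsin : ∀ (w : ℝ) (n : ℤ), Real.sin (2 * Real.pi * (w + n)) = Real.sin (2 * Real.pi * w) := by
    intro w n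
    rw [show 2 * Real.pi * (w + n) = 2 * Real.pi * w + n * (2 * Real.pi) by ring,
      Real.sin_add_int_mul_two_pi]
  have hcos : ∀ (w : ℝ) (n : ℤ), Real.cos (2 * Real.pi * (w + n)) = Real.cos (2 * Real.pi * w) := by
    intro w n
    rw [show 2 * Real.pi * (w + n) = 2 * Real.pi * w + n * (2 * Real.pi) by ring,
      Real.cos_add_int_mul_two_pi]
  obtain ⟨f, hf⟩ := exists_torus_map (h := fun q : ℝ × ℝ =>
      (q.1 + η * Real.sin (2 * Real.pi * (q.2 - α q.1)),
        q.2 + (α (q.1 + η * Real.sin (2 * Real.pi * (q.2 - α q.1))) - α q.1))) fun q m n => by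
    have e1 : Real.sin (2 * Real.pi * (q.2 + n - α (q.1 + m)))
        = Real.sin (2 * Real.pi * (q.2 - α q.1)) := by
      rw [hpern, ← hsin (q.2 - α q.1) (n - m * d)]
      push_cast; congr 1; ring
    refine projR_eq_iff.2 ⟨m, n, ?_⟩
    simp only [Prod.fst_add, Prod.snd_add, e1]
    ext
    · simp only [Prod.fst_add]; ring
    · simp only [Prod.snd_add]
      rw [add_right_comm q.1, hpern, hpern]; ring
  refine ⟨f, .timeOne (fun z => -(η / (2 * Real.pi)) * Real.cos (2 * Real.pi * (z.2.2 - α z.2.1))) f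
    ⟨fun z _ => ?_, fun t x y => ?_, fun t x y => ?_⟩ fun q => ?_, hf⟩
  · refine analyticAt_const.mul (Real.analyticAt_cos.comp (analyticAt_const.mul
      ((analyticAt_snd.comp analyticAt_snd).sub ?_)))
    exact (hα z.2.1 trivial).fun_comp_of_eq (g := α) (analyticAt_fst.comp analyticAt_snd) rfl
  · have := hcos (y - α x) (-d)
    simp only [hper]
    rw [← this]
    push_cast; ring_nf
  · have := hcos (y - α x) 1
    simp only
    rw [← this]
    push_cast; ring_nf
  · set w := η * Real.sin (2 * Real.pi * (q.2 - α q.1)) with hw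
    -- The quantity `y - α x` is conserved, so the horizontal velocity `w` is constant and the orbit
    -- follows a vertical translate of the graph of `α`.
    refine ⟨fun t => (q.1 + t * w, q.2 + (α (q.1 + t * w) - α q.1)), by simp, fun t _ => ?_,
      by simpa using hf q⟩
    have hx : HasDerivAt (fun t => q.1 + t * w) w t := by
      simpa using ((hasDerivAt_id t).mul_const w).const_add q.1
    have e : hamVectorField (fun z : ℝ × ℝ × ℝ =>
        -(η / (2 * Real.pi)) * Real.cos (2 * Real.pi * (z.2.2 - α z.2.1))) t
        (q.1 + t * w, q.2 + (α (q.1 + t * w) - α q.1)) = (w, α' (q.1 + t * w) * w) := by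
      have hpi := Real.pi_ne_zero
      set x := q.1 + t * w
      set y := q.2 + (α x - α q.1) with hy
      have ey : y - α x = q.2 - α q.1 := by rw [hy]; ring
      have d1 : HasDerivAt (fun y => -(η / (2 * Real.pi)) * Real.cos (2 * Real.pi * (y - α x))) w y := by
        have := ((((hasDerivAt_id y).sub_const (α x)).const_mul (2 * Real.pi)).cos).const_mul
          (-(η / (2 * Real.pi)))
        refine this.congr_deriv ?_
        simp only [id, ey, hw]
        field_simp
      have d2 : HasDerivAt (fun x => -(η / (2 * Real.pi)) * Real.cos (2 * Real.pi * (y - α x)))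
          (-(α' x * w)) x := by
        have := ((((hα' x).const_sub y).const_mul (2 * Real.pi)).cos).const_mul
          (-(η / (2 * Real.pi)))
        refine this.congr_deriv ?_
        simp only [ey, hw]
        field_simp
      simp only [hamVectorField]
      rw [d1.deriv, d2.deriv, neg_neg]
    rw [e]
    refine (hx.prodMk ?_).hasDerivWithinAt
    exact (((hα' _).comp t hx).sub_const _).const_add _

/-! ### Small perturbations of elements of `Ham^ω_U(𝕋²)` -/

/-- The map of `ℂ²/ℤ²` induced by a map of `ℂ²` on the set where the latter is equivariant. -/
def descend (h : ℂ × ℂ → ℂ × ℂ) (z : CTorus) : CTorus :=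
  projC (h (Function.surjInv projC_surjective z))

theorem descend_projC {h : ℂ × ℂ → ℂ × ℂ} {U : Set CTorus}
    (hper : ∀ p, projC p ∈ U → ∀ m n : ℤ, h (p + ((m : ℂ), (n : ℂ))) = h p + ((m : ℂ), (n : ℂ)))
    {p : ℂ × ℂ} (hp : projC p ∈ U) : descend h (projC p) = projC (h p) := by
  obtain ⟨m, n, e⟩ := projC_eq_iff.1 (Function.surjInv_eq projC_surjective (projC p))
  rw [descend, e, hper p hp]
  exact projC_eq_iff.2 ⟨m, n, rfl⟩

/-- Precomposition of `f ∈ Ham^ω_{U₀}(𝕋²)` with a holomorphic map `U₁ → U₀` given by a lift `h`,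
which restricts to a Hamiltonian diffeomorphism `g`. -/
theorem HamOn.exists_precomp {U₀ U₁ : Set CTorus} (hU₁ : IsOpen U₁) (f : HamOn U₀)
    (h : ℂ × ℂ → ℂ × ℂ) (hd : ∀ p, projC p ∈ U₁ → DifferentiableAt ℂ h p)
    (hper : ∀ p, projC p ∈ U₁ → ∀ m n : ℤ, h (p + ((m : ℂ), (n : ℂ))) = h p + ((m : ℂ), (n : ℂ)))
    (hmaps : ∀ p, projC p ∈ U₁ → projC (h p) ∈ U₀)
    (g : RTorus → RTorus) (hg : IsHamDiffeo g)
    (hgh : ∀ q, projC (ofReal2 q) ∈ U₁ → projC (h (ofReal2 q)) = torusIncl (g (projR q))) :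
    ∃ f₁ : HamOn U₁, f₁.toMap = f.toMap ∘ g ∧
      ∀ p (hp : projC p ∈ U₁), f₁.ext ⟨projC p, hp⟩ = f.ext ⟨projC (h p), hmaps p hp⟩ := by
  have hnear : ∀ p, projC p ∈ U₁ → ∀ᶠ y in 𝓝 p, projC y ∈ U₁ := fun p hp =>
    continuous_projC.continuousAt.eventually (hU₁.mem_nhds hp)
  have hmaps' : ∀ z ∈ U₁, descend h z ∈ U₀ := by
    intro z hz
    obtain ⟨p, rfl⟩ := projC_surjective z
    rw [descend_projC hper hz]
    exact hmaps p hz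
  have hcont : ContinuousOn (descend h) U₁ := by
    intro z hz
    obtain ⟨p, rfl⟩ := projC_surjective z
    refine ContinuousAt.continuousWithinAt ?_
    rw [ContinuousAt, ← map_projC_nhds, tendsto_map'_iff, descend_projC hper hz]
    refine ((continuous_projC.tendsto _).comp (hd p hz).continuousAt.tendsto).congr' ?_
    filter_upwards [hnear p hz] with y hy
    exact (descend_projC hper hy).symm
  let k : C(U₁, U₀) := ⟨fun z => ⟨descend h z, hmaps' z z.2⟩,
    (continuousOn_iff_continuous_domRestrict.1 hcont).subtype_mk _⟩
  have hk : ∀ p (hp : projC p ∈ U₁), k ⟨projC p, hp⟩ = ⟨projC (h p), hmaps p hp⟩ :=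
    fun p hp => Subtype.ext (descend_projC hper hp)
  refine ⟨⟨f.toMap ∘ g, .comp _ _ f.isHam hg, f.ext.comp k, ?_, ?_⟩, rfl, fun p hp => ?_⟩
  · intro x hx
    obtain ⟨G, hG, hGl⟩ := f.holomorphic (h x) (hmaps x hx)
    have ht := (hd x hx).continuousAt.tendsto
    refine ⟨G ∘ h, ?_, ?_⟩
    · filter_upwards [ht.eventually hG, hnear x hx] with y h1 h2
      exact h1.comp y (hd y h2)
    · filter_upwards [ht.eventually hGl, hnear x hx] with y h1 h2 hy
      simp only [ContinuousMap.comp_apply, hk y hy]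
      exact h1 (hmaps y hy)
  · intro p hp
    obtain ⟨q, rfl⟩ := projR_surjective p
    have e := hgh q hp
    have h2 : k ⟨torusIncl (projR q), hp⟩ = ⟨torusIncl (g (projR q)), e ▸ hmaps _ hp⟩ :=
      (hk (ofReal2 q) hp).trans (Subtype.ext e)
    simp only [ContinuousMap.comp_apply, h2]
    exact f.extends_toMap _ _
  · simp only [ContinuousMap.comp_apply, hk p hp]

/-- A neighbourhood of a restriction of `f` contains all precompositions of `f` with maps which
are uniformly close to the identity. -/
theorem HamOn.exists_mem_nhds_of_close {U₀ U₁ : Set CTorus} (h₁₀ : U₁ ⊆ U₀)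
    (f : HamOn U₀) {𝒰 : Set (HamOn U₁)} (h𝒰 : 𝒰 ∈ 𝓝 (f.restrict h₁₀)) :
    ∃ κ > 0, ∀ (f₁ : HamOn U₁) (h : ℂ × ℂ → ℂ × ℂ)
      (hmaps : ∀ p, projC p ∈ U₁ → projC (h p) ∈ U₀),
      (∀ p (hp : projC p ∈ U₁), f₁.ext ⟨projC p, hp⟩ = f.ext ⟨projC (h p), hmaps p hp⟩) →
      (∀ p, projC p ∈ U₁ → ‖h p - p‖ < κ) → f₁ ∈ 𝒰 := by
  rw [nhds_induced, mem_comap] at h𝒰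
  obtain ⟨V, hV, hV𝒰⟩ := h𝒰
  -- The sets `T κ` of `κ`-close precompositions form a filter basis; it is enough that this filter
  -- refines the compact-open neighbourhood filter, which can be tested on the subbasis.
  let T : {κ : ℝ // 0 < κ} → Set C(U₁, CTorus) := fun κ => {f₁ | ∃ (h : ℂ × ℂ → ℂ × ℂ)
      (hmaps : ∀ p, projC p ∈ U₁ → projC (h p) ∈ U₀),
      (∀ p (hp : projC p ∈ U₁), f₁ ⟨projC p, hp⟩ = f.ext ⟨projC (h p), hmaps p hp⟩) ∧
      (∀ p, projC p ∈ U₁ → ‖h p - p‖ < κ.1)}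
  have hbasis : (⨅ κ, 𝓟 (T κ)).HasBasis (fun _ : {κ : ℝ // 0 < κ} => True) T := by
    have : Nonempty {κ : ℝ // 0 < κ} := ⟨⟨1, one_pos⟩⟩
    refine hasBasis_iInf_principal fun i j => ?_
    refine ⟨⟨min i.1 j.1, lt_min i.2 j.2⟩, ?_, ?_⟩
    · rintro _ ⟨h, hm, he, hs⟩
      exact ⟨h, hm, he, fun p hp => (hs p hp).trans_le (min_le_left _ _)⟩
    · rintro _ ⟨h, hm, he, hs⟩
      exact ⟨h, hm, he, fun p hp => (hs p hp).trans_le (min_le_right _ _)⟩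
  have hle : (⨅ κ, 𝓟 (T κ)) ≤ 𝓝 (f.restrict h₁₀).ext := by
    rw [ContinuousMap.nhds_compactOpen]
    refine le_iInf₂ fun K hK => le_iInf₂ fun O hO => le_iInf fun hKO => ?_
    rw [le_principal_iff, hbasis.mem_iff]
    obtain ⟨W, hW, hWO⟩ := isOpen_induced_iff.1 (hO.preimage f.ext.continuous)
    have hWU : ∀ (z : CTorus) (hz : z ∈ U₀), z ∈ W ↔ f.ext ⟨z, hz⟩ ∈ O := fun z hz =>
      Set.ext_iff.1 hWO ⟨z, hz⟩
    have hK' : IsCompact (Subtype.val '' K) := hK.image continuous_subtype_val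
    have hopen : IsOpen {w : CTorus × (ℂ × ℂ) | w.1 + projC w.2 ∈ W} :=
      hW.preimage (continuous_fst.add (continuous_projC.comp continuous_snd))
    -- The tube lemma makes the size of an admissible displacement uniform over the compact set `K`.
    obtain ⟨u, v, -, hv, hKu, h0v, huv⟩ := generalized_tube_lemma hK'
      (isCompact_singleton (x := (0 : ℂ × ℂ)))
      hopen (by
        rintro ⟨z, w⟩ ⟨⟨⟨z, hz⟩, hzK, rfl⟩, rfl⟩
        have e : z + projC 0 = z := add_zero z
        simp only [mem_ofPred_eq, e]
        exact (hWU z (h₁₀ hz)).2 (hKO hzK))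
    obtain ⟨κ, hκ, hball⟩ := Metric.isOpen_iff.1 hv 0 (h0v rfl)
    refine ⟨⟨κ, hκ⟩, trivial, ?_⟩
    rintro f₁ ⟨h, hm, he, hs⟩ ⟨z, hz⟩ hzK
    obtain ⟨p, rfl⟩ := projC_surjective z
    rw [he p hz, ← hWU]
    have : (projC p, h p - p) ∈ u ×ˢ v :=
      ⟨hKu ⟨_, hzK, rfl⟩, hball (by rw [mem_ball_zero_iff]; exact hs p hz)⟩
    have := huv this
    simpa only [mem_ofPred_eq, ← projC_add, add_sub_cancel] using this
  obtain ⟨κ, -, hκ⟩ := hbasis.mem_iff.1 (hle hV)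
  exact ⟨κ.1, κ.2, fun f₁ h hm he hs => hV𝒰 (hκ ⟨h, hm, he, hs⟩)⟩

/-! ### Lifts of graph KAM curves to a strip -/

/-- The strip `{s ∈ ℂ : |Im s| < r}`. -/
def strip (r : ℝ) : Set ℂ := {s | |s.im| < r}

theorem mem_strip {r : ℝ} {s : ℂ} : s ∈ strip r ↔ |s.im| < r := Iff.rfl

theorem isOpen_strip (r : ℝ) : IsOpen (strip r) :=
  isOpen_lt (Complex.continuous_im.abs) continuous_const

theorem ofReal_mem_strip {r : ℝ} (hr : 0 < r) (x : ℝ) : (x : ℂ) ∈ strip r := by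
  simpa [mem_strip] using hr

theorem convex_strip (r : ℝ) : Convex ℝ (strip r) := by
  have : strip r = Complex.imLm ⁻¹' Ioo (-r) r := by
    ext s; simp [mem_strip, abs_lt]
  rw [this]
  exact (convex_Ioo _ _).linear_preimage _

theorem add_real_mem_strip {r : ℝ} {s : ℂ} (hs : s ∈ strip r) (x : ℝ) : s + x ∈ strip r := by
  simpa [mem_strip] using hs

theorem add_int_mem_strip {r : ℝ} {s : ℂ} (hs : s ∈ strip r) (n : ℤ) : s + n ∈ strip r := by
  simpa [mem_strip] using hs

theorem add_one_mem_strip {r : ℝ} {s : ℂ} (hs : s ∈ strip r) : s + 1 ∈ strip r := by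
  simpa [mem_strip] using hs

theorem coe_mem_annulus {r : ℝ} {s : ℂ} (hs : s ∈ strip r) : (s : CCyl) ∈ annulus r := ⟨s, hs, rfl⟩

/-- Two continuous lifts of the same function to `ℂ/ℤ` differ locally by a constant. -/
theorem ContinuousAt.eventually_eq_add_of_coe {X : Type*} [TopologicalSpace X]
    {F G : X → ℂ} {x : X} (hF : ContinuousAt F x) (hG : ContinuousAt G x)
    (h : ∀ᶠ y in 𝓝 x, (F y : CCyl) = G y) : F =ᶠ[𝓝 x] fun y => G y + (F x - G x) := by
  have := eventually_eq_of_integer_valued (𝕜 := ℂ) (hF.sub hG) (h.mono fun y hy => by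
    obtain ⟨n, hn⟩ := coe_eq_coe_iff_exists_int.1 hy
    exact ⟨n, by simp [hn]⟩)
  filter_upwards [this] with y hy
  rw [← show (F - G) x = F x - G x from rfl, ← hy]
  simp

/-- The strip is contractible, so `u` lifts through the covering `ℂ → ℂ/ℤ`. The lift differs from
the local holomorphic lifts by constants, hence is holomorphic, and its increment over a period is
an integer-valued continuous function on a connected set. -/
theorem exists_lift_strip {r : ℝ} (hr : 0 < r) {u : CCyl → CCyl}
    (hu : ∀ x ∈ strip r, ∃ G : ℂ → ℂ, (∀ᶠ y in 𝓝 x, DifferentiableAt ℂ G y) ∧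
      ∀ᶠ y in 𝓝 x, (G y : CCyl) = u (y : CCyl))
    (hreal : ∀ s : ℝ, ∃ x : ℝ, u ((s : ℂ) : CCyl) = ((x : ℂ) : CCyl)) :
    ∃ Φ : ℂ → ℂ, DifferentiableOn ℂ Φ (strip r) ∧ (∀ s ∈ strip r, (Φ s : CCyl) = u (s : CCyl)) ∧
      (∀ s : ℝ, (Φ s).im = 0) ∧ ∃ n : ℤ, ∀ s ∈ strip r, Φ (s + 1) = Φ s + n := by
  have hopen := isOpen_strip r
  have hcont : Continuous (fun s : strip r => u ((s : ℂ) : CCyl)) := by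
    rw [continuous_iff_continuousAt]
    rintro ⟨x, hx⟩
    obtain ⟨G, hG, hGu⟩ := hu x hx
    have : ContinuousAt (fun y : ℂ => u (y : CCyl)) x :=
      ((AddCircle.continuous_mk' (1 : ℂ)).continuousAt.comp
        hG.self_of_nhds.continuousAt).congr hGu
    exact this.comp (f := Subtype.val) (x := (⟨x, hx⟩ : strip r)) continuous_subtype_val.continuousAt
  have hne : (strip r).Nonempty := ⟨0, by simpa [mem_strip] using hr⟩
  have : ContractibleSpace (strip r) := (convex_strip r).contractibleSpace hne
  have : LocallyPathConnectedSpace (strip r) := hopen.locallyPathConnectedSpace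
  obtain ⟨e₀, he₀⟩ := QuotientAddGroup.mk_surjective (u ((0 : ℂ) : CCyl))
  obtain ⟨F, ⟨-, hF⟩, -⟩ := (AddCircle.isCoveringMap_coe (1 : ℂ)).existsUnique_continuousMap_lifts
    ⟨_, hcont⟩ ⟨0, by simpa [mem_strip] using hr⟩ e₀ he₀
  classical
  set Φ : ℂ → ℂ := fun s => if h : s ∈ strip r then F ⟨s, h⟩ else 0 with hΦ
  have hΦu : ∀ s ∈ strip r, (Φ s : CCyl) = u (s : CCyl) := by
    intro s hs
    simp only [hΦ, dif_pos hs]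
    exact congrFun hF ⟨s, hs⟩
  have hΦc : ContinuousOn Φ (strip r) := by
    rw [continuousOn_iff_continuous_domRestrict]
    refine F.continuous.congr fun s => ?_
    simp only [hΦ, Set.domRestrict_apply, dif_pos s.2]
  have hΦd : DifferentiableOn ℂ Φ (strip r) := by
    intro x hx
    obtain ⟨G, hG, hGu⟩ := hu x hx
    have hnear := hopen.mem_nhds hx
    have := ContinuousAt.eventually_eq_add_of_coe (hΦc.continuousAt hnear)
      hG.self_of_nhds.continuousAt
      (by filter_upwards [hGu, hnear] with y h1 h2; rw [hΦu y h2, h1])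
    exact ((hG.self_of_nhds.add_const _).congr_of_eventuallyEq this).differentiableWithinAt
  refine ⟨Φ, hΦd, hΦu, fun s => ?_, ?_⟩
  · obtain ⟨x, hx⟩ := hreal s
    rw [← hΦu _ (ofReal_mem_strip hr s)] at hx
    obtain ⟨n, hn⟩ := coe_eq_coe_iff_exists_int.1 hx
    simp [hn]
  · obtain ⟨n, hn⟩ := ContinuousOn.exists_int_const (𝕜 := ℂ) (S := strip r)
      (u := fun s => Φ (s + 1) - Φ s)
      ((hΦc.comp (continuous_add_const 1).continuousOn fun s hs => add_one_mem_strip hs).sub hΦc)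
      (convex_strip r).isPreconnected (fun s hs => by
        have : (Φ (s + 1) : CCyl) = Φ s := by
          rw [hΦu _ hs, hΦu _ (add_one_mem_strip hs), AddCircle.coe_add_period]
        obtain ⟨n, hn⟩ := coe_eq_coe_iff_exists_int.1 this
        exact ⟨n, by rw [hn]; ring⟩)
    exact ⟨n, fun s hs => by rw [← hn s hs]; ring⟩

/-- `Φ` and `Γ` are the coordinates of a lift to the strip of width `r` of a real-analytic closed
curve of `𝕋²` which is the graph over the first coordinate of a map of degree `d`. -/
structure IsGraphLift (r : ℝ) (Φ Γ : ℂ → ℂ) (d : ℤ) : Prop where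
  pos : 0 < r
  diffΦ : DifferentiableOn ℂ Φ (strip r)
  diffΓ : DifferentiableOn ℂ Γ (strip r)
  perΦ : ∀ s ∈ strip r, Φ (s + 1) = Φ s + 1
  perΓ : ∀ s ∈ strip r, Γ (s + 1) = Γ s + d
  realΦ : ∀ s : ℝ, (Φ s).im = 0
  realΓ : ∀ s : ℝ, (Γ s).im = 0
  inj : InjOn Φ (strip r)
  deriv_ne : ∀ s ∈ strip r, deriv Φ s ≠ 0

/-- The real curve with coordinates `Φ` and `Γ`. -/
def realCurve (Φ Γ : ℂ → ℂ) (s : ℝ) : ℝ × ℝ := ((Φ s).re, (Γ s).re)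

theorem Continuous.exists_mem_uIoo {Φ : ℝ → ℝ} (hc : Continuous Φ) {a b c : ℝ}
    (h : c ∈ uIoo (Φ a) (Φ b)) : ∃ s ∈ uIoo a b, Φ s = c := by
  obtain ⟨s, hs, rfl⟩ := intermediate_value_uIcc hc.continuousOn (Ioo_subset_Icc_self h)
  refine ⟨s, ⟨lt_of_le_of_ne hs.1 ?_, lt_of_le_of_ne hs.2 ?_⟩, rfl⟩
  · rintro e
    rcases le_total a b with hab | hab
    · rw [inf_eq_left.2 hab] at e
      exact left_notMem_uIoo (e ▸ h)
    · rw [inf_eq_right.2 hab] at e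
      exact right_notMem_uIoo (e ▸ h)
  · rintro e
    rcases le_total a b with hab | hab
    · rw [sup_eq_right.2 hab] at e
      exact right_notMem_uIoo (e ▸ h)
    · rw [sup_eq_left.2 hab] at e
      exact left_notMem_uIoo (e ▸ h)

/-- A real function on `ℝ` which is continuous, injective modulo `1` and has integer increment over
a period has increment `±1`. -/
theorem eq_one_or_neg_one_of_injective_mod {Φ : ℝ → ℝ} (hc : Continuous Φ) {n : ℤ}
    (hper : ∀ s, Φ (s + 1) = Φ s + n)
    (hinj : ∀ s t, (∃ m : ℤ, Φ s = Φ t + m) → ∃ m : ℤ, s = t + m) : n = 1 ∨ n = -1 := by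
  have hn0 : n ≠ 0 := by
    rintro rfl
    have hi : InjOn Φ (Icc 0 (1 / 2)) := by
      intro s hs t ht h
      obtain ⟨m, hm⟩ := hinj s t ⟨0, by simp [h]⟩
      have h1 : |(m : ℝ)| < 1 := by
        rw [abs_lt]; constructor <;> linarith [hs.1, hs.2, ht.1, ht.2]
      have : m = 0 := by rw [← Int.abs_lt_one_iff]; exact_mod_cast h1
      simpa [this] using hm
    have h01 : Φ 1 = Φ 0 := by simpa using hper 0
    have hne : Φ 0 ≠ Φ (1 / 2) := fun h => by
      have := hi (left_mem_Icc.2 (by norm_num)) (right_mem_Icc.2 (by norm_num)) h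
      norm_num at this
    -- With increment zero, `Φ` goes from `Φ 0` to `Φ (1 / 2)` and back, so the midpoint value is
    -- taken once inside each half of the period.
    obtain ⟨s, hs, t, ht, hst⟩ : ∃ s ∈ Ioo (0 : ℝ) (1 / 2), ∃ t ∈ Ioo (1 / 2 : ℝ) 1, Φ s = Φ t := by
      have hmem : (Φ 0 + Φ (1 / 2)) / 2 ∈ uIoo (Φ 0) (Φ (1 / 2)) := by
        rw [uIoo]
        rcases lt_or_gt_of_ne hne with h | h
        · rw [inf_eq_left.2 h.le, sup_eq_right.2 h.le]; constructor <;> linarith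
        · rw [inf_eq_right.2 h.le, sup_eq_left.2 h.le]; constructor <;> linarith
      have h1 := hc.exists_mem_uIoo hmem
      have h2 := hc.exists_mem_uIoo (a := 1) (b := 1 / 2) (c := (Φ 0 + Φ (1 / 2)) / 2)
        (by rw [h01]; exact hmem)
      rw [uIoo_of_le (by norm_num)] at h1
      rw [uIoo_of_ge (by norm_num)] at h2
      obtain ⟨s, hs, es⟩ := h1
      obtain ⟨t, ht, et⟩ := h2
      exact ⟨s, hs, t, ht, es.trans et.symm⟩
    obtain ⟨m, hm⟩ := hinj s t ⟨0, by simp [hst]⟩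
    have h1 : -1 < (m : ℝ) := by linarith [hs.1, ht.2]
    have h2 : (m : ℝ) < 0 := by linarith [hs.2, ht.1]
    have h1' : -1 < m := by exact_mod_cast h1
    have h2' : m < 0 := by exact_mod_cast h2
    omega
  by_contra! hcon
  -- If the increment has absolute value at least `2`, the value `Φ 0 + σ` with `σ` its sign is
  -- already reached strictly inside the period, against injectivity modulo `1`.
  have hσ : ∃ σ : ℤ, (σ = 1 ∨ σ = -1) ∧ (2 ≤ σ * n) := by
    rcases lt_or_gt_of_ne hn0 with h | h
    · exact ⟨-1, Or.inr rfl, by omega⟩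
    · exact ⟨1, Or.inl rfl, by omega⟩
  obtain ⟨σ, hσ, hσn⟩ := hσ
  have hmem : Φ 0 + σ ∈ uIoo (Φ 0) (Φ 1) := by
    have : Φ 1 = Φ 0 + n := by simpa using hper 0
    rw [this, uIoo]
    rcases hσ with rfl | rfl
    · have : (2 : ℝ) ≤ n := by exact_mod_cast (by omega : (2 : ℤ) ≤ n)
      rw [inf_eq_left.2 (by linarith), sup_eq_right.2 (by linarith)]
      push_cast
      constructor <;> linarith
    · have : (n : ℝ) ≤ -2 := by exact_mod_cast (by omega : n ≤ (-2 : ℤ))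
      rw [inf_eq_right.2 (by linarith), sup_eq_left.2 (by linarith)]
      push_cast
      constructor <;> linarith
  have h1 := hc.exists_mem_uIoo hmem
  rw [uIoo_of_le (by norm_num)] at h1
  obtain ⟨s, hs, es⟩ := h1
  obtain ⟨m, hm⟩ := hinj s 0 ⟨σ, es⟩
  rw [zero_add] at hm
  have h1 : 0 < (m : ℝ) := hm ▸ hs.1
  have h2 : (m : ℝ) < 1 := hm ▸ hs.2
  have h1' : 0 < m := by exact_mod_cast h1
  have h2' : m < 1 := by exact_mod_cast h2
  omega

theorem map_add_int_of_map_add_one {r : ℝ} {Φ : ℂ → ℂ} {c : ℂ}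
    (h : ∀ s ∈ strip r, Φ (s + 1) = Φ s + c) (m : ℤ) : ∀ s ∈ strip r, Φ (s + m) = Φ s + m * c := by
  induction m using Int.induction_on with
  | zero => simp
  | succ i ih =>
    intro s hs
    have h1 := h _ (add_int_mem_strip hs i)
    have h2 := ih s hs
    push_cast at h1 h2 ⊢
    rw [← add_assoc, h1, h2]; ring
  | pred i ih =>
    intro s hs
    have h1 := h _ (add_int_mem_strip hs (-(i : ℤ) - 1))
    have h2 := ih s hs
    push_cast at h1 h2 ⊢
    rw [show s + (-(i : ℂ) - 1) + 1 = s + -i by ring, h2] at h1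
    linear_combination -h1

theorem neg_mem_strip {r : ℝ} {s : ℂ} (hs : s ∈ strip r) : -s ∈ strip r := by
  simpa [mem_strip] using hs

/-- A graph KAM curve lifts to the strip, with either orientation made positive. -/
theorem IsGraphKAMCurve.exists_isGraphLift {U : Set CTorus} {f : HamOn U} {θ r : ℝ}
    {φ : CCyl → CTorus} (hr : 0 < r) (h : IsGraphKAMCurve f θ r φ) :
    ∃ (Φ Γ : ℂ → ℂ) (d : ℤ) (θ' : ℝ), IsGraphLift r Φ Γ d ∧
      (fun w => (φ w).1) '' annulus r = (fun w : ℂ => (w : CCyl)) '' (Φ '' strip r) ∧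
      (∀ s : ℝ, f.toMap (projR (realCurve Φ Γ s)) = projR (realCurve Φ Γ (s + θ'))) ∧
      ∀ s : ℝ, ∃ D : ℝ × ℝ →L[ℝ] ℝ × ℝ, HasTorusDerivAt f.toMap D (projR (realCurve Φ Γ s)) ∧
        0 < (D (0, 1)).1 := by
  have hopen := isOpen_strip r
  have hreal : ∀ s : ℝ, ∃ p : ℝ × ℝ, φ ((s : ℂ) : CCyl) = projC (ofReal2 p) := by
    intro s
    obtain ⟨p, hp⟩ := h.real s
    obtain ⟨q, rfl⟩ := projR_surjective p
    exact ⟨q, hp.symm⟩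
  obtain ⟨Φ, hΦd, hΦφ, hΦre, n, hn⟩ := exists_lift_strip hr (u := fun z => (φ z).1)
    (fun x hx => by
      obtain ⟨G, hG, hGφ⟩ := h.holomorphic x hx
      exact ⟨fun y => (G y).1, hG.mono fun y hy => hy.fst, hGφ.mono fun y hy => by rw [← hy]; rfl⟩)
    (fun s => by
      obtain ⟨p, hp⟩ := hreal s
      exact ⟨p.1, by simp only [hp]; rfl⟩)
  obtain ⟨Γ, hΓd, hΓφ, hΓre, d, hd⟩ := exists_lift_strip hr (u := fun z => (φ z).2)
    (fun x hx => by
      obtain ⟨G, hG, hGφ⟩ := h.holomorphic x hx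
      exact ⟨fun y => (G y).2, hG.mono fun y hy => hy.snd, hGφ.mono fun y hy => by rw [← hy]; rfl⟩)
    (fun s => by
      obtain ⟨p, hp⟩ := hreal s
      exact ⟨p.2, by simp only [hp]; rfl⟩)
  have hcurve : ∀ s : ℝ, φ ((s : ℂ) : CCyl) = torusIncl (projR (realCurve Φ Γ s)) := by
    intro s
    have hs := ofReal_mem_strip hr s
    have e1 : ((Φ s).re : ℂ) = Φ s := Complex.ext rfl (hΦre s).symm
    have e2 : ((Γ s).re : ℂ) = Γ s := Complex.ext rfl (hΓre s).symm
    rw [torusIncl_projR, ofReal2, realCurve, projC]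
    simp only [e1, e2]
    exact Prod.ext (hΦφ _ hs).symm (hΓφ _ hs).symm
  have hinjZ : ∀ s ∈ strip r, ∀ t ∈ strip r, (∃ m : ℤ, Φ s = Φ t + m) → ∃ m : ℤ, s = t + m := by
    intro s hs t ht hst
    have e : (Φ s : CCyl) = Φ t := coe_eq_coe_iff_exists_int.2 hst
    rw [hΦφ s hs, hΦφ t ht] at e
    exact coe_eq_coe_iff_exists_int.1 (h.graph.1 (coe_mem_annulus hs) (coe_mem_annulus ht) e)
  have hnpm : n = 1 ∨ n = -1 := by
    refine eq_one_or_neg_one_of_injective_mod (Φ := fun s : ℝ => (Φ s).re) ?_ (fun s => ?_) ?_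
    · exact Complex.continuous_re.comp (hΦd.continuousOn.comp_continuous Complex.continuous_ofReal
        fun s => ofReal_mem_strip hr s)
    · have := congrArg Complex.re (hn s (ofReal_mem_strip hr s))
      simpa using this
    · rintro s t ⟨m, hm⟩
      obtain ⟨k, hk⟩ := hinjZ s (ofReal_mem_strip hr s) t (ofReal_mem_strip hr t)
        ⟨m, Complex.ext (by simpa using hm) (by simp [hΦre])⟩
      exact ⟨k, by exact_mod_cast hk⟩
  have hinj : InjOn Φ (strip r) := by
    intro s hs t ht hst
    obtain ⟨m, rfl⟩ := hinjZ s hs t ht ⟨0, by simp [hst]⟩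
    rw [map_add_int_of_map_add_one hn m t ht] at hst
    have h0 : (m : ℂ) * n = 0 := by linear_combination hst
    have hm : m = 0 := by
      rcases mul_eq_zero.1 h0 with h0 | h0
      · exact_mod_cast h0
      · have : n = 0 := by exact_mod_cast h0
        omega
    simp [hm]
  have hderiv : ∀ s ∈ strip r, deriv Φ s ≠ 0 := by
    intro s hs
    obtain ⟨G, hG, hGφ, hG0⟩ := h.graph.2 s hs
    have hnear := hopen.mem_nhds hs
    have := ContinuousAt.eventually_eq_add_of_coe (hΦd.continuousOn.continuousAt hnear)
      hG.self_of_nhds.continuousAt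
      (by filter_upwards [hGφ, hnear] with y h1 h2; rw [hΦφ y h2, h1])
    rw [this.deriv_eq, deriv_add_const]
    exact hG0
  have himage : (fun w => (φ w).1) '' annulus r = (fun w : ℂ => (w : CCyl)) '' (Φ '' strip r) := by
    rw [annulus, image_image, image_image]
    exact image_congr fun s hs => (hΦφ s hs).symm
  have hconj : ∀ s : ℝ, f.toMap (projR (realCurve Φ Γ s)) = projR (realCurve Φ Γ (s + θ)) := by
    intro s
    have hz := coe_mem_annulus (ofReal_mem_strip hr s)
    apply torusIncl_injective
    rw [← hcurve, ← f.extends_toMap _ (hcurve s ▸ h.mapsTo hz)]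
    have := h.conj _ hz
    simp only [hcurve s] at this
    rw [this, Complex.ofReal_add, AddCircle.coe_add]
  have htwist : ∀ s : ℝ, ∃ D : ℝ × ℝ →L[ℝ] ℝ × ℝ,
      HasTorusDerivAt f.toMap D (projR (realCurve Φ Γ s)) ∧ 0 < (D (0, 1)).1 := fun s =>
    h.twist (s : AddCircle (1 : ℝ)) _ (hcurve s).symm
  rcases hnpm with rfl | rfl
  · exact ⟨Φ, Γ, d, θ, ⟨hr, hΦd, hΓd, by simpa using hn, hd, hΦre, hΓre, hinj, hderiv⟩,
      himage, hconj, htwist⟩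
  -- When the first coordinate runs backwards, the parameter is reversed; the degree and the
  -- rotation number change sign.
  · have hcn : ∀ s : ℝ, realCurve (fun s => Φ (-s)) (fun s => Γ (-s)) s = realCurve Φ Γ (-s) := by
      intro s; simp [realCurve]
    have hnegd : DifferentiableOn ℂ (fun s : ℂ => -s) (strip r) := differentiable_neg.differentiableOn
    refine ⟨fun s => Φ (-s), fun s => Γ (-s), -d, -θ, ⟨hr, hΦd.comp hnegd fun s => neg_mem_strip,
      hΓd.comp hnegd fun s => neg_mem_strip, fun s hs => ?_, fun s hs => ?_,
      fun s => by simpa using hΦre (-s), fun s => by simpa using hΓre (-s), fun s hs t ht hst =>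
        neg_injective (hinj (neg_mem_strip hs) (neg_mem_strip ht) hst), fun s hs => ?_⟩, ?_,
      fun s => ?_, fun s => ?_⟩
    · have := map_add_int_of_map_add_one hn (-1) (-s) (neg_mem_strip hs)
      push_cast at this
      rw [neg_add, this]; ring
    · have := map_add_int_of_map_add_one hd (-1) (-s) (neg_mem_strip hs)
      push_cast at this
      rw [neg_add, this]; push_cast; ring
    · rw [deriv_comp_neg]
      exact neg_ne_zero.2 (hderiv _ (neg_mem_strip hs))
    · rw [himage]
      congr 1
      ext w
      constructor
      · rintro ⟨s, hs, rfl⟩; exact ⟨-s, neg_mem_strip hs, by simp⟩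
      · rintro ⟨s, hs, rfl⟩; exact ⟨-s, neg_mem_strip hs, rfl⟩
    · rw [hcn, hcn, hconj]
      congr 2; ring
    · rw [hcn]; exact htwist _

/-! ### The holomorphic inverse of the first coordinate of the curve -/

namespace IsGraphLift

variable {r : ℝ} {Φ Γ : ℂ → ℂ} {d : ℤ}

/-- The inverse of the first coordinate of the curve. -/
def inv (_ : IsGraphLift r Φ Γ d) : ℂ → ℂ := Function.invFunOn Φ (strip r)

variable (h : IsGraphLift r Φ Γ d)
theorem hasDerivAt (h : IsGraphLift r Φ Γ d) {s : ℂ} (hs : s ∈ strip r) : HasDerivAt Φ (deriv Φ s) s :=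
  (h.diffΦ.differentiableAt ((isOpen_strip r).mem_nhds hs)).hasDerivAt

theorem hasStrictDerivAt (h : IsGraphLift r Φ Γ d) {s : ℂ} (hs : s ∈ strip r) : HasStrictDerivAt Φ (deriv Φ s) s :=
  (h.diffΦ.analyticAt ((isOpen_strip r).mem_nhds hs)).hasStrictDerivAt

theorem isOpen_image (h : IsGraphLift r Φ Γ d) : IsOpen (Φ '' strip r) := by
  rw [isOpen_iff_mem_nhds]
  rintro _ ⟨s, hs, rfl⟩
  rw [← (h.hasStrictDerivAt hs).map_nhds_eq (h.deriv_ne s hs)]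
  exact image_mem_map ((isOpen_strip r).mem_nhds hs)

theorem inv_mem {x : ℂ} (hx : x ∈ Φ '' strip r) : h.inv x ∈ strip r :=
  Function.invFunOn_mem hx

theorem apply_inv {x : ℂ} (hx : x ∈ Φ '' strip r) : Φ (h.inv x) = x :=
  Function.invFunOn_eq hx

theorem inv_apply {s : ℂ} (hs : s ∈ strip r) : h.inv (Φ s) = s :=
  h.inj (h.inv_mem ⟨s, hs, rfl⟩) hs (h.apply_inv ⟨s, hs, rfl⟩)

theorem hasDerivAt_inv {s : ℂ} (hs : s ∈ strip r) : HasDerivAt h.inv (deriv Φ s)⁻¹ (Φ s) := by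
  have hc : ContinuousAt h.inv (Φ s) := by
    rw [ContinuousAt, h.inv_apply hs, ← (h.hasStrictDerivAt hs).map_nhds_eq (h.deriv_ne s hs),
      tendsto_map'_iff]
    refine tendsto_id.congr' ?_
    filter_upwards [(isOpen_strip r).mem_nhds hs] with t ht
    exact (h.inv_apply ht).symm
  refine HasDerivAt.of_local_left_inverse (f := Φ) hc ?_ (h.deriv_ne s hs) ?_
  · rw [h.inv_apply hs]; exact h.hasDerivAt hs
  · filter_upwards [h.isOpen_image.mem_nhds ⟨s, hs, rfl⟩] with x hx
    exact h.apply_inv hx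

theorem differentiableOn_inv : DifferentiableOn ℂ h.inv (Φ '' strip r) := by
  rintro _ ⟨s, hs, rfl⟩
  exact (h.hasDerivAt_inv hs).differentiableAt.differentiableWithinAt

theorem apply_add_int (h : IsGraphLift r Φ Γ d) {s : ℂ} (hs : s ∈ strip r) (m : ℤ) : Φ (s + m) = Φ s + m := by
  simpa using map_add_int_of_map_add_one h.perΦ m s hs

theorem apply_add_int' (h : IsGraphLift r Φ Γ d) {s : ℂ} (hs : s ∈ strip r) (m : ℤ) : Γ (s + m) = Γ s + m * d := by
  simpa using map_add_int_of_map_add_one h.perΓ m s hs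

theorem add_int_mem_image (h : IsGraphLift r Φ Γ d) {x : ℂ} (hx : x ∈ Φ '' strip r) (m : ℤ) : x + m ∈ Φ '' strip r := by
  obtain ⟨s, hs, rfl⟩ := hx
  exact ⟨s + m, add_int_mem_strip hs m, h.apply_add_int hs m⟩

theorem inv_add_int {x : ℂ} (hx : x ∈ Φ '' strip r) (m : ℤ) : h.inv (x + m) = h.inv x + m := by
  obtain ⟨s, hs, rfl⟩ := hx
  rw [← h.apply_add_int hs, h.inv_apply hs, h.inv_apply (add_int_mem_strip hs m)]

theorem ofReal_re (h : IsGraphLift r Φ Γ d) (s : ℝ) : ((Φ s).re : ℂ) = Φ s := Complex.ext rfl (h.realΦ s).symm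

theorem ofReal_re' (h : IsGraphLift r Φ Γ d) (s : ℝ) : ((Γ s).re : ℂ) = Γ s := Complex.ext rfl (h.realΓ s).symm

theorem continuous_re (h : IsGraphLift r Φ Γ d) : Continuous fun s : ℝ => (Φ s).re :=
  Complex.continuous_re.comp (h.diffΦ.continuousOn.comp_continuous Complex.continuous_ofReal
        fun s => ofReal_mem_strip h.pos s)

/-- The first coordinate of the curve maps the real line onto itself. -/
theorem exists_real_eq (h : IsGraphLift r Φ Γ d) (x : ℝ) : ∃ s : ℝ, Φ s = x := by
  have hnat : ∀ n : ℤ, (Φ (n : ℝ)).re = (Φ (0 : ℝ)).re + n := by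
    intro n
    have := congrArg Complex.re (h.apply_add_int (ofReal_mem_strip h.pos 0) n)
    simpa using this
  obtain ⟨s, -, hs⟩ : x ∈ (fun s : ℝ => (Φ s).re) ''
      Icc ((⌊x - (Φ (0 : ℝ)).re⌋ : ℤ) : ℝ) ((⌊x - (Φ (0 : ℝ)).re⌋ + 1 : ℤ) : ℝ) := by
    refine intermediate_value_Icc (by push_cast; linarith) h.continuous_re.continuousOn ?_
    rw [hnat, hnat]
    have h1 := Int.floor_le (x - (Φ (0 : ℝ)).re)
    have h2 := Int.lt_floor_add_one (x - (Φ (0 : ℝ)).re)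
    push_cast at h1 h2 ⊢
    constructor <;> linarith
  exact ⟨s, by rw [← h.ofReal_re, ← hs]⟩

theorem ofReal_mem_image (h : IsGraphLift r Φ Γ d) (x : ℝ) : (x : ℂ) ∈ Φ '' strip r := by
  obtain ⟨s, hs⟩ := h.exists_real_eq x
  exact ⟨s, ofReal_mem_strip h.pos s, hs⟩

end IsGraphLift

/-! ### A holomorphic inverse of the sine -/

/-- The square root of `1 - z ^ 2`. -/
def sqrtOneSubSq (z : ℂ) : ℂ := Complex.exp (Complex.log (1 - z ^ 2) / 2)

/-- `arcsin z / (2π)`, holomorphic on the unit disc. -/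
def arcsinTurn (z : ℂ) : ℂ :=
  -Complex.I * Complex.log (Complex.I * z + sqrtOneSubSq z) / (2 * Real.pi)

theorem one_sub_sq_mem_slitPlane {z : ℂ} (hz : ‖z‖ < 1) : 1 - z ^ 2 ∈ Complex.slitPlane := by
  left
  have h1 : (z ^ 2).re ≤ ‖z‖ ^ 2 := (Complex.re_le_norm _).trans (norm_pow z 2).le
  have h2 : ‖z‖ ^ 2 < 1 := by nlinarith [norm_nonneg z]
  rw [Complex.sub_re, Complex.one_re]
  linarith

theorem sqrtOneSubSq_sq {z : ℂ} (hz : ‖z‖ < 1) : sqrtOneSubSq z ^ 2 = 1 - z ^ 2 := by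
  rw [sqrtOneSubSq, ← Complex.exp_nat_mul]
  push_cast
  rw [mul_div_cancel₀ _ two_ne_zero,
    Complex.exp_log (Complex.slitPlane_ne_zero (one_sub_sq_mem_slitPlane hz))]

theorem sqrtOneSubSq_re_nonneg (z : ℂ) : 0 ≤ (sqrtOneSubSq z).re := by
  rw [sqrtOneSubSq, Complex.exp_re]
  have h1 := Complex.neg_pi_lt_log_im (1 - z ^ 2)
  have h2 := Complex.log_im_le_pi (1 - z ^ 2)
  refine mul_nonneg (Real.exp_pos _).le (Real.cos_nonneg_of_mem_Icc ?_)
  have e : (Complex.log (1 - z ^ 2) / 2).im = (Complex.log (1 - z ^ 2)).im / 2 := by simp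
  rw [e]
  constructor <;> linarith

theorem mul_conj_factor {z : ℂ} (hz : ‖z‖ < 1) :
    (Complex.I * z + sqrtOneSubSq z) * (sqrtOneSubSq z - Complex.I * z) = 1 := by
  have h1 := sqrtOneSubSq_sq hz
  have h2 := Complex.I_sq
  linear_combination h1 - z ^ 2 * h2

/-- The numbers `√(1 - z²) ± iz` are reciprocal. If one were a nonpositive real, both would have
negative real part, although their sum `2√(1 - z²)` has nonnegative real part. -/
theorem arcsinTurn_arg_mem_slitPlane {z : ℂ} (hz : ‖z‖ < 1) :
    Complex.I * z + sqrtOneSubSq z ∈ Complex.slitPlane := by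
  rw [Complex.mem_slitPlane_iff]
  by_contra! hcon
  set A := Complex.I * z + sqrtOneSubSq z with hA
  set B := sqrtOneSubSq z - Complex.I * z with hB
  have hAB : A * B = 1 := mul_conj_factor hz
  have hw : 2 * (sqrtOneSubSq z).re = A.re + B.re := by
    rw [← Complex.add_re, hA, hB, show Complex.I * z + sqrtOneSubSq z +
      (sqrtOneSubSq z - Complex.I * z) = 2 * sqrtOneSubSq z by ring]
    simp
  have hre : A.re * B.re = 1 := by
    have := congrArg Complex.re hAB
    rwa [Complex.mul_re, hcon.2, zero_mul, sub_zero, Complex.one_re] at this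
  have := sqrtOneSubSq_re_nonneg z
  nlinarith [hcon.1]

theorem sin_arcsinTurn {z : ℂ} (hz : ‖z‖ < 1) :
    Complex.sin (2 * Real.pi * arcsinTurn z) = z := by
  have hpi : (Real.pi : ℂ) ≠ 0 := by exact_mod_cast Real.pi_ne_zero
  have hA := Complex.slitPlane_ne_zero (arcsinTurn_arg_mem_slitPlane hz)
  have e : (2 * Real.pi * arcsinTurn z) =
      -Complex.I * Complex.log (Complex.I * z + sqrtOneSubSq z) := by
    rw [arcsinTurn]; field_simp
  have hinv : (Complex.I * z + sqrtOneSubSq z)⁻¹ = sqrtOneSubSq z - Complex.I * z :=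
    inv_eq_of_mul_eq_one_right (mul_conj_factor hz)
  rw [e, Complex.sin]
  have e1 : -(-Complex.I * Complex.log (Complex.I * z + sqrtOneSubSq z)) * Complex.I
      = -Complex.log (Complex.I * z + sqrtOneSubSq z) := by
    linear_combination Complex.log (Complex.I * z + sqrtOneSubSq z) * Complex.I_sq
  have e2 : -Complex.I * Complex.log (Complex.I * z + sqrtOneSubSq z) * Complex.I
      = Complex.log (Complex.I * z + sqrtOneSubSq z) := by
    linear_combination -Complex.log (Complex.I * z + sqrtOneSubSq z) * Complex.I_sq
  rw [e1, e2, Complex.exp_neg, Complex.exp_log hA, hinv]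
  linear_combination -z * Complex.I_sq

theorem differentiableAt_arcsinTurn {z : ℂ} (hz : ‖z‖ < 1) : DifferentiableAt ℂ arcsinTurn z := by
  have h0 : DifferentiableAt ℂ (fun z : ℂ => 1 - z ^ 2) z := by fun_prop
  have hl := (h0.clog (one_sub_sq_mem_slitPlane hz)).div_const 2
  have h1 : DifferentiableAt ℂ sqrtOneSubSq z := hl.cexp
  have h2 : DifferentiableAt ℂ (fun z => Complex.I * z + sqrtOneSubSq z) z := by fun_prop
  have h3 := h2.clog (arcsinTurn_arg_mem_slitPlane hz)
  exact (h3.const_mul (-Complex.I)).div_const (2 * Real.pi : ℂ)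

theorem arcsinTurn_zero : arcsinTurn 0 = 0 := by
  simp [arcsinTurn, sqrtOneSubSq]

theorem sqrtOneSubSq_ofReal {x : ℝ} (hx : |x| < 1) :
    ∃ w : ℝ, 0 < w ∧ sqrtOneSubSq x = w ∧ w ^ 2 + x ^ 2 = 1 := by
  have hpos : 0 ≤ 1 - x ^ 2 := by nlinarith [abs_nonneg x, sq_abs x]
  have e : sqrtOneSubSq x = (Real.exp (Real.log (1 - x ^ 2) / 2) : ℝ) := by
    rw [sqrtOneSubSq]
    push_cast [Complex.ofReal_log hpos]
    rfl
  refine ⟨_, Real.exp_pos _, e, ?_⟩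
  have := sqrtOneSubSq_sq (z := (x : ℂ)) (by simpa using hx)
  rw [e] at this
  have h2 : (Real.exp (Real.log (1 - x ^ 2) / 2)) ^ 2 = 1 - x ^ 2 := by exact_mod_cast this
  rw [h2]; ring

/-- For real `x` the number `ix + √(1 - x²)` lies on the unit circle in the open right half-plane,
and the cosine of its argument is that positive root. This sign will give the positive twist of the
translation of the curve. -/
theorem arcsinTurn_ofReal {x : ℝ} (hx : |x| < 1) :
    (arcsinTurn x).im = 0 ∧ 0 < Real.cos (2 * Real.pi * (arcsinTurn x).re) := by
  obtain ⟨w, hw, hwe, hw1⟩ := sqrtOneSubSq_ofReal hx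
  have hpi := Real.pi_ne_zero
  set A : ℂ := Complex.I * x + w with hA
  have hre : A.re = w := by simp [hA]
  have him : A.im = x := by simp [hA]
  have hnorm : ‖A‖ = 1 := by
    rw [← sq_eq_sq₀ (norm_nonneg _) zero_le_one, Complex.sq_norm, Complex.normSq_apply, hre, him]
    linarith
  have hlog : Complex.log A = A.arg * Complex.I := by
    rw [Complex.log, hnorm]; simp
  have e : arcsinTurn x = ((A.arg / (2 * Real.pi) : ℝ) : ℂ) := by
    rw [arcsinTurn, hwe, ← hA, hlog]
    push_cast
    congr 1
    linear_combination -(A.arg : ℂ) * Complex.I_sq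
  rw [e]
  refine ⟨Complex.ofReal_im _, ?_⟩
  rw [Complex.ofReal_re, mul_div_cancel₀ _ (by positivity), Complex.cos_arg, hnorm, hre, div_one]
  · exact hw
  · rw [← norm_ne_zero_iff, hnorm]; exact one_ne_zero

/-! ### A Hamiltonian diffeomorphism translating the points of the curve -/

namespace IsGraphLift

variable {r : ℝ} {Φ Γ : ℂ → ℂ} {d : ℤ} (h : IsGraphLift r Φ Γ d)

/-- The displacement of the first coordinate under the translation of the curve by `δ`. -/
def disp (δ : ℝ) (x : ℂ) : ℂ := Φ (h.inv x + δ) - x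

/-- The domain on which `IsGraphLift.turn` is holomorphic. -/
def dom (δ η : ℝ) : Set ℂ := {x | x ∈ Φ '' strip r ∧ ‖h.disp δ x‖ < |η|}

/-- A solution `b` of `η * sin (2 π b) = disp δ`. -/
def turn (δ η : ℝ) (x : ℂ) : ℂ := arcsinTurn (h.disp δ x / η)

/-- The height of the graph along which the horizontal translation is applied. -/
def height (δ η : ℝ) (x : ℂ) : ℂ := Γ (h.inv x) - h.turn δ η x

/-- The first coordinate of `IsGraphLift.translate`. -/
def translateFst (δ η : ℝ) (p : ℂ × ℂ) : ℂ :=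
  p.1 + η * Complex.sin (2 * Real.pi * (p.2 - h.height δ η p.1))

/-- A lift of a Hamiltonian diffeomorphism which preserves the curve and translates it by `δ`. -/
def translate (δ η : ℝ) (p : ℂ × ℂ) : ℂ × ℂ :=
  (h.translateFst δ η p,
    p.2 + (h.height (-δ) (-η) (h.translateFst δ η p) - h.height δ η p.1))

/-- The domain on which `IsGraphLift.translate` is holomorphic. -/
def translateDom (δ η : ℝ) : Set (ℂ × ℂ) :=
  {p | p.1 ∈ h.dom δ η ∧ h.translateFst δ η p ∈ h.dom (-δ) (-η)}

variable {δ η : ℝ}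

theorem differentiableOn_disp (δ : ℝ) : DifferentiableOn ℂ (h.disp δ) (Φ '' strip r) :=
  (h.diffΦ.comp (h.differentiableOn_inv.add_const _)
    fun _ hx => add_real_mem_strip (h.inv_mem hx) δ).sub differentiableOn_id

theorem isOpen_dom (δ η : ℝ) : IsOpen (h.dom δ η) :=
  (h.differentiableOn_disp δ).continuousOn.norm.isOpen_inter_preimage h.isOpen_image isOpen_Iio

theorem norm_disp_div_lt {x : ℂ} (hx : x ∈ h.dom δ η) : ‖h.disp δ x / η‖ < 1 := by
  have h1 : 0 < |η| := (norm_nonneg _).trans_lt hx.2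
  rw [norm_div, Complex.norm_real, Real.norm_eq_abs, div_lt_one h1]
  exact hx.2

theorem ne_zero_of_mem_dom {x : ℂ} (hx : x ∈ h.dom δ η) : η ≠ 0 :=
  abs_pos.1 ((norm_nonneg _).trans_lt hx.2)

theorem sin_turn {x : ℂ} (hx : x ∈ h.dom δ η) :
    η * Complex.sin (2 * Real.pi * h.turn δ η x) = h.disp δ x := by
  rw [turn, sin_arcsinTurn (h.norm_disp_div_lt hx),
    mul_div_cancel₀ _ (by exact_mod_cast h.ne_zero_of_mem_dom hx)]

theorem differentiableOn_turn : DifferentiableOn ℂ (h.turn δ η) (h.dom δ η) := by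
  intro x hx
  refine DifferentiableAt.comp_differentiableWithinAt x
    (differentiableAt_arcsinTurn (h.norm_disp_div_lt hx)) ?_
  exact (((h.differentiableOn_disp δ).mono fun y hy => hy.1) x hx).div_const _

theorem differentiableOn_height : DifferentiableOn ℂ (h.height δ η) (h.dom δ η) :=
  ((h.diffΓ.comp h.differentiableOn_inv fun _ hx => h.inv_mem hx).mono fun _ hy => hy.1).sub
    h.differentiableOn_turn

theorem differentiableAt_height {x : ℂ} (hx : x ∈ h.dom δ η) :
    DifferentiableAt ℂ (h.height δ η) x :=
  h.differentiableOn_height.differentiableAt ((h.isOpen_dom δ η).mem_nhds hx)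

theorem differentiableAt_translateFst {p : ℂ × ℂ} (hp : p.1 ∈ h.dom δ η) :
    DifferentiableAt ℂ (h.translateFst δ η) p := by
  have h1 : DifferentiableAt ℂ (fun p : ℂ × ℂ => h.height δ η p.1) p :=
    (h.differentiableAt_height hp).comp p differentiableAt_fst
  unfold translateFst
  fun_prop

theorem differentiableAt_translate {p : ℂ × ℂ} (hp : p ∈ h.translateDom δ η) :
    DifferentiableAt ℂ (h.translate δ η) p := by
  have h1 : DifferentiableAt ℂ (fun p : ℂ × ℂ => h.height δ η p.1) p :=
    (h.differentiableAt_height hp.1).comp p differentiableAt_fst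
  have h2 := h.differentiableAt_translateFst hp.1
  have h3 : DifferentiableAt ℂ (fun p => h.height (-δ) (-η) (h.translateFst δ η p)) p :=
    (h.differentiableAt_height hp.2).comp p h2
  exact h2.prodMk (differentiableAt_snd.add (h3.sub h1))

theorem isOpen_translateDom : IsOpen (h.translateDom δ η) := by
  rw [isOpen_iff_mem_nhds]
  intro p hp
  have h1 : ∀ᶠ q in 𝓝 p, q.1 ∈ h.dom δ η :=
    continuousAt_fst.eventually ((h.isOpen_dom δ η).mem_nhds hp.1)
  have h2 : ∀ᶠ q in 𝓝 p, h.translateFst δ η q ∈ h.dom (-δ) (-η) :=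
    (h.differentiableAt_translateFst hp.1).continuousAt.eventually
      ((h.isOpen_dom (-δ) (-η)).mem_nhds hp.2)
  filter_upwards [h1, h2] with q h1 h2 using ⟨h1, h2⟩

theorem disp_add_int {x : ℂ} (hx : x ∈ Φ '' strip r) (m : ℤ) :
    h.disp δ (x + m) = h.disp δ x := by
  rw [disp, disp, h.inv_add_int hx, add_right_comm,
    h.apply_add_int (add_real_mem_strip (h.inv_mem hx) δ)]
  ring

theorem add_int_mem_dom {x : ℂ} (hx : x ∈ h.dom δ η) (m : ℤ) : x + m ∈ h.dom δ η :=
  ⟨h.add_int_mem_image hx.1 m, by rw [h.disp_add_int hx.1]; exact hx.2⟩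

theorem turn_add_int {x : ℂ} (hx : x ∈ Φ '' strip r) (m : ℤ) :
    h.turn δ η (x + m) = h.turn δ η x := by
  rw [turn, turn, h.disp_add_int hx]

theorem height_add_int {x : ℂ} (hx : x ∈ Φ '' strip r) (m : ℤ) :
    h.height δ η (x + m) = h.height δ η x + m * d := by
  rw [height, height, h.turn_add_int hx, h.inv_add_int hx, h.apply_add_int' (h.inv_mem hx)]
  ring

theorem translateFst_add_int {p : ℂ × ℂ} (hp : p.1 ∈ Φ '' strip r) (m n : ℤ) :
    h.translateFst δ η (p + ((m : ℂ), (n : ℂ))) = h.translateFst δ η p + m := by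
  simp only [translateFst, Prod.fst_add, Prod.snd_add, h.height_add_int hp]
  have : 2 * (Real.pi : ℂ) * (p.2 + n - (h.height δ η p.1 + m * d))
      = 2 * Real.pi * (p.2 - h.height δ η p.1) + ((n - m * d : ℤ) : ℂ) * (2 * Real.pi) := by
    push_cast; ring
  rw [this, Complex.sin_add_int_mul_two_pi]
  ring

theorem add_int_mem_translateDom {p : ℂ × ℂ} (hp : p ∈ h.translateDom δ η) (m n : ℤ) :
    p + ((m : ℂ), (n : ℂ)) ∈ h.translateDom δ η :=
  ⟨h.add_int_mem_dom hp.1 m, by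
    rw [h.translateFst_add_int hp.1.1]; exact h.add_int_mem_dom hp.2 m⟩

theorem translate_add_int {p : ℂ × ℂ} (hp : p ∈ h.translateDom δ η) (m n : ℤ) :
    h.translate δ η (p + ((m : ℂ), (n : ℂ))) = h.translate δ η p + ((m : ℂ), (n : ℂ)) := by
  simp only [translate, h.translateFst_add_int hp.1.1, Prod.fst_add, Prod.snd_add,
    h.height_add_int hp.1.1, h.height_add_int hp.2.1, Prod.mk_add_mk, Prod.mk.injEq, true_and]
  ring

/-- The map `IsGraphLift.translate` translates the points of the curve by `δ`. -/
theorem translate_apply {s : ℂ} (hs : s ∈ strip r) (hd : Φ s ∈ h.dom δ η) :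
    h.translate δ η (Φ s, Γ s) = (Φ (s + δ), Γ (s + δ)) := by
  have hs' := add_real_mem_strip hs δ
  have e1 : h.translateFst δ η (Φ s, Γ s) = Φ (s + δ) := by
    simp only [translateFst, height, h.inv_apply hs, sub_sub_cancel, h.sin_turn hd]
    rw [disp, h.inv_apply hs]; ring
  -- The displacement from `Φ (s + δ)` back to `Φ s` is the opposite one, and replacing `η` by `-η`
  -- cancels the sign. The two heights therefore sit below the curve by the same amount at the two
  -- points.
  have e2 : h.turn (-δ) (-η) (Φ (s + δ)) = h.turn δ η (Φ s) := by
    simp only [turn, disp, h.inv_apply hs, h.inv_apply hs']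
    congr 1
    push_cast
    rw [add_neg_cancel_right, ← neg_div_neg_eq, neg_sub, neg_neg]
  simp only [translate, e1, height, e2, h.inv_apply hs, h.inv_apply hs']
  ext <;> simp

/-! #### The real restriction -/

theorem disp_translate_neg {x : ℂ} (hx : x ∈ Φ '' strip r) :
    h.disp δ (Φ (h.inv x + (-δ : ℝ))) = -h.disp (-δ) x := by
  have hs := add_real_mem_strip (h.inv_mem hx) (-δ)
  rw [disp, disp, h.inv_apply hs]
  push_cast
  rw [neg_add_cancel_right, h.apply_inv hx]; ring

/-- The backward displacement at `x` is the opposite of the forward one at the preimage of `x` under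
the translation, which is again a real point. -/
theorem ofReal_mem_dom_neg (hd : ∀ x : ℝ, (x : ℂ) ∈ h.dom δ η) (x : ℝ) :
    (x : ℂ) ∈ h.dom (-δ) (-η) := by
  obtain ⟨s, hs⟩ := h.exists_real_eq x
  have hx := h.ofReal_mem_image x
  refine ⟨hx, ?_⟩
  have h1 := h.disp_translate_neg (δ := δ) hx
  rw [abs_neg, ← norm_neg, ← h1]
  have e : Φ (h.inv x + (-δ : ℝ)) = ((Φ (s - δ : ℝ)).re : ℂ) := by
    rw [h.ofReal_re, ← hs, h.inv_apply (ofReal_mem_strip h.pos s)]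
    push_cast
    rw [sub_eq_add_neg]
  rw [e]
  exact (hd _).2

theorem disp_ofReal_im (x : ℝ) : (h.disp δ x).im = 0 := by
  obtain ⟨s, hs⟩ := h.exists_real_eq x
  rw [disp, ← hs, h.inv_apply (ofReal_mem_strip h.pos s), ← Complex.ofReal_add, Complex.sub_im,
    h.realΦ, h.realΦ, sub_zero]

theorem disp_ofReal (x : ℝ) : h.disp δ x = (h.disp δ x).re := Complex.ext rfl (h.disp_ofReal_im x)

theorem turn_ofReal {x : ℝ} (hx : (x : ℂ) ∈ h.dom δ η) :
    (h.turn δ η x).im = 0 ∧ 0 < Real.cos (2 * Real.pi * (h.turn δ η x).re) := by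
  have h1 := h.norm_disp_div_lt hx
  rw [turn]
  rw [h.disp_ofReal, ← Complex.ofReal_div] at h1 ⊢
  exact arcsinTurn_ofReal (by rwa [Complex.norm_real, Real.norm_eq_abs] at h1)

theorem height_ofReal {x : ℝ} (hx : (x : ℂ) ∈ h.dom δ η) :
    h.height δ η x = (h.height δ η x).re := by
  obtain ⟨s, hs⟩ := h.exists_real_eq x
  refine Complex.ext rfl ?_
  rw [Complex.ofReal_im, height, Complex.sub_im, (h.turn_ofReal hx).1, ← hs,
    h.inv_apply (ofReal_mem_strip h.pos s), h.realΓ, sub_zero]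

/-- The restriction of `IsGraphLift.translate` to `ℝ²`. -/
def translateReal (δ η : ℝ) (q : ℝ × ℝ) : ℝ × ℝ :=
  (q.1 + η * Real.sin (2 * Real.pi * (q.2 - (h.height δ η q.1).re)),
    q.2 + ((h.height (-δ) (-η)
      (q.1 + η * Real.sin (2 * Real.pi * (q.2 - (h.height δ η q.1).re)) : ℝ)).re
        - (h.height δ η q.1).re))

theorem translate_ofReal2 (hd : ∀ x : ℝ, (x : ℂ) ∈ h.dom δ η) (q : ℝ × ℝ) :
    h.translate δ η (ofReal2 q) = ofReal2 (h.translateReal δ η q) := by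
  have e : h.translateFst δ η (ofReal2 q) = ((h.translateReal δ η q).1 : ℝ) := by
    simp only [translateFst, translateReal, ofReal2]
    rw [h.height_ofReal (hd q.1)]
    push_cast
    simp
  simp only [translate, e]
  simp only [ofReal2, Prod.mk.injEq, true_and]
  rw [h.height_ofReal (hd q.1), h.height_ofReal (h.ofReal_mem_dom_neg hd _)]
  simp only [translateReal, Complex.ofReal_add, Complex.ofReal_sub]

theorem translateReal_realCurve (hd : ∀ x : ℝ, (x : ℂ) ∈ h.dom δ η) (s : ℝ) :
    h.translateReal δ η (realCurve Φ Γ s) = realCurve Φ Γ (s + δ) := by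
  have h1 := h.translate_ofReal2 hd (realCurve Φ Γ s)
  have e : ∀ s : ℝ, ofReal2 (realCurve Φ Γ s) = (Φ s, Γ s) := fun s => by
    simp only [ofReal2, realCurve, h.ofReal_re, h.ofReal_re']
  rw [e, h.translate_apply (ofReal_mem_strip h.pos s) (h.ofReal_re s ▸ hd _),
    ← Complex.ofReal_add, ← e] at h1
  have h2 := congrArg Prod.fst h1
  have h3 := congrArg Prod.snd h1
  simp only [ofReal2, Complex.ofReal_inj] at h2 h3
  exact (Prod.ext h2 h3).symm

end IsGraphLift

/-! ### Restrictions of holomorphic functions to the real line -/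

theorem analyticOnNhd_re_ofReal {g : ℂ → ℂ} {S : Set ℂ} (hS : IsOpen S) (hg : DifferentiableOn ℂ g S)
    (hreal : ∀ x : ℝ, (x : ℂ) ∈ S) : AnalyticOnNhd ℝ (fun x : ℝ => (g x).re) univ := fun x _ =>
  (hg.analyticAt (hS.mem_nhds (hreal x))).re_ofReal

theorem hasDerivAt_re_ofReal {g : ℂ → ℂ} {S : Set ℂ} (hS : IsOpen S) (hg : DifferentiableOn ℂ g S)
    {x : ℝ} (hx : (x : ℂ) ∈ S) : HasDerivAt (fun x : ℝ => (g x).re) (deriv g x).re x :=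
  (hg.differentiableAt (hS.mem_nhds hx)).hasDerivAt.real_of_complex

/-- The restriction to `ℝ` of a holomorphic function has a real-analytic primitive. -/
theorem exists_analytic_primitive {g : ℂ → ℂ} {S : Set ℂ} (hS : IsOpen S)
    (hg : DifferentiableOn ℂ g S) (hreal : ∀ x : ℝ, (x : ℂ) ∈ S) :
    ∃ J : ℝ → ℝ, AnalyticOnNhd ℝ J univ ∧ ∀ x : ℝ, HasDerivAt J (g x).re x := by
  have hcont : Continuous (fun x : ℝ => (g x).re) := by
    rw [← continuousOn_univ]
    exact (analyticOnNhd_re_ofReal hS hg hreal).continuousOn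
  set J : ℝ → ℝ := fun x => ∫ t in (0 : ℝ)..x, (g t).re with hJ
  have hJ' : ∀ x : ℝ, HasDerivAt J (g x).re x := fun x =>
    (hcont.integral_hasStrictDerivAt 0 x).hasDerivAt
  refine ⟨J, fun x₀ _ => ?_, hJ'⟩
  obtain ⟨ρ, hρ, hball⟩ := Metric.isOpen_iff.1 hS _ (hreal x₀)
  -- Analyticity of the integral is local: on a disc it differs by a constant from the real part of
  -- a holomorphic primitive.
  obtain ⟨P, hP⟩ := (hg.mono hball).isExactOn_ball
  have hmem : ∀ x ∈ Metric.ball x₀ ρ, (x : ℂ) ∈ Metric.ball (x₀ : ℂ) ρ := by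
    intro x hx
    rwa [Metric.mem_ball, Complex.dist_of_im_eq (by simp), Complex.ofReal_re, Complex.ofReal_re]
  have hPan : AnalyticAt ℝ (fun x : ℝ => (P x).re) x₀ := by
    refine AnalyticAt.re_ofReal (DifferentiableOn.analyticAt (s := Metric.ball (x₀ : ℂ) ρ) ?_
      (Metric.ball_mem_nhds _ hρ))
    exact fun z hz => (hP z hz).differentiableAt.differentiableWithinAt
  have hderiv : ∀ x ∈ Metric.ball x₀ ρ, HasDerivAt (fun x : ℝ => J x - (P x).re) 0 x := by
    intro x hx
    have := (hJ' x).sub (hP x (hmem x hx)).real_of_complex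
    rwa [sub_self] at this
  have hconst : ∀ x ∈ Metric.ball x₀ ρ, J x - (P x).re = J x₀ - (P x₀).re := by
    intro x hx
    exact Metric.isOpen_ball.is_const_of_deriv_eq_zero (convex_ball x₀ ρ).isPreconnected
      (fun y hy => (hderiv y hy).differentiableAt.differentiableWithinAt)
      (fun y hy => (hderiv y hy).deriv) hx (Metric.mem_ball_self hρ)
  refine (hPan.add (analyticAt_const (v := J x₀ - (P x₀).re))).congr ?_
  filter_upwards [Metric.ball_mem_nhds x₀ hρ] with x hx
  rw [Pi.add_apply, ← hconst x hx]; ring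

/-! ### The translation of the curve is Hamiltonian and has positive twist -/

namespace IsGraphLift

variable {r : ℝ} {Φ Γ : ℂ → ℂ} {d : ℤ} (h : IsGraphLift r Φ Γ d) {δ η : ℝ}

/-- The difference of the two solutions `turn` has a periodic primitive. -/
theorem exists_primitive_turn_sub (hd : ∀ x : ℝ, (x : ℂ) ∈ h.dom δ η) :
    ∃ B : ℝ → ℝ, AnalyticOnNhd ℝ B univ ∧ (∀ x, B (x + 1) = B x) ∧
      ∀ x : ℝ, HasDerivAt B ((h.turn δ η x).re - (h.turn (-δ) (-η) x).re) x := by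
  have hd' := h.ofReal_mem_dom_neg hd
  have hpi := Real.pi_ne_zero
  obtain ⟨J, hJ, hJ'⟩ := exists_analytic_primitive (h.isOpen_dom δ η) h.differentiableOn_turn hd
  set m : ℝ → ℝ := fun x => (h.turn (-δ) (-η) x).re with hm
  have hman : AnalyticOnNhd ℝ m univ :=
    analyticOnNhd_re_ofReal (h.isOpen_dom _ _) h.differentiableOn_turn hd'
  have hmd : ∀ x, HasDerivAt m _ x := fun x =>
    hasDerivAt_re_ofReal (h.isOpen_dom _ _) h.differentiableOn_turn (hd' x)
  have hmper : ∀ x, m (x + 1) = m x := fun x => by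
    have := h.turn_add_int (δ := -δ) (η := -η) (h.ofReal_mem_image x) 1
    simp only [hm]; push_cast at this ⊢; rw [this]
  -- On the real line `v` is the backward translation `Φ s ↦ Φ (s - δ)`, and `m` is `turn δ η`
  -- composed with `v`.
  set v : ℝ → ℝ := fun x => x - η * Real.sin (2 * Real.pi * m x) with hv
  have hvan : AnalyticOnNhd ℝ v univ := fun x _ => analyticAt_id.sub (analyticAt_const.mul
    (Real.analyticAt_sin.comp (analyticAt_const.mul (hman x trivial))))
  have hmreal : ∀ x : ℝ, h.turn (-δ) (-η) x = m x := fun x =>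
    Complex.ext rfl (h.turn_ofReal (hd' x)).1
  have hvdisp : ∀ x : ℝ, (v x : ℂ) = x + h.disp (-δ) x := by
    intro x
    rw [← h.sin_turn (hd' x), hmreal]
    simp only [hv]
    push_cast
    ring
  have hmv : ∀ x : ℝ, (h.turn δ η (v x)).re = m x := by
    intro x
    have hx := h.ofReal_mem_image x
    have e : (v x : ℂ) = Φ (h.inv x + (-δ : ℝ)) := by
      rw [hvdisp, disp]; ring
    simp only [hm, turn]
    rw [e, h.disp_translate_neg hx, Complex.ofReal_neg, div_neg, neg_div]
  have hJper : ∃ c, ∀ x, J (x + 1) = J x + c := by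
    have : ∀ x, HasDerivAt (fun x => J (x + 1) - J x) 0 x := by
      intro x
      have h1 := ((hJ' (x + 1)).comp_add_const x 1).sub (hJ' x)
      have h2 := h.turn_add_int (δ := δ) (η := η) (h.ofReal_mem_image x) 1
      push_cast at h1 h2
      rwa [h2, sub_self] at h1
    refine ⟨J (0 + 1) - J 0, fun x => ?_⟩
    have := is_const_of_deriv_eq_zero (fun x => (this x).differentiableAt) (fun x => (this x).deriv) x 0
    linarith
  obtain ⟨c, hc⟩ := hJper
  -- Substitute `x = v + η sin (2πm)` in `∫ m dx`: the first term is `∫ turn δ η dv = J (v x)`, the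
  -- second is `η ∫ m d(sin (2πm))`, computed by parts. The period `c` of `J` cancels in `J x - J (v
  -- x)` because `v` commutes with the unit translation.
  refine ⟨fun x => J x - J (v x) - η * (m x * Real.sin (2 * Real.pi * m x) +
    Real.cos (2 * Real.pi * m x) / (2 * Real.pi)), fun x _ => ?_, fun x => ?_, fun x => ?_⟩
  · have hmx := hman x trivial
    have h1 : AnalyticAt ℝ (fun x => J (v x)) x := (hJ (v x) trivial).comp (hvan x trivial)
    have h2 : AnalyticAt ℝ (fun x => Real.sin (2 * Real.pi * m x)) x :=
      Real.analyticAt_sin.comp (analyticAt_const.mul hmx)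
    have h3 : AnalyticAt ℝ (fun x => Real.cos (2 * Real.pi * m x)) x :=
      Real.analyticAt_cos.comp (analyticAt_const.mul hmx)
    exact ((hJ x trivial).sub h1).sub (analyticAt_const.mul ((hmx.mul h2).add (h3.div analyticAt_const (by positivity))))
  · have : v (x + 1) = v x + 1 := by simp only [hv, hmper]; ring
    simp only [hmper, this, hc]; ring
  · have h1 := ((hmd x).const_mul (2 * Real.pi)).sin
    have h2 := ((hmd x).const_mul (2 * Real.pi)).cos
    have h3 : HasDerivAt v _ x := (hasDerivAt_id x).sub (h1.const_mul η)
    have h4 := ((hJ' x).sub ((hJ' (v x)).comp x h3)).sub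
      ((((hmd x).mul h1).add (h2.div_const (2 * Real.pi))).const_mul η)
    refine h4.congr_deriv ?_
    rw [hmv]
    simp only [hm]
    field_simp
    ring

/-- The flow along `height δ η` ends at the height of the wrong graph; the vertical shear by `height
(-δ) (-η) - height δ η` corrects it. The terms in `Γ` cancel in this difference, leaving the
difference of the two functions `turn`. -/
theorem exists_isHamDiffeo_translateReal (hd : ∀ x : ℝ, (x : ℂ) ∈ h.dom δ η) :
    ∃ g : RTorus → RTorus, IsHamDiffeo g ∧ ∀ q, g (projR q) = projR (h.translateReal δ η q) := by
  obtain ⟨B, hB, hBper, hB'⟩ := h.exists_primitive_turn_sub hd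
  obtain ⟨g₁, hg₁, e₁⟩ := exists_isHamDiffeo_shear hB hBper hB'
  obtain ⟨g₂, hg₂, e₂⟩ := exists_isHamDiffeo_shear_along (α := fun x => (h.height δ η x).re) η d
    (analyticOnNhd_re_ofReal (h.isOpen_dom _ _) h.differentiableOn_height hd)
    (fun x => by
      have := h.height_add_int (δ := δ) (η := η) (h.ofReal_mem_image x) 1
      push_cast at this ⊢
      rw [this]; simp)
    (fun x => hasDerivAt_re_ofReal (h.isOpen_dom _ _) h.differentiableOn_height (hd x))
  refine ⟨g₁ ∘ g₂, .comp _ _ hg₁ hg₂, fun q => ?_⟩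
  rw [Function.comp_apply, e₂, e₁]
  simp only [translateReal, height, Complex.sub_re]
  congr 2
  ring

/-- The twist of `translateReal` along the curve is positive. -/
theorem exists_hasFDerivAt_translateReal (hη : 0 < η) (hd : ∀ x : ℝ, (x : ℂ) ∈ h.dom δ η) (s : ℝ) :
    ∃ D : ℝ × ℝ →L[ℝ] ℝ × ℝ, HasFDerivAt (h.translateReal δ η) D (realCurve Φ Γ s) ∧
      0 < (D (0, 1)).1 := by
  have hd' := h.ofReal_mem_dom_neg hd
  have hα : Differentiable ℝ (fun x : ℝ => (h.height δ η x).re) := fun x =>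
    (hasDerivAt_re_ofReal (h.isOpen_dom _ _) h.differentiableOn_height (hd x)).differentiableAt
  have hβ : Differentiable ℝ (fun x : ℝ => (h.height (-δ) (-η) x).re) := fun x =>
    (hasDerivAt_re_ofReal (h.isOpen_dom _ _) h.differentiableOn_height (hd' x)).differentiableAt
  have hα' : Differentiable ℝ (fun q : ℝ × ℝ => (h.height δ η q.1).re) := hα.comp differentiable_fst
  have h1 : Differentiable ℝ (fun q : ℝ × ℝ =>
      q.1 + η * Real.sin (2 * Real.pi * (q.2 - (h.height δ η q.1).re))) := by
    fun_prop
  have h2 : Differentiable ℝ (h.translateReal δ η) :=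
    h1.prodMk (differentiable_snd.add ((hβ.comp h1).sub hα'))
  refine ⟨_, (h2 _).hasFDerivAt, ?_⟩
  set p := realCurve Φ Γ s with hp
  have hline : HasDerivAt (fun y : ℝ => ((p.1, y) : ℝ × ℝ)) (0, 1) p.2 :=
    (hasDerivAt_const _ _).prodMk (hasDerivAt_id _)
  have h3 : HasDerivAt (fun y : ℝ => (h.translateReal δ η (p.1, y)).1)
      (fderiv ℝ (h.translateReal δ η) p (0, 1)).1 p.2 :=
    (ContinuousLinearMap.fst ℝ ℝ ℝ).hasFDerivAt.comp_hasDerivAt _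
      ((h2 p).hasFDerivAt.comp_hasDerivAt_of_eq p.2 hline rfl)
  have h4 : ∀ A : ℝ, HasDerivAt (fun y : ℝ => p.1 + η * Real.sin (2 * Real.pi * (y - A)))
      (η * (Real.cos (2 * Real.pi * (p.2 - A)) * (2 * Real.pi))) p.2 := by
    intro A
    have := (((((hasDerivAt_id p.2).sub_const A).const_mul (2 * Real.pi)).sin).const_mul η).const_add p.1
    rwa [mul_one] at this
  simp only [translateReal] at h3
  rw [h3.unique (h4 _)]
  -- On the curve the phase of the sine is exactly `turn`, where its cosine is positive.
  have e : p.2 - (h.height δ η p.1).re = (h.turn δ η (p.1 : ℝ)).re := by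
    have e1 : ((p.1 : ℝ) : ℂ) = Φ s := h.ofReal_re s
    rw [height, e1, h.inv_apply (ofReal_mem_strip h.pos s), Complex.sub_re]
    simp [hp, realCurve]
  rw [e]
  have := (h.turn_ofReal (hd p.1)).2
  have := Real.pi_pos
  positivity

end IsGraphLift

/-! ### Dependence of the translation on its parameters, and smallness on compact sets -/

namespace IsGraphLift

variable {r : ℝ} {Φ Γ : ℂ → ℂ} {d : ℤ} (h : IsGraphLift r Φ Γ d) {δ η : ℝ}

theorem continuousAt_disp {x : ℂ} (hx : x ∈ Φ '' strip r) :
    ContinuousAt (fun z : ℝ × ℂ => h.disp z.1 z.2) (δ, x) := by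
  have h1 : ContinuousAt (fun z : ℝ × ℂ => h.inv z.2 + z.1) (δ, x) := by
    have : ContinuousAt (fun z : ℝ × ℂ => h.inv z.2) (δ, x) :=
      (h.differentiableOn_inv.continuousOn.continuousAt (h.isOpen_image.mem_nhds hx)).comp_of_eq
        continuousAt_snd rfl
    exact this.add (Complex.continuous_ofReal.continuousAt.comp continuousAt_fst)
  have h2 : ContinuousAt (fun z : ℝ × ℂ => Φ (h.inv z.2 + z.1)) (δ, x) :=
    (h.diffΦ.continuousOn.continuousAt ((isOpen_strip r).mem_nhds
      (add_real_mem_strip (h.inv_mem hx) δ))).comp_of_eq h1 rfl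
  exact h2.sub continuousAt_snd

theorem eventually_mem_dom {x : ℂ} (hx : x ∈ h.dom δ η) :
    ∀ᶠ z : ℝ × ℂ in 𝓝 (δ, x), z.2 ∈ h.dom z.1 η := by
  filter_upwards [continuousAt_snd.eventually (h.isOpen_image.mem_nhds hx.1),
    (h.continuousAt_disp hx.1).norm.eventually (gt_mem_nhds hx.2)] with z h1 h2 using ⟨h1, h2⟩

theorem continuousAt_height {x : ℂ} (hx : x ∈ h.dom δ η) :
    ContinuousAt (fun z : ℝ × ℂ => h.height z.1 η z.2) (δ, x) := by
  have h1 : ContinuousAt (fun z : ℝ × ℂ => h.turn z.1 η z.2) (δ, x) :=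
    (differentiableAt_arcsinTurn (h.norm_disp_div_lt hx)).continuousAt.comp_of_eq
      ((h.continuousAt_disp hx.1).div_const _) rfl
  have h2 : ContinuousAt (fun z : ℝ × ℂ => h.inv z.2) (δ, x) :=
    (h.differentiableOn_inv.continuousOn.continuousAt (h.isOpen_image.mem_nhds hx.1)).comp_of_eq
      continuousAt_snd rfl
  have h3 : ContinuousAt (fun z : ℝ × ℂ => Γ (h.inv z.2)) (δ, x) :=
    (h.diffΓ.continuousOn.continuousAt ((isOpen_strip r).mem_nhds (h.inv_mem hx.1))).comp_of_eq h2 rfl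
  exact h3.sub h1

theorem continuousAt_translateFst {p : ℂ × ℂ} (hp : p.1 ∈ h.dom δ η) :
    ContinuousAt (fun z : ℝ × (ℂ × ℂ) => h.translateFst z.1 η z.2) (δ, p) := by
  have h1 : ContinuousAt (fun z : ℝ × (ℂ × ℂ) => h.height z.1 η z.2.1) (δ, p) :=
    (h.continuousAt_height hp).comp_of_eq
      (continuousAt_fst.prodMk (continuousAt_fst.comp continuousAt_snd)) rfl
  unfold translateFst
  fun_prop

theorem continuousAt_height_translateFst {p : ℂ × ℂ} (hp : p ∈ h.translateDom δ η) :
    ContinuousAt (fun z : ℝ × (ℂ × ℂ) => h.height (-z.1) (-η) (h.translateFst z.1 η z.2)) (δ, p) :=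
  (h.continuousAt_height hp.2).comp_of_eq
    (continuousAt_fst.neg.prodMk (h.continuousAt_translateFst hp.1)) rfl

theorem continuousAt_translate {p : ℂ × ℂ} (hp : p ∈ h.translateDom δ η) :
    ContinuousAt (fun z : ℝ × (ℂ × ℂ) => h.translate z.1 η z.2) (δ, p) := by
  have h1 : ContinuousAt (fun z : ℝ × (ℂ × ℂ) => h.height z.1 η z.2.1) (δ, p) :=
    (h.continuousAt_height hp.1).comp_of_eq
      (continuousAt_fst.prodMk (continuousAt_fst.comp continuousAt_snd)) rfl
  exact (h.continuousAt_translateFst hp.1).prodMk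
    ((continuousAt_snd.comp continuousAt_snd).add ((h.continuousAt_height_translateFst hp).sub h1))

theorem eventually_mem_translateDom {p : ℂ × ℂ} (hp : p ∈ h.translateDom δ η) :
    ∀ᶠ z : ℝ × (ℂ × ℂ) in 𝓝 (δ, p), z.2 ∈ h.translateDom z.1 η := by
  have h1 : ContinuousAt (fun z : ℝ × (ℂ × ℂ) => (z.1, z.2.1)) (δ, p) :=
    continuousAt_fst.prodMk (continuousAt_fst.comp continuousAt_snd)
  have h2 : ContinuousAt (fun z : ℝ × (ℂ × ℂ) => (-z.1, h.translateFst z.1 η z.2)) (δ, p) :=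
    continuousAt_fst.neg.prodMk (h.continuousAt_translateFst hp.1)
  filter_upwards [h1.eventually (h.eventually_mem_dom hp.1),
    h2.eventually (h.eventually_mem_dom hp.2)] with z h1 h2 using ⟨h1, h2⟩

theorem disp_zero {x : ℂ} (hx : x ∈ Φ '' strip r) : h.disp 0 x = 0 := by
  simp [disp, h.apply_inv hx]

theorem mem_dom_zero {x : ℂ} (hη : η ≠ 0) (hx : x ∈ Φ '' strip r) : x ∈ h.dom 0 η :=
  ⟨hx, by rw [h.disp_zero hx, norm_zero]; exact abs_pos.2 hη⟩

theorem height_zero {x : ℂ} (hx : x ∈ Φ '' strip r) : h.height 0 η x = Γ (h.inv x) := by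
  rw [height, turn, h.disp_zero hx, zero_div, arcsinTurn_zero, sub_zero]

/-- The amplitude `η` is fixed first, from the case `δ = 0`, where `disp` vanishes and everything is
continuous at `η = 0`. Only then is `δ` taken small, since the domain requires `disp δ` to be
smaller than `|η|`; compactness of `L` makes both choices uniform. -/
theorem exists_translate_small {L : Set (ℂ × ℂ)} (hL : IsCompact L)
    (hLΩ : ∀ p ∈ L, p.1 ∈ Φ '' strip r) {κ : ℝ} (hκ : 0 < κ) :
    ∃ η > 0, ∀ᶠ δ in 𝓝 (0 : ℝ), ∀ p ∈ L,
      p ∈ h.translateDom δ η ∧ ‖h.translate δ η p - p‖ < κ := by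
  have hΩ := h.isOpen_image
  set g : ℂ → ℂ := fun x => Γ (h.inv x) with hg
  have hgc : ∀ x ∈ Φ '' strip r, ContinuousAt g x := fun x hx =>
    (h.diffΓ.continuousOn.comp h.differentiableOn_inv.continuousOn
      fun _ hx => h.inv_mem hx).continuousAt (hΩ.mem_nhds hx)
  -- This is `translateFst` at `δ = 0`, where `height` reduces to `g`; unlike `turn`, it makes sense
  -- at `η = 0`.
  set X : ℝ → ℂ × ℂ → ℂ := fun η p => p.1 + η * Complex.sin (2 * Real.pi * (p.2 - g p.1)) with hX
  obtain ⟨η, hηL, hη⟩ : ∃ η : ℝ, (∀ p ∈ L, X η p ∈ Φ '' strip r ∧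
      ‖(X η p, p.2 + (g (X η p) - g p.1)) - p‖ < κ) ∧ 0 < η := by
    have key : ∀ᶠ η in 𝓝 (0 : ℝ), ∀ p ∈ L, X η p ∈ Φ '' strip r ∧
        ‖(X η p, p.2 + (g (X η p) - g p.1)) - p‖ < κ := by
      refine hL.eventually_forall_of_forall_eventually fun p hp => ?_
      have hpΩ := hLΩ p hp
      have h1 : ContinuousAt (fun z : ℝ × (ℂ × ℂ) => g z.2.1) (0, p) :=
        (hgc _ hpΩ).comp_of_eq (continuousAt_fst.comp continuousAt_snd) rfl
      have h2 : ContinuousAt (fun z : ℝ × (ℂ × ℂ) => X z.1 z.2) (0, p) := by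
        simp only [hX]; fun_prop
      have e : X 0 p = p.1 := by simp [hX]
      have h3 : ContinuousAt (fun z : ℝ × (ℂ × ℂ) => g (X z.1 z.2)) (0, p) :=
        (hgc _ hpΩ).comp_of_eq h2 e
      have h4 : ContinuousAt (fun z : ℝ × (ℂ × ℂ) =>
          ‖(X z.1 z.2, z.2.2 + (g (X z.1 z.2) - g z.2.1)) - z.2‖) (0, p) :=
        ((h2.prodMk ((continuousAt_snd.comp continuousAt_snd).add (h3.sub h1))).sub
          continuousAt_snd).norm
      have h5 : ∀ᶠ z : ℝ × (ℂ × ℂ) in 𝓝 (0, p), X z.1 z.2 ∈ Φ '' strip r :=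
        h2.eventually (hΩ.mem_nhds (by simpa only [e] using hpΩ))
      exact h5.and (h4.eventually (gt_mem_nhds (by simpa [e] using hκ)))
    exact ((key.filter_mono nhdsWithin_le_nhds).and (self_mem_nhdsWithin (s := Ioi (0 : ℝ)))).exists
  refine ⟨η, hη, hL.eventually_forall_of_forall_eventually fun p hp => ?_⟩
  obtain ⟨hX1, hX2⟩ := hηL p hp
  have hpΩ := hLΩ p hp
  have e1 : h.translateFst 0 η p = X η p := by
    simp only [translateFst, h.height_zero hpΩ, hX, hg]
  have hdom : p ∈ h.translateDom 0 η :=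
    ⟨h.mem_dom_zero hη.ne' hpΩ, by rw [e1, neg_zero]; exact h.mem_dom_zero (neg_ne_zero.2 hη.ne') hX1⟩
  have e2 : h.translate 0 η p = (X η p, p.2 + (g (X η p) - g p.1)) := by
    simp only [translate, e1, neg_zero, h.height_zero hpΩ, h.height_zero hX1, hg]
  have h4 : ContinuousAt (fun z : ℝ × (ℂ × ℂ) => ‖h.translate z.1 η z.2 - z.2‖) (0, p) :=
    ((h.continuousAt_translate hdom).sub continuousAt_snd).norm
  exact (h.eventually_mem_translateDom hdom).and
    (h4.eventually (gt_mem_nhds (by simpa only [e2] using hX2)))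

/-! #### The vertical perturbation -/

/-- A function with simple zeros at the points of the curve with parameter in `(1/2M)ℤ`. -/
def wave (M : ℕ) (x : ℂ) : ℂ :=
  Complex.sin (2 * Real.pi * M * h.inv x) * deriv h.inv x

theorem differentiableOn_wave (M : ℕ) : DifferentiableOn ℂ (h.wave M) (Φ '' strip r) := by
  have h1 := h.differentiableOn_inv
  have h2 : DifferentiableOn ℂ (deriv h.inv) (Φ '' strip r) := h1.deriv h.isOpen_image
  unfold wave
  fun_prop

theorem deriv_inv_add_int {x : ℂ} (hx : x ∈ Φ '' strip r) (m : ℤ) :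
    deriv h.inv (x + m) = deriv h.inv x := by
  rw [← deriv_comp_add_const]
  have : (fun y => h.inv (y + m)) =ᶠ[𝓝 x] fun y => h.inv y + m := by
    filter_upwards [h.isOpen_image.mem_nhds hx] with y hy using h.inv_add_int hy m
  rw [this.deriv_eq, deriv_add_const]

theorem wave_add_int (M : ℕ) {x : ℂ} (hx : x ∈ Φ '' strip r) (m : ℤ) :
    h.wave M (x + m) = h.wave M x := by
  rw [wave, wave, h.deriv_inv_add_int hx, h.inv_add_int hx]
  have : 2 * (Real.pi : ℂ) * M * (h.inv x + m)
      = 2 * Real.pi * M * h.inv x + ((M * m : ℤ) : ℂ) * (2 * Real.pi) := by push_cast; ring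
  rw [this, Complex.sin_add_int_mul_two_pi]

theorem deriv_ofReal (h : IsGraphLift r Φ Γ d) (s : ℝ) : deriv Φ s = (deriv Φ s).re := by
  refine Complex.ext rfl ?_
  rw [Complex.ofReal_im]
  have hs := ofReal_mem_strip h.pos s
  have h1 : HasDerivAt (fun t : ℝ => Φ t) (deriv Φ s) s := (h.hasDerivAt hs).comp_ofReal
  have h2 : HasDerivAt (fun t : ℝ => (Φ t).im) (deriv Φ s).im s :=
    Complex.imCLM.hasFDerivAt.comp_hasDerivAt s h1
  simp only [h.realΦ] at h2
  exact h2.unique (hasDerivAt_const s 0)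

theorem wave_apply (M : ℕ) {s : ℂ} (hs : s ∈ strip r) :
    h.wave M (Φ s) = Complex.sin (2 * Real.pi * M * s) * (deriv Φ s)⁻¹ := by
  rw [wave, h.inv_apply hs, (h.hasDerivAt_inv hs).deriv]

theorem wave_ofReal (M : ℕ) (x : ℝ) : h.wave M x = (h.wave M x).re := by
  obtain ⟨s, hs⟩ := h.exists_real_eq x
  rw [← hs, h.wave_apply M (ofReal_mem_strip h.pos s), h.deriv_ofReal]
  have : Complex.sin (2 * Real.pi * M * s) * ((deriv Φ s).re : ℂ)⁻¹
    = ((Real.sin (2 * Real.pi * M * s) * (deriv Φ s).re⁻¹ : ℝ) : ℂ) := by push_cast; rfl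
  rw [this, Complex.ofReal_re]

/-- The derivative of `wave` at one of its zeros. -/
theorem hasDerivAt_wave (M : ℕ) {s : ℝ} (hs : Real.sin (2 * Real.pi * M * s) = 0) :
    HasDerivAt (fun x : ℝ => (h.wave M x).re)
      (2 * Real.pi * M * Real.cos (2 * Real.pi * M * s) / (deriv Φ s).re ^ 2) (Φ s).re := by
  have hss := ofReal_mem_strip h.pos s
  have hmem : Φ s ∈ Φ '' strip r := ⟨s, hss, rfl⟩
  have h1 := h.hasDerivAt_inv hss
  have h2 : HasDerivAt (deriv h.inv) (deriv (deriv h.inv) (Φ s)) (Φ s) :=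
    ((h.differentiableOn_inv.deriv h.isOpen_image).differentiableAt
      (h.isOpen_image.mem_nhds hmem)).hasDerivAt
  have h3 := ((h1.const_mul (2 * Real.pi * M : ℂ)).csin).mul h2
  have hsin : Complex.sin (2 * Real.pi * M * s) = 0 := by exact_mod_cast hs
  rw [h.inv_apply hss, hsin, zero_mul, add_zero, h1.deriv, h.deriv_ofReal] at h3
  rw [← h.ofReal_re] at h3
  have h4 := h3.real_of_complex
  refine h4.congr_deriv ?_
  have : Complex.cos (2 * Real.pi * M * s) * (2 * Real.pi * M * ((deriv Φ s).re : ℂ)⁻¹)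
      * ((deriv Φ s).re : ℂ)⁻¹ = ((2 * Real.pi * M * Real.cos (2 * Real.pi * M * s)
        / (deriv Φ s).re ^ 2 : ℝ) : ℂ) := by
    push_cast
    rw [div_eq_mul_inv, ← inv_pow]
    ring
  rw [this, Complex.ofReal_re]

/-- The factor `deriv h.inv` in `wave` makes it the derivative of a multiple of `cos (2πM · inv x)`,
which is periodic in `x`. -/
theorem exists_isHamDiffeo_wave {M : ℕ} (hM : M ≠ 0) (ε : ℝ) :
    ∃ g : RTorus → RTorus, IsHamDiffeo g ∧
      ∀ q, g (projR q) = projR (q.1, q.2 + ε * (h.wave M q.1).re) := by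
  have hpi := Real.pi_ne_zero
  have hpiC : (Real.pi : ℂ) ≠ 0 := by exact_mod_cast hpi
  have hMC : (M : ℂ) ≠ 0 := by exact_mod_cast hM
  set P : ℂ → ℂ := fun x => -(ε / (2 * Real.pi * M)) * Complex.cos (2 * Real.pi * M * h.inv x) with hP
  have hPd : ∀ x ∈ Φ '' strip r, HasDerivAt P (ε * h.wave M x) x := by
    intro x hx
    have h1 := (h.differentiableOn_inv.differentiableAt (h.isOpen_image.mem_nhds hx)).hasDerivAt
    refine (((h1.const_mul (2 * Real.pi * M : ℂ)).ccos).const_mul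
      (-(ε / (2 * Real.pi * M) : ℂ))).congr_deriv ?_
    rw [wave]
    field_simp
  have hPd' : DifferentiableOn ℂ P (Φ '' strip r) := fun x hx =>
    (hPd x hx).differentiableAt.differentiableWithinAt
  refine exists_isHamDiffeo_shear (B := fun x => (P x).re) (b := fun x => ε * (h.wave M x).re)
    (analyticOnNhd_re_ofReal h.isOpen_image hPd' h.ofReal_mem_image) (fun x => ?_) fun x => ?_
  · have h1 := h.inv_add_int (h.ofReal_mem_image x) 1
    have : 2 * (Real.pi : ℂ) * M * (h.inv x + 1)
      = 2 * Real.pi * M * h.inv x + ((M : ℤ) : ℂ) * (2 * Real.pi) := by push_cast; ring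
    push_cast at h1 ⊢
    simp only [hP, h1, this, Complex.cos_add_int_mul_two_pi]
  · refine (hPd _ (h.ofReal_mem_image x)).real_of_complex.congr_deriv ?_
    simp

end IsGraphLift

/-! ### Traces and eigenvalues -/

/-- The trace of a linear map of the plane. -/
def planeTrace (D : ℝ × ℝ →L[ℝ] ℝ × ℝ) : ℝ := (D (1, 0)).1 + (D (0, 1)).2

/-- Area preservation means determinant one, so the characteristic polynomial depends on the trace
alone. -/
theorem root_of_mem_aroots {D : ℝ × ℝ →L[ℝ] ℝ × ℝ}
    (hD : ∀ u v, areaForm (D u) (D v) = areaForm u v) {μ : ℂ}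
    (hμ : μ ∈ (D : ℝ × ℝ →ₗ[ℝ] ℝ × ℝ).charpoly.aroots ℂ) : μ ^ 2 - planeTrace D * μ + 1 = 0 := by
  set b := Module.Basis.finTwoProd ℝ
  set A := LinearMap.toMatrix b b (D : ℝ × ℝ →ₗ[ℝ] ℝ × ℝ) with hA
  have hA' : ∀ i j, A i j = b.repr (D (b j)) i := fun i j => LinearMap.toMatrix_apply _ _ _ _ _
  have htr : A.trace = planeTrace D := by
    rw [Matrix.trace_fin_two, hA', hA', planeTrace]
    simp [b]
  have hdet : A.det = 1 := by
    rw [Matrix.det_fin_two, hA', hA', hA', hA']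
    have := hD (1, 0) (0, 1)
    simp only [areaForm] at this
    simp only [b, Module.Basis.finTwoProd_zero, Module.Basis.finTwoProd_one]
    simp only [Module.Basis.coe_finTwoProd_repr]
    simp
    linarith
  rw [← LinearMap.charpoly_toMatrix (D : ℝ × ℝ →ₗ[ℝ] ℝ × ℝ) b, ← hA, Matrix.charpoly_fin_two, htr,
    hdet, Polynomial.mem_aroots'] at hμ
  simpa using hμ.2

/-- A root of modulus one would force the trace to be twice its real part, hence at most `2`. -/
theorem isHyperbolicMap_of_two_lt_trace {D : ℝ × ℝ →L[ℝ] ℝ × ℝ}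
    (hD : ∀ u v, areaForm (D u) (D v) = areaForm u v) (ht : 2 < planeTrace D) :
    IsHyperbolicMap D := by
  intro μ hμ h1
  have h := root_of_mem_aroots hD hμ
  have h2 : μ.re * μ.re + μ.im * μ.im = 1 := by
    rw [← Complex.normSq_apply, ← Complex.sq_norm, h1, one_pow]
  have hre := congrArg Complex.re h
  have him := congrArg Complex.im h
  simp [pow_two] at hre him
  set T := planeTrace D
  have h3 : μ.re * (2 * μ.re - T) = 0 := by linarith
  have h4 : μ.im * (2 * μ.re - T) = 0 := by linarith
  have h5 : 2 * μ.re - T = 0 := by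
    have : (μ.re * μ.re + μ.im * μ.im) * (2 * μ.re - T) = 0 := by linear_combination μ.re * h3 + μ.im * h4
    rwa [h2, one_mul] at this
  nlinarith [mul_self_nonneg μ.im]

theorem isEllipticMap_of_abs_trace_lt_two {D : ℝ × ℝ →L[ℝ] ℝ × ℝ}
    (hD : ∀ u v, areaForm (D u) (D v) = areaForm u v) (ht : |planeTrace D| < 2) :
    IsEllipticMap D := by
  intro μ hμ
  have h := root_of_mem_aroots hD hμ
  have hre := congrArg Complex.re h
  have him := congrArg Complex.im h
  simp [pow_two] at hre him
  set T := planeTrace D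
  have hT : T ^ 2 < 4 := by rw [← sq_abs]; nlinarith [abs_nonneg T]
  have him0 : μ.im ≠ 0 := by
    intro h0
    rw [h0] at hre
    nlinarith [sq_nonneg (2 * μ.re - T)]
  refine ⟨?_, him0⟩
  have h5 : 2 * μ.re - T = 0 := by
    have : μ.im * (2 * μ.re - T) = 0 := by linarith
    exact (mul_eq_zero.1 this).resolve_left him0
  rw [← sq_eq_sq₀ (norm_nonneg _) zero_le_one, Complex.sq_norm, Complex.normSq_apply, one_pow]
  linear_combination μ.re * h5 - hre

/-! ### Products of shears -/

/-- The orbit of a vector under a product of matrices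
`[[1, τ j], [0, 1]] * [[1, 0], [k, 1]]`. -/
def shearOrbit (τ : ℕ → ℝ) (k : ℝ) (v : ℝ × ℝ) : ℕ → ℝ × ℝ
  | 0 => v
  | j + 1 => ((shearOrbit τ k v j).1 * (1 + k * τ j) + (shearOrbit τ k v j).2 * τ j,
      (shearOrbit τ k v j).1 * k + (shearOrbit τ k v j).2)

/-- The trace of the product of shears. -/
def shearTrace (τ : ℕ → ℝ) (k : ℝ) (j : ℕ) : ℝ :=
  (shearOrbit τ k (1, 0) j).1 + (shearOrbit τ k (0, 1) j).2

/-- All factors have nonnegative entries and diagonal entries at least `1`. The first diagonal entry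
of the product is strictly greater than `1` as soon as there is a factor. -/
theorem two_lt_shearTrace {τ : ℕ → ℝ} (hτ : ∀ j, 0 < τ j) {k : ℝ} (hk : 0 < k) {q : ℕ} (hq : 0 < q) :
    2 < shearTrace τ k q := by
  have h1 : ∀ j, 1 < (shearOrbit τ k (1, 0) (j + 1)).1 ∧ 0 ≤ (shearOrbit τ k (1, 0) (j + 1)).2 := by
    intro j
    induction j with
    | zero =>
      simp only [shearOrbit]
      have := mul_pos hk (hτ 0)
      constructor <;> linarith
    | succ j ih =>
      rw [shearOrbit]
      have h2 := mul_pos hk (hτ (j + 1))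
      have h3 := mul_nonneg ih.2 (hτ (j + 1)).le
      have h4 : 0 < (shearOrbit τ k (1, 0) (j + 1)).1 := by linarith [ih.1]
      have h5 := mul_pos h4 h2
      have h6 := mul_pos h4 hk
      refine ⟨?_, by linarith [ih.2]⟩
      simp only
      linarith [ih.1]
  have h2 : ∀ j, 0 ≤ (shearOrbit τ k (0, 1) j).1 ∧ 1 ≤ (shearOrbit τ k (0, 1) j).2 := by
    intro j
    induction j with
    | zero => simp [shearOrbit]
    | succ j ih =>
      rw [shearOrbit]
      have h2 := mul_pos hk (hτ j)
      have h3 : 0 ≤ (shearOrbit τ k (0, 1) j).1 * (1 + k * τ j) := mul_nonneg ih.1 (by linarith)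
      have h4 := mul_nonneg (zero_le_one.trans ih.2) (hτ j).le
      have h5 := mul_nonneg ih.1 hk.le
      exact ⟨by linarith, by linarith [ih.2]⟩
  obtain ⟨j, rfl⟩ := Nat.exists_eq_succ_of_ne_zero hq.ne'
  have := (h1 j).1
  have := (h2 (j + 1)).2
  simp only [shearTrace, Nat.succ_eq_add_one]
  linarith

/-- At `k = 0` the product is unipotent with trace `2`, and the derivative of the trace in `k` is
positive because every `τ j` is. For small negative `k` the trace is thus just below `2`. -/
theorem eventually_abs_shearTrace_lt_two {τ : ℕ → ℝ} (hτ : ∀ j, 0 < τ j) {q : ℕ} (hq : 0 < q) :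
    ∀ᶠ k in 𝓝[<] (0 : ℝ), |shearTrace τ k q| < 2 := by
  have h1 : ∀ j, (shearOrbit τ 0 (1, 0) j) = (1, 0) ∧ ∃ a c : ℝ, 0 ≤ a ∧ 0 ≤ c ∧ (0 < j → 0 < a) ∧
      HasDerivAt (fun k => (shearOrbit τ k (1, 0) j).1) a 0 ∧
      HasDerivAt (fun k => (shearOrbit τ k (1, 0) j).2) c 0 := by
    intro j
    induction j with
    | zero => exact ⟨rfl, 0, 0, le_rfl, le_rfl, by simp, hasDerivAt_const _ _, hasDerivAt_const _ _⟩
    | succ j ih =>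
      obtain ⟨e, a, c, ha, hc, -, hA, hC⟩ := ih
      have d1 := (hA.mul (((hasDerivAt_id (0 : ℝ)).mul_const (τ j)).const_add 1)).add
        (hC.mul_const (τ j))
      have d2 := (hA.mul (hasDerivAt_id (0 : ℝ))).add hC
      have hpos : 0 < a + τ j + c * τ j := by
        have := hτ j; have := mul_nonneg hc this.le; linarith
      refine ⟨by simp [shearOrbit, e], a + τ j + c * τ j, 1 + c, hpos.le, by linarith, fun _ => hpos,
        d1.congr_deriv ?_, d2.congr_deriv ?_⟩
      · simp [e]
      · simp [e]
  have h2 : ∀ j, (shearOrbit τ 0 (0, 1) j).2 = 1 ∧ 0 ≤ (shearOrbit τ 0 (0, 1) j).1 ∧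
      DifferentiableAt ℝ (fun k => (shearOrbit τ k (0, 1) j).1) 0 ∧
      ∃ e : ℝ, 0 ≤ e ∧ HasDerivAt (fun k => (shearOrbit τ k (0, 1) j).2) e 0 := by
    intro j
    induction j with
    | zero =>
      exact ⟨rfl, le_rfl, differentiableAt_const _, 0, le_rfl, hasDerivAt_const _ _⟩
    | succ j ih =>
      obtain ⟨e, hB0, hB, c, hc, hE⟩ := ih
      have d2 := (hB.hasDerivAt.mul (hasDerivAt_id (0 : ℝ))).add hE
      refine ⟨by simp [shearOrbit, e], ?_, ?_, (shearOrbit τ 0 (0, 1) j).1 + c, by linarith,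
        d2.congr_deriv (by simp)⟩
      · simp only [shearOrbit, e]
        have := hτ j
        simp only [zero_mul, add_zero, mul_one, one_mul]
        linarith
      · have := hE.differentiableAt
        simp only [shearOrbit]
        fun_prop
  obtain ⟨e, a, -, -, -, ha, hA, -⟩ := h1 q
  obtain ⟨e', -, -, c, hc, hE⟩ := h2 q
  have hd : HasDerivAt (fun k => shearTrace τ k q) (a + c) 0 := hA.add hE
  have h0 : shearTrace τ 0 q = 2 := by simp only [shearTrace, e, e']; norm_num
  have hlow : ∀ᶠ k in 𝓝[<] (0 : ℝ), -2 < shearTrace τ k q :=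
    (hd.continuousAt.eventually (lt_mem_nhds (by simp only [h0]; norm_num))).filter_mono
      nhdsWithin_le_nhds
  have hslope : ∀ᶠ k in 𝓝[<] (0 : ℝ), 0 < slope (fun k => shearTrace τ k q) 0 k :=
    ((hasDerivAt_iff_tendsto_slope.1 hd).mono_left
      (nhdsWithin_mono _ fun k (hk : k < 0) => hk.ne)).eventually
      (lt_mem_nhds (by have := ha hq; linarith))
  filter_upwards [hlow, hslope, self_mem_nhdsWithin] with k h1 h2 (h3 : k < 0)
  rw [slope_def_field, sub_zero, h0] at h2
  have h4 : shearTrace τ k q - 2 < 0 := by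
    by_contra! hcon
    exact absurd h2 (not_lt.2 (div_nonpos_of_nonneg_of_nonpos hcon h3.le))
  rw [abs_lt]
  exact ⟨h1, by linarith⟩

/-! ### Frames along the curve -/

/-- The velocity of the real curve. -/
def frameTangent (Φ Γ : ℂ → ℂ) (s : ℝ) : ℝ × ℝ := ((deriv Φ s).re, (deriv Γ s).re)

/-- A vertical vector spanning a unit area with the velocity of the real curve. -/
def frameNormal (Φ : ℂ → ℂ) (s : ℝ) : ℝ × ℝ := (0, (deriv Φ s).re⁻¹)

/-- In the frames along the curve at `s` and `s'`, the map `D` has the matrix `[[1, τ], [0, 1]]`. -/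
def IsTwist (Φ Γ : ℂ → ℂ) (D : ℝ × ℝ →L[ℝ] ℝ × ℝ) (τ s s' : ℝ) : Prop :=
  D (frameTangent Φ Γ s) = frameTangent Φ Γ s' ∧
    D (frameNormal Φ s) = frameNormal Φ s' + τ • frameTangent Φ Γ s'

theorem IsTwist.comp {Φ Γ : ℂ → ℂ} {D D' : ℝ × ℝ →L[ℝ] ℝ × ℝ} {τ τ' s s' s'' : ℝ}
    (h' : IsTwist Φ Γ D' τ' s' s'') (h : IsTwist Φ Γ D τ s s') :
    IsTwist Φ Γ (D'.comp D) (τ + τ') s s'' := by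
  constructor
  · rw [ContinuousLinearMap.comp_apply, h.1, h'.1]
  · rw [ContinuousLinearMap.comp_apply, h.2, map_add, map_smul, h'.1, h'.2, add_smul]
    abel

/-- A linear map whose restriction to the frames is given by a product of shears has the
corresponding trace. -/
theorem planeTrace_eq_of_frame {Φ Γ : ℂ → ℂ} {D : ℝ × ℝ →L[ℝ] ℝ × ℝ} {s : ℝ}
    (hs : (deriv Φ s).re ≠ 0) {A B C E : ℝ}
    (h1 : D (frameTangent Φ Γ s) = A • frameTangent Φ Γ s + C • frameNormal Φ s)
    (h2 : D (frameNormal Φ s) = B • frameTangent Φ Γ s + E • frameNormal Φ s) :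
    planeTrace D = A + E := by
  set a := (deriv Φ s).re with ha
  set b := (deriv Γ s).re with hb
  have e1 : ((0, 1) : ℝ × ℝ) = a • frameNormal Φ s := by
    ext <;> simp [frameNormal, ← ha, hs]
  have e2 : ((1, 0) : ℝ × ℝ) = a⁻¹ • (frameTangent Φ Γ s - b • ((0, 1) : ℝ × ℝ)) := by
    ext <;> simp [frameTangent, ← ha, ← hb, hs]
  have f1 : D (0, 1) = a • (B • frameTangent Φ Γ s + E • frameNormal Φ s) := by
    rw [e1, map_smul, h2]
  rw [planeTrace, e2, map_smul, map_sub, map_smul, h1, f1]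
  simp only [frameTangent, frameNormal, ← ha, ← hb, Prod.smul_mk, Prod.mk_add_mk, Prod.mk_sub_mk,
    smul_eq_mul]
  field_simp
  ring

namespace IsGraphLift

variable {r : ℝ} {Φ Γ : ℂ → ℂ} {d : ℤ} (h : IsGraphLift r Φ Γ d)

theorem hasDerivAt_realCurve (h : IsGraphLift r Φ Γ d) (s : ℝ) :
    HasDerivAt (realCurve Φ Γ) (frameTangent Φ Γ s) s := by
  have hs := ofReal_mem_strip h.pos s
  exact (h.hasDerivAt hs).real_of_complex.prodMk
    (h.diffΓ.differentiableAt ((isOpen_strip r).mem_nhds hs)).hasDerivAt.real_of_complex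

/-- The real derivative never vanishes and, since `Φ` gains `1` over a period, equals `1` somewhere
by the mean value theorem. -/
theorem deriv_re_pos (h : IsGraphLift r Φ Γ d) (s : ℝ) : 0 < (deriv Φ s).re := by
  have hd : ∀ s : ℝ, HasDerivAt (fun s : ℝ => (Φ s).re) (deriv Φ s).re s := fun s =>
    (h.hasDerivAt (ofReal_mem_strip h.pos s)).real_of_complex
  have hcont : Continuous fun s : ℝ => (deriv Φ s).re :=
    Complex.continuous_re.comp ((h.diffΦ.deriv (isOpen_strip r)).continuousOn.comp_continuous
      Complex.continuous_ofReal fun s => ofReal_mem_strip h.pos s)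
  obtain ⟨c, -, hc⟩ := exists_hasDerivAt_eq_slope (fun s : ℝ => (Φ s).re) _ zero_lt_one
    h.continuous_re.continuousOn fun s _ => hd s
  have h1 : (deriv Φ c).re = 1 := by
    rw [hc]
    have := congrArg Complex.re (h.perΦ 0 (ofReal_mem_strip h.pos 0))
    simp at this
    simp [this]
  by_contra! hcon
  obtain ⟨t, ht⟩ := mem_range_of_exists_le_of_exists_ge hcont ⟨s, hcon⟩
    ⟨c, by rw [h1]; exact zero_le_one⟩
  refine h.deriv_ne t (ofReal_mem_strip h.pos t) ?_
  rw [h.deriv_ofReal]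
  exact_mod_cast ht

/-- The frames span unit area, so area preservation forces the normal coefficient to be `1`. The
tangential coefficient has the sign of the twist because `frameNormal` is a positive multiple of
`(0, 1)` and the curve runs to the right. -/
theorem isTwist_of_areaForm (h : IsGraphLift r Φ Γ d) {D : ℝ × ℝ →L[ℝ] ℝ × ℝ} {s s' : ℝ}
    (ht : D (frameTangent Φ Γ s) = frameTangent Φ Γ s')
    (hD : ∀ u v, areaForm (D u) (D v) = areaForm u v) (hpos : 0 < (D (0, 1)).1) :
    ∃ τ > 0, IsTwist Φ Γ D τ s s' := by
  have ha := h.deriv_re_pos s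
  have ha' := h.deriv_re_pos s'
  have e1 : frameNormal Φ s = (deriv Φ s).re⁻¹ • ((0, 1) : ℝ × ℝ) := by
    ext <;> simp [frameNormal]
  have e2 := hD (frameTangent Φ Γ s) (frameNormal Φ s)
  set w := D (frameNormal Φ s) with hw
  have hw1 : 0 < w.1 := by
    rw [hw, e1, map_smul]
    exact mul_pos (inv_pos.2 ha) hpos
  rw [ht] at e2
  simp only [areaForm, frameTangent, frameNormal, mul_zero, sub_zero, mul_inv_cancel₀ ha.ne'] at e2
  refine ⟨w.1 / (deriv Φ s').re, div_pos hw1 ha', ht, ?_⟩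
  rw [← hw]
  ext
  · simp [frameNormal, frameTangent, ha'.ne']
  · simp only [frameNormal, frameTangent, Prod.snd_add, Prod.smul_snd, smul_eq_mul]
    field_simp
    linarith

/-- A map which translates the curve translates its velocity. -/
theorem map_frameTangent (h : IsGraphLift r Φ Γ d) {f : RTorus → RTorus} {F : ℝ × ℝ → ℝ × ℝ}
    (hF : ∀ q, projR (F q) = f (projR q)) {ω : ℝ}
    (hf : ∀ s, f (projR (realCurve Φ Γ s)) = projR (realCurve Φ Γ (s + ω)))
    {D : ℝ × ℝ →L[ℝ] ℝ × ℝ} {s : ℝ} (hD : HasFDerivAt F D (realCurve Φ Γ s)) :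
    D (frameTangent Φ Γ s) = frameTangent Φ Γ (s + ω) := by
  have h1 : HasDerivAt (fun s => F (realCurve Φ Γ s)) (D (frameTangent Φ Γ s)) s :=
    hD.comp_hasDerivAt s (h.hasDerivAt_realCurve s)
  have h2 : HasDerivAt (fun s => realCurve Φ Γ (s + ω)) (frameTangent Φ Γ (s + ω)) s :=
    (h.hasDerivAt_realCurve (s + ω)).comp_add_const s ω
  have h3 := h1.continuousAt.eventually_eq_add_of_projR h2.continuousAt
    (Eventually.of_forall fun s => by rw [hF, hf])
  exact h1.unique ((h2.add_const _).congr_of_eventuallyEq h3)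

theorem frameTangent_add_int (h : IsGraphLift r Φ Γ d) (s : ℝ) (m : ℤ) :
    frameTangent Φ Γ (s + m) = frameTangent Φ Γ s ∧ frameNormal Φ (s + m) = frameNormal Φ s := by
  have hs := ofReal_mem_strip h.pos s
  have hev : ∀ᶠ z in 𝓝 (s : ℂ), z ∈ strip r := (isOpen_strip r).mem_nhds hs
  have e1 : deriv Φ (s + m) = deriv Φ s := by
    rw [← deriv_comp_add_const]
    have : (fun z => Φ (z + m)) =ᶠ[𝓝 (s : ℂ)] fun z => Φ z + m :=
      hev.mono fun z hz => h.apply_add_int hz m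
    rw [this.deriv_eq, deriv_add_const]
  have e2 : deriv Γ (s + m) = deriv Γ s := by
    rw [← deriv_comp_add_const]
    have : (fun z => Γ (z + m)) =ᶠ[𝓝 (s : ℂ)] fun z => Γ z + m * d :=
      hev.mono fun z hz => h.apply_add_int' hz m
    rw [this.deriv_eq, deriv_add_const]
  simp only [frameTangent, frameNormal]
  push_cast
  rw [e1, e2]
  exact ⟨rfl, rfl⟩

theorem projR_realCurve_eq_iff (h : IsGraphLift r Φ Γ d) {s t : ℝ} :
    projR (realCurve Φ Γ s) = projR (realCurve Φ Γ t) ↔ ∃ m : ℤ, s = t + m := by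
  have hs := ofReal_mem_strip h.pos s
  have ht := ofReal_mem_strip h.pos t
  constructor
  · intro e
    obtain ⟨m, n, hmn⟩ := projR_eq_iff.1 e
    have h1 := congrArg Prod.fst hmn
    simp only [realCurve, Prod.fst_add] at h1
    have h2 : Φ s = Φ (t + m) := by
      rw [h.apply_add_int ht, ← h.ofReal_re, ← h.ofReal_re t]
      exact_mod_cast h1
    exact ⟨m, by exact_mod_cast h.inj hs (add_int_mem_strip ht m) h2⟩
  · rintro ⟨m, rfl⟩
    refine projR_eq_iff.2 ⟨m, m * d, ?_⟩
    have h1 := congrArg Complex.re (h.apply_add_int ht m)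
    have h2 := congrArg Complex.re (h.apply_add_int' ht m)
    simp only [realCurve]
    push_cast
    ext
    · simpa using h1
    · simpa using h2

end IsGraphLift

/-- The derivative of an iterate along an orbit. -/
theorem hasFDerivAt_iterate_of_hasTorusDerivAt {f : RTorus → RTorus} {F : ℝ × ℝ → ℝ × ℝ}
    (hFc : Continuous F) (hF : ∀ q, projR (F q) = f (projR q)) {D : ℕ → ℝ × ℝ →L[ℝ] ℝ × ℝ}
    {x : ℝ × ℝ} (hD : ∀ j, HasTorusDerivAt f (D j) (f^[j] (projR x))) :
    ∃ P : ℕ → ℝ × ℝ →L[ℝ] ℝ × ℝ, P 0 = ContinuousLinearMap.id ℝ _ ∧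
      (∀ j, P (j + 1) = (D j).comp (P j)) ∧
      ∀ j, projR (F^[j] x) = f^[j] (projR x) ∧ HasFDerivAt F^[j] (P j) x := by
  refine ⟨fun j => Nat.rec (ContinuousLinearMap.id ℝ _) (fun j P => (D j).comp P) j, rfl,
    fun _ => rfl, fun j => ?_⟩
  induction j with
  | zero => exact ⟨rfl, hasFDerivAt_id x⟩
  | succ j ih =>
    rw [Function.iterate_succ', Function.iterate_succ']
    refine ⟨by rw [Function.comp_apply, Function.comp_apply, hF, ih.1], ?_⟩
    have h1 := hD j
    rw [← ih.1] at h1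
    exact (h1.hasFDerivAt_lift hFc hF).comp x ih.2

/-! ### Periodic points on the curve -/

namespace IsGraphLift

variable {r : ℝ} {Φ Γ : ℂ → ℂ} {d : ℤ} (h : IsGraphLift r Φ Γ d)

/-- The vertical perturbation of the plane by a multiple of `wave`. -/
def waveShear (M : ℕ) (ε : ℝ) (x : ℝ × ℝ) : ℝ × ℝ := (x.1, x.2 + ε * (h.wave M x.1).re)

theorem wave_re_realCurve {M : ℕ} {s : ℝ} (hs : Real.sin (2 * Real.pi * M * s) = 0) :
    (h.wave M (realCurve Φ Γ s).1).re = 0 := by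
  have hsin : Complex.sin (2 * Real.pi * M * s) = 0 := by exact_mod_cast hs
  simp only [realCurve]
  rw [h.ofReal_re, h.wave_apply M (ofReal_mem_strip h.pos s), hsin]
  simp

theorem waveShear_realCurve {M : ℕ} {s : ℝ} (hs : Real.sin (2 * Real.pi * M * s) = 0) (ε : ℝ) :
    h.waveShear M ε (realCurve Φ Γ s) = realCurve Φ Γ s := by
  rw [waveShear, h.wave_re_realCurve hs]
  simp

theorem exists_hasFDerivAt_waveShear {M : ℕ} {s : ℝ} (hs : Real.sin (2 * Real.pi * M * s) = 0)
    (ε : ℝ) : ∃ D : ℝ × ℝ →L[ℝ] ℝ × ℝ, HasFDerivAt (h.waveShear M ε) D (realCurve Φ Γ s) ∧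
      D (frameTangent Φ Γ s) = frameTangent Φ Γ s +
        (ε * (2 * Real.pi * M * Real.cos (2 * Real.pi * M * s))) • frameNormal Φ s ∧
      D (frameNormal Φ s) = frameNormal Φ s := by
  have ha := h.deriv_re_pos s
  have h0 : HasFDerivAt (fun x : ℝ × ℝ => x.1) (ContinuousLinearMap.fst ℝ ℝ ℝ) (realCurve Φ Γ s) :=
    hasFDerivAt_fst
  have h1 := (h.hasDerivAt_wave M hs).comp_hasFDerivAt_of_eq (realCurve Φ Γ s) h0 rfl
  refine ⟨_, hasFDerivAt_fst.prodMk (hasFDerivAt_snd.add (h1.const_mul ε)), ?_, ?_⟩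
  · ext
    · simp [frameTangent, frameNormal]
    · simp [frameTangent, frameNormal]
      field_simp
  · ext <;> simp [frameNormal]

/-- The orbit of a point of the curve under a perturbed twist map. -/
theorem exists_deriv_iterate {f g : RTorus → RTorus} (hf : IsHamDiffeo f) (hg : IsHamDiffeo g)
    {p : ℤ} {q : ℕ} (hq : 0 < q) (hpq : IsCoprime p q)
    (hconj : ∀ s, f (projR (realCurve Φ Γ s)) = projR (realCurve Φ Γ (s + p / q)))
    {τ : ℝ → ℝ} (htw : ∀ s, ∃ D, HasTorusDerivAt f D (projR (realCurve Φ Γ s)) ∧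
      IsTwist Φ Γ D (τ s) s (s + p / q)) {N : ℕ} {ε : ℝ}
    (hgV : ∀ x, g (projR x) = projR (h.waveShear (q * N) ε x)) {s σ : ℝ}
    (hsin : Real.sin (2 * Real.pi * (q * N : ℕ) * s) = 0)
    (hcos : Real.cos (2 * Real.pi * (q * N : ℕ) * s) = σ) :
    Function.minimalPeriod (f ∘ g) (projR (realCurve Φ Γ s)) = q ∧
    ∃ D : ℝ × ℝ →L[ℝ] ℝ × ℝ, HasTorusDerivAt (f ∘ g)^[q] D (projR (realCurve Φ Γ s)) ∧
      (∀ u v, areaForm (D u) (D v) = areaForm u v) ∧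
      planeTrace D = shearTrace (fun j => τ (s + j * (p / q)))
        (ε * (2 * Real.pi * (q * N : ℕ) * σ)) q := by
  set M := q * N with hM
  have hqR : (q : ℝ) ≠ 0 := by exact_mod_cast hq.ne'
  -- Since `q` divides `M`, rotation by `p / q` changes the phase by a multiple of `2π`: the whole
  -- orbit consists of zeros of `wave` with the same slope sign, hence the same `k`.
  have harg : ∀ j : ℕ, 2 * Real.pi * M * (s + j * (p / q))
      = 2 * Real.pi * M * s + ((N * j * p : ℤ) : ℝ) * (2 * Real.pi) := by
    intro j
    rw [hM]; push_cast; field_simp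
  have hsin' : ∀ j : ℕ, Real.sin (2 * Real.pi * M * (s + j * (p / q))) = 0 := fun j => by
    rw [harg, Real.sin_add_int_mul_two_pi, hsin]
  have hcos' : ∀ j : ℕ, Real.cos (2 * Real.pi * M * (s + j * (p / q))) = σ := fun j => by
    rw [harg, Real.cos_add_int_mul_two_pi, hcos]
  set c : ℕ → ℝ := fun j => s + j * (p / q) with hc
  have hc1 : ∀ j, c j + p / q = c (j + 1) := fun j => by simp only [hc]; push_cast; ring
  have hc0 : c 0 = s := by simp [hc]
  have hcq : c q = s + p := by simp only [hc]; field_simp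
  have hiter : ∀ j, (f ∘ g)^[j] (projR (realCurve Φ Γ s)) = projR (realCurve Φ Γ (c j)) := by
    intro j
    induction j with
    | zero => simp [hc0]
    | succ j ih =>
      rw [Function.iterate_succ_apply', ih, Function.comp_apply, hgV,
        h.waveShear_realCurve (hsin' j), hconj, hc1]
  obtain ⟨F, hF, hFf⟩ := hf.exists_lift
  -- A second lift: the explicit `F ∘ h.waveShear M ε` yields the one-step derivatives, and the
  -- continuous `F₁` is the map that is iterated.
  obtain ⟨F₁, hF₁, hF₁f⟩ := (IsHamDiffeo.comp f g hf hg).exists_lift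
  have hlift : ∀ x, projR ((F ∘ h.waveShear M ε) x) = (f ∘ g) (projR x) := fun x => by
    rw [Function.comp_apply, Function.comp_apply, hFf, hgV]
  set k := ε * (2 * Real.pi * M * σ) with hk
  have hstep : ∀ j, ∃ D : ℝ × ℝ →L[ℝ] ℝ × ℝ,
      HasTorusDerivAt (f ∘ g) D ((f ∘ g)^[j] (projR (realCurve Φ Γ s))) ∧
      (∀ u v, areaForm (D u) (D v) = areaForm u v) ∧
      D (frameTangent Φ Γ (c j)) = (1 + k * τ (c j)) • frameTangent Φ Γ (c (j + 1))
        + k • frameNormal Φ (c (j + 1)) ∧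
      D (frameNormal Φ (c j)) = frameNormal Φ (c (j + 1))
        + τ (c j) • frameTangent Φ Γ (c (j + 1)) := by
    intro j
    rw [hiter]
    obtain ⟨DV, hDV, hDVt, hDVn⟩ := h.exists_hasFDerivAt_waveShear (hsin' j) ε
    obtain ⟨D, hD, hDt, hDn⟩ := htw (c j)
    have h1 := hD.hasFDerivAt_lift hF.continuous hFf
    have h2 : HasFDerivAt (F ∘ h.waveShear M ε) (D.comp DV) (realCurve Φ Γ (c j)) :=
      HasFDerivAt.comp _ (by rw [h.waveShear_realCurve (hsin' j)]; exact h1) hDV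
    refine ⟨_, hasTorusDerivAt_of_lift hlift h2,
      (IsHamDiffeo.comp f g hf hg).areaForm_deriv hlift h2, ?_, ?_⟩
    · rw [ContinuousLinearMap.comp_apply, hDVt, hcos' j, map_add, map_smul]
      change D (frameTangent Φ Γ (c j)) + k • D (frameNormal Φ (c j)) = _
      rw [hDt, hDn, hc1, smul_add, smul_smul, add_smul, one_smul]
      abel
    · rw [ContinuousLinearMap.comp_apply, hDVn, hDn, hc1]
  choose D hD hDarea hDt hDn using hstep
  obtain ⟨P, hP0, hPs, hP⟩ := hasFDerivAt_iterate_of_hasTorusDerivAt hF₁.continuous hF₁f hD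
  have hParea : ∀ j u v, areaForm (P j u) (P j v) = areaForm u v := by
    intro j
    induction j with
    | zero => intro u v; rw [hP0]; rfl
    | succ j ih => intro u v; rw [hPs, ContinuousLinearMap.comp_apply,
        ContinuousLinearMap.comp_apply, hDarea, ih]
  have hPframe : ∀ (v : ℝ × ℝ) j, P j (v.1 • frameTangent Φ Γ s + v.2 • frameNormal Φ s)
      = (shearOrbit (fun j => τ (c j)) k v j).1 • frameTangent Φ Γ (c j)
        + (shearOrbit (fun j => τ (c j)) k v j).2 • frameNormal Φ (c j) := by
    intro v j
    induction j with
    | zero => rw [hP0, hc0]; rfl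
    | succ j ih =>
      rw [hPs, ContinuousLinearMap.comp_apply, ih, map_add, map_smul, map_smul, hDt, hDn, shearOrbit]
      module
  constructor
  · apply Nat.dvd_antisymm
    · apply Function.IsPeriodicPt.minimalPeriod_dvd
      rw [Function.IsPeriodicPt, Function.IsFixedPt, hiter, hcq]
      exact h.projR_realCurve_eq_iff.2 ⟨p, rfl⟩
    · have := Function.isPeriodicPt_minimalPeriod (f ∘ g) (projR (realCurve Φ Γ s))
      rw [Function.IsPeriodicPt, Function.IsFixedPt, hiter, h.projR_realCurve_eq_iff] at this
      obtain ⟨m, hm⟩ := this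
      set j := Function.minimalPeriod (f ∘ g) (projR (realCurve Φ Γ s))
      have h1 : (j : ℝ) * p = m * q := by
        have : (j : ℝ) * (p / q) = m := by simp only [hc] at hm; linarith
        rw [← this]; field_simp
      have h2 : (q : ℤ) ∣ p * j := ⟨m, by rw [mul_comm p, mul_comm (q : ℤ)]; exact_mod_cast h1⟩
      exact Int.natCast_dvd_natCast.1 (hpq.symm.dvd_of_dvd_mul_left h2)
  · refine ⟨P q, ⟨_, _, rfl, Eventually.of_forall fun y => ?_, (hP q).2⟩, hParea q, ?_⟩
    · clear hP
      have : ∀ j, projR (F₁^[j] y) = (f ∘ g)^[j] (projR y) := by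
        intro j
        induction j with
        | zero => rfl
        | succ j ih => rw [Function.iterate_succ_apply', Function.iterate_succ_apply', hF₁f, ih]
      exact this q
    · obtain ⟨e1, e2⟩ := h.frameTangent_add_int s p
      have ht := hPframe (1, 0) q
      have hn := hPframe (0, 1) q
      rw [hcq, e1, e2] at ht hn
      simp only [one_smul, zero_smul, add_zero, zero_add] at ht hn
      exact planeTrace_eq_of_frame (h.deriv_re_pos s).ne' ht hn

/-- The kick has `k > 0` at the parameters `i / M` and `k < 0` at `(i + 1/2) / M`, with `0 ≤ i < M`.
Only the elliptic points need `ε` small, and they are finitely many, so one bound on `ε` suffices,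
valid for every `g` lifted by the shear. -/
theorem eventually_many_periodic_points {f : RTorus → RTorus} (hf : IsHamDiffeo f)
    {p : ℤ} {q : ℕ} (hq : 0 < q) (hpq : IsCoprime p q)
    (hconj : ∀ s, f (projR (realCurve Φ Γ s)) = projR (realCurve Φ Γ (s + p / q)))
    (htw : ∀ s, ∃ D, HasTorusDerivAt f D (projR (realCurve Φ Γ s)) ∧
      ∃ τ > 0, IsTwist Φ Γ D τ s (s + p / q)) {N : ℕ} (hN : 0 < N) :
    ∀ᶠ ε in 𝓝[>] (0 : ℝ), ∀ g, IsHamDiffeo g →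
      (∀ x, g (projR x) = projR (h.waveShear (q * N) ε x)) →
      ((q * N : ℕ) : ℕ∞) ≤ min (perHyp (f ∘ g) q).encard (perEll (f ∘ g) q).encard := by
  choose D₀ hD₀ τ hτ htw using htw
  have htw' : ∀ s, ∃ D, HasTorusDerivAt f D (projR (realCurve Φ Γ s)) ∧
      IsTwist Φ Γ D (τ s) s (s + p / q) := fun s => ⟨D₀ s, hD₀ s, htw s⟩
  set M := q * N with hM
  have hMpos : 0 < M := Nat.mul_pos hq hN
  have hMR : (0 : ℝ) < M := by exact_mod_cast hMpos
  have hpi := Real.pi_pos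
  set sH : Fin M → ℝ := fun i => (i : ℕ) / (M : ℝ) with hsH
  set sE : Fin M → ℝ := fun i => ((i : ℕ) + 1 / 2) / (M : ℝ) with hsE
  have argH : ∀ i, 2 * Real.pi * M * sH i = ((i : ℕ) : ℝ) * (2 * Real.pi) := fun i => by
    simp only [hsH]; field_simp
  have argE : ∀ i, 2 * Real.pi * M * sE i = Real.pi + ((i : ℕ) : ℝ) * (2 * Real.pi) := fun i => by
    simp only [hsE]; field_simp; ring
  have sinH : ∀ i, Real.sin (2 * Real.pi * M * sH i) = 0 := fun i => by
    rw [argH]; simpa using Real.sin_add_nat_mul_two_pi 0 i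
  have cosH : ∀ i, Real.cos (2 * Real.pi * M * sH i) = 1 := fun i => by
    rw [argH]; exact Real.cos_nat_mul_two_pi i
  have sinE : ∀ i, Real.sin (2 * Real.pi * M * sE i) = 0 := fun i => by
    rw [argE, Real.sin_add_nat_mul_two_pi, Real.sin_pi]
  have cosE : ∀ i, Real.cos (2 * Real.pi * M * sE i) = -1 := fun i => by
    rw [argE, Real.cos_add_nat_mul_two_pi, Real.cos_pi]
  have hinj : ∀ a : ℝ, Function.Injective fun i : Fin M =>
      projR (realCurve Φ Γ (((i : ℕ) + a) / M)) := by
    intro a i j hij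
    obtain ⟨m, hm⟩ := h.projR_realCurve_eq_iff.1 hij
    have h1 : ((i : ℕ) : ℝ) = (j : ℕ) + m * M := by
      field_simp at hm; linarith
    have h2 : ((i : ℕ) : ℤ) = (j : ℕ) + m * M := by exact_mod_cast h1
    have h3 := i.2
    have h4 := j.2
    have h5 : m = 0 := by
      by_contra hm0
      rcases lt_or_gt_of_ne hm0 with h6 | h6
      · have : m * M ≤ -M := by nlinarith
        omega
      · have : (M : ℤ) ≤ m * M := by nlinarith
        omega
    rw [h5] at h2
    ext
    omega
  have hcount : ∀ (a : ℝ) (S : Set RTorus),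
      (∀ i : Fin M, projR (realCurve Φ Γ (((i : ℕ) + a) / M)) ∈ S) → ((M : ℕ) : ℕ∞) ≤ S.encard := by
    intro a S hS
    have h1 : (range fun i : Fin M => projR (realCurve Φ Γ (((i : ℕ) + a) / M))).encard = M := by
      rw [← image_univ, (hinj a).encard_image, encard_univ]
      simp
    rw [← h1]
    exact encard_le_encard (range_subset_iff.2 hS)
  have hell : ∀ᶠ ε in 𝓝[>] (0 : ℝ), ∀ i : Fin M, |shearTrace (fun j => τ (sE i + j * (p / q)))
      (ε * (2 * Real.pi * M * (-1))) q| < 2 := by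
    rw [eventually_all]
    intro i
    have ht : Tendsto (fun ε : ℝ => ε * (2 * Real.pi * M * (-1))) (𝓝[>] 0) (𝓝[<] 0) := by
      refine tendsto_nhdsWithin_iff.2 ⟨?_, ?_⟩
      · have : Continuous fun ε : ℝ => ε * (2 * Real.pi * M * (-1)) := by fun_prop
        simpa using (this.tendsto 0).mono_left nhdsWithin_le_nhds
      · filter_upwards [self_mem_nhdsWithin] with ε (hε : 0 < ε)
        have : 0 < ε * (2 * Real.pi * M) := by positivity
        simp only [mem_Iio]
        linarith
    exact ht.eventually (eventually_abs_shearTrace_lt_two (fun j => hτ _) hq)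
  filter_upwards [hell, self_mem_nhdsWithin] with ε hell (hε : 0 < ε) g hg hgV
  refine le_min (hcount 0 _ fun i => ?_) (hcount (1 / 2) _ fun i => ?_)
  · obtain ⟨hmin, D, hD, harea, htr⟩ := h.exists_deriv_iterate hf hg hq hpq hconj htw' hgV (sinH i) (cosH i)
    rw [add_zero]
    refine ⟨hmin, D, hD, isHyperbolicMap_of_two_lt_trace harea ?_⟩
    rw [htr]
    exact two_lt_shearTrace (fun j => hτ _) (by positivity) hq
  · obtain ⟨hmin, D, hD, harea, htr⟩ := h.exists_deriv_iterate hf hg hq hpq hconj htw' hgV (sinE i) (cosE i)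
    refine ⟨hmin, D, hD, isEllipticMap_of_abs_trace_lt_two harea ?_⟩
    rw [htr]
    exact hell i

end IsGraphLift

/-! ### Compactness, rational approximation and the main theorem -/

/-- Estimates on periodic maps of `ℂ²` need only be made on a compact set of representatives. It is
obtained by covering `Q` with images of compact neighbourhoods. -/
theorem exists_isCompact_lift {Q W : Set CTorus} (hQ : IsCompact Q) (hW : IsOpen W) (hQW : Q ⊆ W) :
    ∃ L : Set (ℂ × ℂ), IsCompact L ∧ (∀ p ∈ L, projC p ∈ W) ∧ Q ⊆ projC '' L := by
  refine hQ.induction_on (p := fun S => ∃ L : Set (ℂ × ℂ), IsCompact L ∧ (∀ p ∈ L, projC p ∈ W) ∧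
    S ⊆ projC '' L) ⟨∅, isCompact_empty, by simp, by simp⟩ ?_ ?_ ?_
  · rintro s t hst ⟨L, h1, h2, h3⟩
    exact ⟨L, h1, h2, hst.trans h3⟩
  · rintro s t ⟨L, h1, h2, h3⟩ ⟨L', h1', h2', h3'⟩
    refine ⟨L ∪ L', h1.union h1', ?_, ?_⟩
    · rintro p (hp | hp)
      exacts [h2 p hp, h2' p hp]
    · rw [image_union]
      exact union_subset_union h3 h3'
  · intro z hz
    obtain ⟨p, rfl⟩ := projC_surjective z
    have hnhds : projC ⁻¹' W ∈ 𝓝 p := (hW.preimage continuous_projC).mem_nhds (hQW hz)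
    obtain ⟨L, hL, hLW, hLc⟩ := local_compact_nhds hnhds
    refine ⟨projC '' L, mem_nhdsWithin_of_mem_nhds ?_, L, hLc, fun q hq => hLW hq, Subset.rfl⟩
    rw [← map_projC_nhds]
    exact image_mem_map hL

theorem isCompact_realTorus : IsCompact realTorus := by
  have hc : Continuous fun q : ℝ × ℝ => projC (ofReal2 q) :=
    continuous_projC.comp ((Complex.continuous_ofReal.comp continuous_fst).prodMk
      (Complex.continuous_ofReal.comp continuous_snd))
  have : realTorus = (fun q : ℝ × ℝ => projC (ofReal2 q)) '' (Icc 0 1 ×ˢ Icc 0 1) := by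
    refine Subset.antisymm ?_ ?_
    · rintro _ ⟨p, rfl⟩
      obtain ⟨q, rfl⟩ := projR_surjective p
      refine ⟨(Int.fract q.1, Int.fract q.2), ⟨⟨Int.fract_nonneg _, (Int.fract_lt_one _).le⟩,
        Int.fract_nonneg _, (Int.fract_lt_one _).le⟩, ?_⟩
      have e : projR (Int.fract q.1, Int.fract q.2) = projR q :=
        projR_eq_iff.2 ⟨-⌊q.1⌋, -⌊q.2⌋, by
          ext <;> simp only [Prod.fst_add, Prod.snd_add, Int.fract] <;> push_cast <;> ring⟩
      exact (torusIncl_projR _).symm.trans (congrArg torusIncl e)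
    · rintro _ ⟨q, -, rfl⟩
      exact ⟨projR q, torusIncl_projR q⟩
  rw [this]
  exact (isCompact_Icc.prod isCompact_Icc).image hc

/-- The image of a closed annulus under a holomorphic curve is contained in a compact set. -/
theorem IsHolomorphicCurve.exists_isCompact {r r' : ℝ} {φ : CCyl → CTorus}
    (hφ : IsHolomorphicCurve r φ) (hr : r' < r) :
    ∃ C, IsCompact C ∧ φ '' annulus r' ⊆ C ∧ C ⊆ φ '' annulus r := by
  set R : Set ℂ := Icc 0 1 ×ℂ Icc (-r') r' with hR
  have hRc : IsCompact R := isCompact_Icc.reProdIm isCompact_Icc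
  have hRr : ∀ s ∈ R, |s.im| < r := fun s hs => (abs_le.2 hs.2).trans_lt hr
  refine ⟨(fun s : ℂ => φ (s : CCyl)) '' R, hRc.image_of_continuousOn fun s hs => ?_, ?_, ?_⟩
  · obtain ⟨G, hG, hGφ⟩ := hφ s (hRr s hs)
    exact ((continuous_projC.continuousAt.comp hG.self_of_nhds.continuousAt).congr
      hGφ).continuousWithinAt
  · rintro _ ⟨_, ⟨s, hs, rfl⟩, rfl⟩
    refine ⟨s - ⌊s.re⌋, ⟨?_, ?_⟩, ?_⟩
    · simp only [mem_preimage, Complex.sub_re, Complex.intCast_re]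
      exact ⟨Int.fract_nonneg _, (Int.fract_lt_one _).le⟩
    · simp only [mem_preimage, Complex.sub_im, Complex.intCast_im, sub_zero]
      exact abs_le.1 (le_of_lt hs)
    · have : ((s - ⌊s.re⌋ : ℂ) : CCyl) = (s : CCyl) :=
        coe_eq_coe_iff_exists_int.2 ⟨-⌊s.re⌋, by push_cast; ring⟩
      simp only [this]
  · rintro _ ⟨s, hs, rfl⟩
    exact ⟨_, ⟨s, hRr s hs, rfl⟩, rfl⟩

/-- Take `q` a large prime. One of the two consecutive integers `⌊qθ⌋` and `⌊qθ⌋ + 1` is not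
divisible by `q`, and both lie within `1` of `qθ`. -/
theorem exists_coprime_div_sub_mem {S : Set ℝ} (hS : S ∈ 𝓝 (0 : ℝ)) (θ : ℝ) (n₀ : ℕ) :
    ∃ (p : ℤ) (q : ℕ), n₀ < q ∧ IsCoprime p q ∧ (p / q - θ : ℝ) ∈ S := by
  obtain ⟨ρ, hρ, hball⟩ := Metric.mem_nhds_iff.1 hS
  obtain ⟨n, hn⟩ := exists_nat_gt (1 / ρ)
  obtain ⟨q, hqn, hq⟩ := Nat.exists_infinite_primes (max (n₀ + 1) n)
  have hqpos : (0 : ℝ) < q := by exact_mod_cast hq.pos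
  have hqρ : 1 < ρ * q := by
    have h1 : (n : ℝ) ≤ q := by exact_mod_cast (le_max_right _ _).trans hqn
    rw [div_lt_iff₀ hρ] at hn
    nlinarith
  obtain ⟨p, hp, hpq⟩ : ∃ p : ℤ, |(p : ℝ) - q * θ| ≤ 1 ∧ ¬ (q : ℤ) ∣ p := by
    have h1 := Int.floor_le (q * θ)
    have h2 := Int.lt_floor_add_one (q * θ)
    by_cases hd : (q : ℤ) ∣ ⌊q * θ⌋
    · refine ⟨⌊q * θ⌋ + 1, ?_, fun hd' => ?_⟩
      · push_cast; rw [abs_le]; constructor <;> linarith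
      · have := (Int.dvd_add_right hd).1 hd'
        have h3 := Int.le_of_dvd one_pos this
        have := hq.two_le
        omega
    · exact ⟨_, by rw [abs_le]; constructor <;> linarith, hd⟩
  refine ⟨p, q, (le_max_left _ _).trans hqn, ?_, hball ?_⟩
  · exact ((Nat.prime_iff_prime_int.1 hq).irreducible.coprime_iff_not_dvd.2 hpq).symm
  · rw [mem_ball_zero_iff, Real.norm_eq_abs]
    have e : (p / q - θ : ℝ) = (p - q * θ) / q := by field_simp
    rw [e, abs_div, abs_of_pos hqpos, div_lt_iff₀ hqpos]
    linarith

namespace IsGraphLift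

variable {r : ℝ} {Φ Γ : ℂ → ℂ} {d : ℤ} (h : IsGraphLift r Φ Γ d)

/-- The complex extension of `IsGraphLift.waveShear`. -/
def waveShearC (M : ℕ) (ε : ℝ) (p : ℂ × ℂ) : ℂ × ℂ := (p.1, p.2 + ε * h.wave M p.1)

theorem waveShearC_ofReal2 (M : ℕ) (ε : ℝ) (q : ℝ × ℝ) :
    h.waveShearC M ε (ofReal2 q) = ofReal2 (h.waveShear M ε q) := by
  simp only [waveShearC, ofReal2, waveShear]
  rw [h.wave_ofReal]
  push_cast
  simp

theorem waveShearC_add_int (M : ℕ) (ε : ℝ) {p : ℂ × ℂ} (hp : p.1 ∈ Φ '' strip r) (m n : ℤ) :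
    h.waveShearC M ε (p + ((m : ℂ), (n : ℂ))) = h.waveShearC M ε p + ((m : ℂ), (n : ℂ)) := by
  simp only [waveShearC, Prod.fst_add, Prod.snd_add, h.wave_add_int M hp, Prod.mk_add_mk,
    Prod.mk.injEq, true_and]
  ring

theorem differentiableAt_waveShearC (M : ℕ) (ε : ℝ) {p : ℂ × ℂ} (hp : p.1 ∈ Φ '' strip r) :
    DifferentiableAt ℂ (h.waveShearC M ε) p := by
  have h1 : DifferentiableAt ℂ (fun p : ℂ × ℂ => h.wave M p.1) p :=
    ((h.differentiableOn_wave M).differentiableAt (h.isOpen_image.mem_nhds hp)).comp p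
      differentiableAt_fst
  unfold waveShearC
  fun_prop

theorem eventually_translate_waveShearC_small {δ η κ : ℝ} {L : Set (ℂ × ℂ)} (hL : IsCompact L)
    (hLΩ : ∀ p ∈ L, p ∈ h.translateDom δ η ∧ ‖h.translate δ η p - p‖ < κ) (M : ℕ) :
    ∀ᶠ ε in 𝓝 (0 : ℝ), ∀ p ∈ L, h.waveShearC M ε p ∈ h.translateDom δ η ∧
      ‖h.translate δ η (h.waveShearC M ε p) - p‖ < κ := by
  refine hL.eventually_forall_of_forall_eventually fun p hp => ?_
  obtain ⟨hp1, hp2⟩ := hLΩ p hp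
  have h0 : h.waveShearC M 0 p = p := by simp [waveShearC]
  have h1 : ContinuousAt (fun z : ℝ × (ℂ × ℂ) => h.wave M z.2.1) (0, p) :=
    ((h.differentiableOn_wave M).continuousOn.continuousAt
      (h.isOpen_image.mem_nhds hp1.1.1)).comp_of_eq (continuousAt_fst.comp continuousAt_snd) rfl
  have h2 : ContinuousAt (fun z : ℝ × (ℂ × ℂ) => h.waveShearC M z.1 z.2) (0, p) := by
    unfold waveShearC
    fun_prop
  have h3 : ContinuousAt (fun z : ℝ × (ℂ × ℂ) =>
      ‖h.translate δ η (h.waveShearC M z.1 z.2) - z.2‖) (0, p) :=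
    (((h.differentiableAt_translate hp1).continuousAt.comp_of_eq h2 h0).sub continuousAt_snd).norm
  exact (h2.eventually ((h.isOpen_translateDom).mem_nhds (by simpa only [h0] using hp1))).and
    (h3.eventually (gt_mem_nhds (by simpa only [h0] using hp2)))

/-- The dynamics on the curve after a translation. -/
theorem exists_isTwist_comp {f g : RTorus → RTorus} (hf : IsHamDiffeo f) (hg : IsHamDiffeo g)
    {θ δ η : ℝ} (hη : 0 < η) (hd : ∀ x : ℝ, (x : ℂ) ∈ h.dom δ η)
    (hgh : ∀ q, g (projR q) = projR (h.translateReal δ η q))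
    (hconj : ∀ s, f (projR (realCurve Φ Γ s)) = projR (realCurve Φ Γ (s + θ)))
    (htw : ∀ s, ∃ D : ℝ × ℝ →L[ℝ] ℝ × ℝ, HasTorusDerivAt f D (projR (realCurve Φ Γ s)) ∧
      0 < (D (0, 1)).1) (s : ℝ) :
    (f ∘ g) (projR (realCurve Φ Γ s)) = projR (realCurve Φ Γ (s + (δ + θ))) ∧
    ∃ D, HasTorusDerivAt (f ∘ g) D (projR (realCurve Φ Γ s)) ∧
      ∃ τ > 0, IsTwist Φ Γ D τ s (s + (δ + θ)) := by
  have hgc := h.translateReal_realCurve hd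
  have hgconj : ∀ s, g (projR (realCurve Φ Γ s)) = projR (realCurve Φ Γ (s + δ)) := fun s => by
    rw [hgh, hgc]
  refine ⟨by rw [Function.comp_apply, hgconj, hconj, add_assoc], ?_⟩
  obtain ⟨F, hF, hFf⟩ := hf.exists_lift
  obtain ⟨D₁, hD₁, hpos₁⟩ := h.exists_hasFDerivAt_translateReal hη hd s
  obtain ⟨D₂, hD₂, hpos₂⟩ := htw (s + δ)
  have hD₂' := hD₂.hasFDerivAt_lift hF.continuous hFf
  obtain ⟨τ₁, hτ₁, ht₁⟩ := h.isTwist_of_areaForm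
    (h.map_frameTangent (fun q => (hgh q).symm) hgconj hD₁)
    (hg.areaForm_deriv (fun q => (hgh q).symm) hD₁) hpos₁
  obtain ⟨τ₂, hτ₂, ht₂⟩ := h.isTwist_of_areaForm (h.map_frameTangent hFf hconj hD₂')
    (hf.areaForm_deriv hFf hD₂') hpos₂
  refine ⟨D₂.comp D₁, hasTorusDerivAt_of_lift (F := F ∘ h.translateReal δ η) (fun q => ?_)
    (HasFDerivAt.comp _ (by rw [hgc]; exact hD₂') hD₁), τ₁ + τ₂, by positivity, ?_⟩
  · rw [Function.comp_apply, Function.comp_apply, hFf, hgh]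
  · rw [← add_assoc]
    exact ht₂.comp ht₁

end IsGraphLift

theorem proposition3p4
    (U₀ : Set CTorus) (hU₀ : IsOpen U₀) (hTU₀ : realTorus ⊆ U₀)
    (f₀ : HamOn U₀)
    (r₀ r' r₁ : ℝ) (hr₁ : 0 < r₁) (hr₁' : r₁ < r') (hr' : r' < r₀)
    (θ : ℝ) (φ₀ : CCyl → CTorus) (hφ₀ : IsGraphKAMCurve f₀ θ r₀ φ₀)
    (K : Set CTorus) (hK : IsCompact K) (hKU₀ : K ⊆ overCurve U₀ φ₀ r₁) :
    ∃ (U₁ : Set CTorus) (hU₁ : U₁ ⊆ U₀),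
      IsOpen U₁ ∧ realTorus ⊆ U₁ ∧
      IsCompact (closure U₁) ∧
      φ₀ '' annulus r' ⊆ U₁ ∧ K ⊆ overCurve U₁ φ₀ r₁ ∧
      ∀ γ : ℕ → ℕ, (∀ n, 1 ≤ n → 0 < γ n) →
      ∀ n₀ : ℕ, 1 ≤ n₀ →
      ∀ 𝒰 ∈ 𝓝 (f₀.restrict hU₁),
        ∃ f₁ ∈ 𝒰, ∃ n₁ : ℕ, n₀ < n₁ ∧
          ((n₁ * γ n₁ : ℕ) : ℕ∞) ≤
            min (perHyp f₁.toMap n₁).encard (perEll f₁.toMap n₁).encard := by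
  have hr₀ : 0 < r₀ := by linarith
  obtain ⟨Φ, Γ, d, θ', h, himage, hconj, htw⟩ := hφ₀.exists_isGraphLift hr₀
  -- `W` lies above the full image of the curve, where the inverse of `Φ` is holomorphic; `U₁` is
  -- taken relatively compact in it.
  set W : Set CTorus := U₀ ∩ {z | z.1 ∈ (fun w => (φ₀ w).1) '' annulus r₀} with hW
  have hWopen : IsOpen W := by
    refine hU₀.inter (IsOpen.preimage continuous_fst ?_)
    rw [himage]
    exact QuotientAddGroup.isOpenMap_coe _ h.isOpen_image
  have hmemΩ : ∀ p : ℂ × ℂ, projC p ∈ W → p.1 ∈ Φ '' strip r₀ := by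
    intro p hp
    obtain ⟨x, hx, e⟩ := himage ▸ hp.2
    obtain ⟨n, hn⟩ := coe_eq_coe_iff_exists_int.1 e.symm
    rw [hn]
    exact h.add_int_mem_image hx n
  have hannulus : ∀ {a b : ℝ}, a ≤ b → annulus a ⊆ annulus b := by
    rintro a b hab _ ⟨s, hs, rfl⟩
    exact ⟨s, lt_of_lt_of_le hs hab, rfl⟩
  obtain ⟨C, hC, hC', hC''⟩ := hφ₀.holomorphic.exists_isCompact hr'
  have hsub : realTorus ∪ C ∪ K ⊆ W := by
    refine union_subset (union_subset ?_ ?_) ?_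
    · rintro _ ⟨p, rfl⟩
      refine ⟨hTU₀ ⟨p, rfl⟩, ?_⟩
      obtain ⟨q, rfl⟩ := projR_surjective p
      rw [himage]
      exact ⟨q.1, h.ofReal_mem_image q.1, rfl⟩
    · intro z hz
      obtain ⟨w, hw, rfl⟩ := hC'' hz
      exact ⟨hφ₀.mapsTo hw, w, hw, rfl⟩
    · intro z hz
      obtain ⟨w, hw, e⟩ := (hKU₀ hz).2
      exact ⟨(hKU₀ hz).1, w, hannulus (by linarith) hw, e⟩
  obtain ⟨U₁, hU₁o, hU₁sub, hU₁W, hU₁c⟩ := exists_open_between_and_isCompact_closure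
    ((isCompact_realTorus.union hC).union hK) hWopen hsub
  have hTU₁ : realTorus ⊆ U₁ := fun z hz => hU₁sub (Or.inl (Or.inl hz))
  have hU₁U₀ : U₁ ⊆ U₀ := fun z hz => (hU₁W (subset_closure hz)).1
  refine ⟨U₁, hU₁U₀, hU₁o, hTU₁, hU₁c,
    fun z hz => hU₁sub (Or.inl (Or.inr (hC' hz))), fun z hz => ⟨hU₁sub (Or.inr hz), (hKU₀ hz).2⟩, ?_⟩
  intro γ hγ n₀ _ 𝒰 h𝒰
  obtain ⟨κ₁, hκ₁, hclose⟩ := f₀.exists_mem_nhds_of_close hU₁U₀ h𝒰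
  obtain ⟨L, hL, hLW, hLU₁⟩ := exists_isCompact_lift hU₁c hWopen hU₁W
  -- A displacement below `κ₂` keeps the points of `L` above `U₀`, where `f₀` can be applied; `κ₁`
  -- measures closeness to `f₀`.
  obtain ⟨κ₂, hκ₂, hthick⟩ := hL.exists_thickening_subset_open (hU₀.preimage continuous_projC)
    fun p hp => (hLW p hp).1
  have hlift : ∀ p : ℂ × ℂ, projC p ∈ U₁ → ∃ l ∈ L, ∃ m n : ℤ, p = l + ((m : ℂ), (n : ℂ)) := by
    intro p hp
    obtain ⟨l, hl, e⟩ := hLU₁ (subset_closure hp)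
    exact ⟨l, hl, projC_eq_iff.1 e.symm⟩
  obtain ⟨η, hη, hδ⟩ := h.exists_translate_small hL (fun p hp => hmemΩ p (hLW p hp))
    (lt_min hκ₁ hκ₂)
  -- The denominator `q` is the period `n₁`. It is fixed before `ε`, so `γ q` may be arbitrarily
  -- large.
  obtain ⟨p, q, hn₀q, hpq, hδpq⟩ := exists_coprime_div_sub_mem hδ θ' n₀
  set δ : ℝ := p / q - θ' with hδdef
  have hq : 0 < q := by omega
  have hN : 0 < γ q := hγ q (by omega)
  -- The torus lies in `U₁`, so each real point is an integer translate of a point of `L`, where the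
  -- domain condition is known.
  have hdom : ∀ x : ℝ, (x : ℂ) ∈ h.dom δ η := by
    intro x
    obtain ⟨l, hl, m, n, e⟩ := hlift (ofReal2 (x, 0)) (hTU₁ ⟨projR (x, 0), rfl⟩)
    have h1 := h.add_int_mem_translateDom (hδpq l hl).1 m n
    rw [← e] at h1
    exact h1.1
  obtain ⟨gE, hgE, hgEh⟩ := h.exists_isHamDiffeo_translateReal hdom
  have hdyn := h.exists_isTwist_comp f₀.isHam hgE hη hdom hgEh hconj htw
  rw [show δ + θ' = p / q by rw [hδdef]; ring] at hdyn
  have hper := h.eventually_many_periodic_points (.comp _ _ f₀.isHam hgE) hq hpq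
    (fun s => (hdyn s).1) (fun s => (hdyn s).2) hN
  have hsmall := (h.eventually_translate_waveShearC_small hL hδpq (q * γ q)).filter_mono
    (nhdsWithin_le_nhds (s := Ioi 0))
  obtain ⟨ε, hper, hsmall⟩ := (hper.and hsmall).exists
  obtain ⟨gV, hgV, hgVh⟩ := h.exists_isHamDiffeo_wave (Nat.mul_pos hq hN).ne' ε
  -- `H` is the complex lift of `gE ∘ gV`. It commutes with integer translations above `U₁`, so the
  -- bounds on `L` extend to all points above `U₁`.
  set H : ℂ × ℂ → ℂ × ℂ := fun p => h.translate δ η (h.waveShearC (q * γ q) ε p) with hH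
  have hV : ∀ l ∈ L, ∀ m n : ℤ, h.waveShearC (q * γ q) ε (l + ((m : ℂ), (n : ℂ)))
      = h.waveShearC (q * γ q) ε l + ((m : ℂ), (n : ℂ)) := fun l hl =>
    h.waveShearC_add_int _ _ (hmemΩ l (hLW l hl))
  have hHl : ∀ l ∈ L, ∀ m n : ℤ, H (l + ((m : ℂ), (n : ℂ))) = H l + ((m : ℂ), (n : ℂ)) := by
    intro l hl m n
    simp only [hH]
    rw [hV l hl, h.translate_add_int (hsmall l hl).1]
  have hHclose : ∀ p, projC p ∈ U₁ → ‖H p - p‖ < min κ₁ κ₂ := by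
    intro p hp
    obtain ⟨l, hl, m, n, rfl⟩ := hlift p hp
    rw [hHl l hl, add_sub_add_right_eq_sub]
    exact (hsmall l hl).2
  have hmaps : ∀ p, projC p ∈ U₁ → projC (H p) ∈ U₀ := by
    intro p hp
    obtain ⟨l, hl, m, n, rfl⟩ := hlift p hp
    have h1 : projC (H l) ∈ U₀ := hthick (Metric.mem_thickening_iff.2
      ⟨l, hl, by rw [dist_eq_norm]; exact (hsmall l hl).2.trans_le (min_le_right _ _)⟩)
    rwa [hHl l hl, projC_eq_iff.2 ⟨m, n, rfl⟩]
  have hHd : ∀ p, projC p ∈ U₁ → DifferentiableAt ℂ H p := by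
    intro p hp
    obtain ⟨l, hl, m, n, rfl⟩ := hlift p hp
    refine DifferentiableAt.comp _ (h.differentiableAt_translate ?_)
      (h.differentiableAt_waveShearC _ _ (h.add_int_mem_image (hmemΩ l (hLW l hl)) m))
    rw [hV l hl]
    exact h.add_int_mem_translateDom (hsmall l hl).1 m n
  have hHper : ∀ p, projC p ∈ U₁ → ∀ m n : ℤ,
      H (p + ((m : ℂ), (n : ℂ))) = H p + ((m : ℂ), (n : ℂ)) := by
    intro p hp m n
    obtain ⟨l, hl, m', n', rfl⟩ := hlift p hp
    have e : ∀ a b a' b' : ℤ, ((a : ℂ), (b : ℂ)) + ((a' : ℂ), (b' : ℂ))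
        = (((a + a' : ℤ) : ℂ), ((b + b' : ℤ) : ℂ)) := fun a b a' b' => by push_cast; rfl
    rw [add_assoc, e, hHl l hl, hHl l hl, add_assoc, e]
  obtain ⟨f₁, hf₁, hf₁ext⟩ := f₀.exists_precomp hU₁o H hHd hHper hmaps (gE ∘ gV)
    (.comp _ _ hgE hgV) (fun x _ => by
      simp only [hH]
      rw [h.waveShearC_ofReal2, h.translate_ofReal2 hdom, Function.comp_apply, hgVh, ← torusIncl_projR]
      congr 1
      exact (hgEh _).symm)
  refine ⟨f₁, hclose f₁ H hmaps hf₁ext fun p hp => (hHclose p hp).trans_le (min_le_left _ _),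
    q, hn₀q, ?_⟩
  rw [hf₁]
  exact hper gV hgV hgVh

end
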